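/- Let $m\ge 0$ be an integer, let $H_m$ be the $(2m+1)$-dimensional space of complex harmonic homogeneous polynomials of degree $m$ on $\mathbb{R}^3$, and let $\tau_m$ be the irreducible unitary representation $(\tau_m(k)p)(x)=p(k^{-1}x)$ of $SO(3)$ on $H_m$. For a finite-dimensional representation $\tau$ of $SO(3)$ on $V$, let $L^p_\tau$ ($p=1,\infty$) be the space of $F\in L^p(\mathbb{R}^3,\mathrm{End}(V))$ with $F(kx)=\tau(k)F(x)\tau(k)^{-1}$ for all $k\in SO(3)$ and almost every $x$. A $\tau$-spherical function is a nonzero $\Phi\in L^\infty_\tau$ such that $F\mapsto\frac{1}{\dim V}\int_{\mathbb{R}^3}\mathrm{Tr}[F(x)\Phi(-x)]\,dx$ is a homomorphism from the convolution algebra $L^1_\tau$ to $\mathbb{C}$; for $\tau=\tau_m$ it is called non-trivial if it is not the constant function $I$. (Functions are identified when they agree almost everywhere.) Let $Y_1=E_{23}-E_{32}$, $Y_2=E_{31}-E_{13}$, $Y_3=E_{12}-E_{21}$ be the standard basis of $so(3)$, where $E_{ab}$ are the matrix units, and let $D_\tau=\sum_{i=1}^3\frac{\partial}{\partial x_i}\,d\tau_m(Y_i)$,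 acting on smooth $\mathrm{End}(H_m)$-valued functions on $\mathbb{R}^3$. For $s>0$ and an integer $j$ with $-m\le j\le m$ put $$D_{s,j}=\prod_{l=-m,\ l\ne j}^{m}\frac{D_\tau-slI}{sj-sl}.$$ Theorem 4. For every $s>0$ there is exactly one smooth classical spherical function $\varphi_s:\mathbb{R}^3\to\mathbb{C}$ of the pair $(SO(3)\ltimes\mathbb{R}^3,SO(3))$ (that is, a spherical function for the trivial representation on $\mathbb{C}$) with $\Delta\varphi_s=-s^2\varphi_s$. For every $s>0$ and every integer $j$ with $-m\le j\le m$ there is exactly one smooth $\tau_m$-spherical function $\Phi_{s,j}$ with $\Delta\Phi_{s,j}=-s^2\Phi_{s,j}$ and $D_\tau\Phi_{s,j}=sj\,\Phi_{s,j}$; it is non-trivial, and $$\Phi_{s,j}=(2m+1)\,D_{s,j}(\varphi_s I).$$ Every non-trivial $\tau_m$-spherical function is equal to $\Phi_{s,j}$ for exactly one pair $(s,j)$ with $s>0$ and $j\in\{-m,\dots,m\}$. -/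

import Mathlib

open MeasureTheory Filter Topology MvPolynomial
open scoped ContDiff Matrix InnerProductSpace

noncomputable section

namespace EuclideanMotion

/-- Euclidean space `ℝ³`. -/
abbrev E3 : Type := EuclideanSpace ℝ (Fin 3)

/-- The rotation group `SO(3)`. -/
abbrev SO3 : Type := Matrix.specialOrthogonalGroup (Fin 3) ℝ

/-- The Lie algebra `so(3)` of skew-symmetric matrices. -/
abbrev so3 : Type := LieAlgebra.Orthogonal.so (Fin 3) ℝ

/-- The natural action `k · x` of `SO(3)` on `ℝ³`. -/
def rot (k : SO3) (x : E3) : E3 := WithLp.toLp 2 ((k : Matrix (Fin 3) (Fin 3) ℝ) *ᵥ x.ofLp)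

theorem exp_mem_SO3 (Y : so3) :
    NormedSpace.exp (Y : Matrix (Fin 3) (Fin 3) ℝ) ∈ Matrix.specialOrthogonalGroup (Fin 3) ℝ := by
  have horth : ∀ A : Matrix (Fin 3) (Fin 3) ℝ, Aᵀ = -A →
      NormedSpace.exp A ∈ Matrix.orthogonalGroup (Fin 3) ℝ := by
    intro A hA
    rw [Matrix.mem_orthogonalGroup_iff, ← Matrix.exp_transpose, hA,
      ← Matrix.exp_add_of_commute _ _ ((Commute.refl A).neg_right), add_neg_cancel,
      NormedSpace.exp_zero]
  have hY : (Y : Matrix (Fin 3) (Fin 3) ℝ)ᵀ = -(Y : Matrix (Fin 3) (Fin 3) ℝ) :=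
    (LieAlgebra.Orthogonal.mem_so (Fin 3) ℝ _).1 Y.2
  refine Matrix.mem_specialOrthogonalGroup_iff.2 ⟨horth _ hY, ?_⟩
  set A : Matrix (Fin 3) (Fin 3) ℝ := (2⁻¹ : ℝ) • (Y : Matrix (Fin 3) (Fin 3) ℝ) with hAdef
  have hA : Aᵀ = -A := by rw [hAdef, Matrix.transpose_smul, hY, smul_neg]
  have hsum : (Y : Matrix (Fin 3) (Fin 3) ℝ) = A + A := by
    rw [hAdef, ← add_smul]; norm_num
  have h1 := (Matrix.mem_orthogonalGroup_iff (Fin 3) ℝ).1 (horth A hA)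
  have h2 := congrArg Matrix.det h1
  rw [Matrix.det_mul, Matrix.det_transpose, Matrix.det_one] at h2
  rw [hsum, Matrix.exp_add_of_commute _ _ (Commute.refl A), Matrix.det_mul, h2]

/-- The exponential map `so(3) → SO(3)`. -/
def expSO3 (Y : so3) : SO3 := ⟨NormedSpace.exp (Y : Matrix (Fin 3) (Fin 3) ℝ), exp_mem_SO3 Y⟩

/-- The basis `Y₁, Y₂, Y₃` of `so(3)`. -/
def Ybasis : Fin 3 → so3 :=
  ![⟨!![0, 0, 0; 0, 0, 1; 0, -1, 0], by
      rw [LieAlgebra.Orthogonal.mem_so]; ext i j; fin_cases i <;> fin_cases j <;> simp⟩,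
    ⟨!![0, 0, -1; 0, 0, 0; 1, 0, 0], by
      rw [LieAlgebra.Orthogonal.mem_so]; ext i j; fin_cases i <;> fin_cases j <;> simp⟩,
    ⟨!![0, 1, 0; -1, 0, 0; 0, 0, 0], by
      rw [LieAlgebra.Orthogonal.mem_so]; ext i j; fin_cases i <;> fin_cases j <;> simp⟩]

section Spherical

variable {V : Type*} [NormedAddCommGroup V] [NormedSpace ℂ V]

/-- The identity `F(k · x) = τ(k) F(x) τ(k)⁻¹`, for each `k` and almost every `x`. -/
def IsEquivariant (τ : SO3 →* (V →L[ℂ] V)) (F : E3 → (V →L[ℂ] V)) : Prop :=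
  ∀ k : SO3, ∀ᵐ x : E3, F (rot k x) = τ k * F x * τ k⁻¹

/-- Membership in `L¹_τ(ℝ³)`. -/
def MemL1 (τ : SO3 →* (V →L[ℂ] V)) (F : E3 → (V →L[ℂ] V)) : Prop :=
  Integrable F ∧ IsEquivariant τ F

/-- Membership in `L^∞_τ(ℝ³)`. -/
def MemLinfty (τ : SO3 →* (V →L[ℂ] V)) (F : E3 → (V →L[ℂ] V)) : Prop :=
  MemLp F ⊤ ∧ IsEquivariant τ F

/-- The convolution `(F₁ * F₂)(x) = ∫ F₁(x - y) F₂(y) dy`. -/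
def conv (F₁ F₂ : E3 → (V →L[ℂ] V)) : E3 → (V →L[ℂ] V) :=
  fun x => ∫ y : E3, F₁ (x - y) * F₂ y

/-- The pairing `(1 / d_τ) ∫ Tr[F(x) Φ(-x)] dx`, with `d_τ = dim V`. -/
def sphericalTransform (F Φ : E3 → (V →L[ℂ] V)) : ℂ :=
  ((Module.finrank ℂ V : ℂ))⁻¹ *
    ∫ x : E3, LinearMap.trace ℂ V ((F x * Φ (-x) : V →L[ℂ] V) : V →ₗ[ℂ] V)

/-- `Φ` represents a `τ`-spherical function: a nonzero element of `L^∞_τ(ℝ³)` such that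
`F ↦ (1 / d_τ) ∫ Tr[F(x) Φ(-x)] dx` is a homomorphism from the convolution algebra `L¹_τ(ℝ³)`
to `ℂ` (linearity in `F` being automatic). -/
structure IsSpherical (τ : SO3 →* (V →L[ℂ] V)) (Φ : E3 → (V →L[ℂ] V)) : Prop where
  memLinfty : MemLinfty τ Φ
  ne_zero : ¬ Φ =ᵐ[volume] 0
  map_conv : ∀ F₁ F₂ : E3 → (V →L[ℂ] V), MemL1 τ F₁ → MemL1 τ F₂ →
    sphericalTransform (conv F₁ F₂) Φ = sphericalTransform F₁ Φ * sphericalTransform F₂ Φ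

/-- The differential `dτ(Y) = d/dt τ(exp tY)` at `t = 0`. -/
def dRep (τ : SO3 →* (V →L[ℂ] V)) (Y : so3) : V →L[ℂ] V :=
  deriv (fun t : ℝ => τ (expSO3 (t • Y))) 0

variable (W : Type*) [NormedAddCommGroup W] [NormedSpace ℂ W]

/-- The space `C^∞(ℝ³, W)`. -/
def Smooth : Submodule ℂ (E3 → W) where
  carrier := {f | ContDiff ℝ ∞ f}
  add_mem' {f g} (hf : ContDiff ℝ ∞ f) (hg : ContDiff ℝ ∞ g) := hf.add hg
  zero_mem' := (contDiff_const : ContDiff ℝ ∞ (fun _ : E3 => (0 : W)))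
  smul_mem' c f (hf : ContDiff ℝ ∞ f) := hf.const_smul c

variable {W}

theorem contDiff_of_smooth (f : Smooth W) : ContDiff ℝ ∞ f.1 := f.2

/-- The partial derivative `∂f/∂xᵢ`. -/
def partialDeriv (i : Fin 3) (f : E3 → W) : E3 → W :=
  fun x => fderiv ℝ f x (EuclideanSpace.single i 1)

/-- The operator `D_τ = ∑ᵢ (∂/∂xᵢ) dτ(Yᵢ)` acting on smooth `End(V)`-valued functions. -/
def Dop (τ : SO3 →* (V →L[ℂ] V)) : Module.End ℂ (Smooth (V →L[ℂ] V)) where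
  toFun f := ⟨fun x => ∑ i, dRep τ (Ybasis i) * partialDeriv i f.1 x, by
    have h : ∀ i, ContDiff ℝ ∞ (partialDeriv i f.1) := fun i =>
      ((contDiff_of_smooth f).fderiv_right (m := ∞) (by simp)).clm_apply contDiff_const
    exact ContDiff.sum (𝕜 := ℝ) fun i _ => contDiff_const.mul (h i)⟩
  map_add' f g := by
    ext1; funext x
    have hf := ((contDiff_of_smooth f).differentiable (by simp)) x
    have hg := ((contDiff_of_smooth g).differentiable (by simp)) x
    simp [partialDeriv, fderiv_add hf hg, mul_add, Finset.sum_add_distrib]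
  map_smul' c f := by
    ext1; funext x
    have hf := ((contDiff_of_smooth f).differentiable (by simp)) x
    simp [partialDeriv, fderiv_const_smul hf, Finset.smul_sum]

/-- The operator `D_{s,j} = ∏_{l ≠ j, -m ≤ l ≤ m} (D_τ - s l I) / (s j - s l)`. The factors commute;
their product is formed as the value at `D_τ` of the corresponding polynomial. -/
def Dlagrange (τ : SO3 →* (V →L[ℂ] V)) (m : ℕ) (s : ℝ) (j : ℤ) :
    Module.End ℂ (Smooth (V →L[ℂ] V)) :=
  Polynomial.aeval (Dop τ)
    (∏ l ∈ (Finset.Icc (-(m : ℤ)) m).erase j,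
      Polynomial.C (((s : ℂ) * j - (s : ℂ) * l)⁻¹) *
        (Polynomial.X - Polynomial.C ((s : ℂ) * l)))

/-- The matrix-valued function `φ I` attached to a smooth scalar function `φ`. -/
def smulI (V : Type*) [NormedAddCommGroup V] [NormedSpace ℂ V] (φ : Smooth ℂ) :
    Smooth (V →L[ℂ] V) :=
  ⟨fun x => φ.1 x • ContinuousLinearMap.id ℂ V, (contDiff_of_smooth φ).smul contDiff_const⟩

/-- `φ` is the (smooth) classical spherical function of the Gelfand pair `(SO(3) ⋉ ℝ³, SO(3))`,
that is, a spherical function for the trivial representation of `SO(3)` on `ℂ`, with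
`Δ φ = -s² φ`. -/
def IsClassicalSpherical (s : ℝ) (φ : Smooth ℂ) : Prop :=
  IsSpherical (1 : SO3 →* (ℂ →L[ℂ] ℂ)) (smulI ℂ φ).1 ∧
    ∀ x, Laplacian.laplacian φ.1 x = -(s : ℂ) ^ 2 * φ.1 x

/-- `Φ` is a (smooth) `τ`-spherical function with `Δ Φ = -s² Φ` and `D_τ Φ = s j Φ`. -/
structure IsSphericalEigen (τ : SO3 →* (V →L[ℂ] V)) (s : ℝ) (j : ℤ) (Φ : Smooth (V →L[ℂ] V)) :
    Prop where
  spherical : IsSpherical τ Φ.1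
  laplacian_eq : ∀ x, Laplacian.laplacian Φ.1 x = (-(s : ℂ) ^ 2) • Φ.1 x
  Dop_eq : Dop τ Φ = ((s : ℂ) * j) • Φ

end Spherical

/-! The representation `τ_m` on harmonic homogeneous polynomials of degree `m`. -/

/-- The Laplacian on polynomials in three variables. -/
def polyLaplacian : MvPolynomial (Fin 3) ℂ →ₗ[ℂ] MvPolynomial (Fin 3) ℂ :=
  ∑ i, (pderiv i).toLinearMap ∘ₗ (pderiv i).toLinearMap

/-- The space `H_m` of harmonic homogeneous polynomials of degree `m` on `ℝ³`. -/
def harmonic (m : ℕ) : Submodule ℂ (MvPolynomial (Fin 3) ℂ) :=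
  homogeneousSubmodule (Fin 3) ℂ m ⊓ LinearMap.ker polyLaplacian

instance (m : ℕ) : Module.Finite ℂ (harmonic m) := by
  have h1 : Module.Finite ℂ (homogeneousSubmodule (Fin 3) ℂ m) :=
    Module.Finite.iff_fg.2 (homogeneousSubmodule_fg _ _ m)
  exact Submodule.finiteDimensional_of_le (inf_le_left : harmonic m ≤ _)

/-- The inner product of `p` and `q`, namely `q(∂/∂x) p̄` at `x = 0` (conjugate-linear in the first
argument), written out on coefficients. -/
def fischer (p q : MvPolynomial (Fin 3) ℂ) : ℂ :=
  ∑ d ∈ p.support, (∏ i, ((d i).factorial : ℂ)) * (starRingEnd ℂ (coeff d p) * coeff d q)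

theorem fischer_eq (p q : MvPolynomial (Fin 3) ℂ) (S : Finset (Fin 3 →₀ ℕ)) (hS : p.support ⊆ S) :
    fischer p q =
      ∑ d ∈ S, (∏ i, ((d i).factorial : ℂ)) * (starRingEnd ℂ (coeff d p) * coeff d q) := by
  refine Finset.sum_subset hS fun d _ hd => ?_
  rw [MvPolynomial.notMem_support_iff.1 hd]; simp

theorem fischer_self (p : MvPolynomial (Fin 3) ℂ) :
    fischer p p = ((∑ d ∈ p.support, (∏ i, ((d i).factorial : ℝ)) * ‖coeff d p‖ ^ 2 : ℝ) : ℂ) := by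
  rw [fischer]; push_cast
  refine Finset.sum_congr rfl fun d _ => ?_
  rw [Complex.conj_mul']

/-- The inner product space structure of `H_m` given by this inner product. -/
@[reducible]
def fischerCore (m : ℕ) : InnerProductSpace.Core ℂ (harmonic m) where
  inner p q := fischer p.1 q.1
  conj_inner_symm p q := by
    classical
    rw [fischer_eq q.1 p.1 _ (Finset.subset_union_right (s₁ := p.1.support)),
      fischer_eq p.1 q.1 _ (Finset.subset_union_left (s₂ := q.1.support)), map_sum]
    refine Finset.sum_congr rfl fun d _ => ?_
    simp [mul_comm]
  re_inner_nonneg p := by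
    rw [fischer_self]; simp only [RCLike.re_to_complex, Complex.ofReal_re]
    positivity
  add_left p q r := by
    classical
    have h : ((p + q : harmonic m).1).support ⊆ p.1.support ∪ q.1.support := support_add
    rw [fischer_eq _ r.1 _ h,
      fischer_eq q.1 r.1 _ (Finset.subset_union_right (s₁ := p.1.support)),
      fischer_eq p.1 r.1 _ (Finset.subset_union_left (s₂ := q.1.support)),
      ← Finset.sum_add_distrib]
    refine Finset.sum_congr rfl fun d _ => ?_
    simp only [Submodule.coe_add, coeff_add, map_add]; ring
  smul_left p q c := by
    have h : ((c • p : harmonic m).1).support ⊆ p.1.support := support_smul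
    rw [fischer_eq _ q.1 _ h, fischer, Finset.mul_sum]
    refine Finset.sum_congr rfl fun d _ => ?_
    simp only [Submodule.coe_smul, coeff_smul, smul_eq_mul, map_mul]; ring
  definite p hp := by
    change fischer p.1 p.1 = 0 at hp
    rw [fischer_self, Complex.ofReal_eq_zero,
      Finset.sum_eq_zero_iff_of_nonneg (fun d _ => by positivity)] at hp
    ext1
    ext d
    by_contra hd
    have h1 := hp d (MvPolynomial.mem_support_iff.2 hd)
    have h2 : (0 : ℝ) < ∏ i, ((d i).factorial : ℝ) :=
      Finset.prod_pos fun i _ => by exact_mod_cast Nat.factorial_pos _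
    rcases mul_eq_zero.1 h1 with h | h
    · exact h2.ne' h
    · exact hd (by simpa using h)

/-- The space `H_m` as a Hilbert space. -/
def H (m : ℕ) : Type := harmonic m

instance (m : ℕ) : NormedAddCommGroup (H m) := (fischerCore m).toNormedAddCommGroup

instance (m : ℕ) : InnerProductSpace ℂ (H m) := InnerProductSpace.ofCore (fischerCore m).toCore

/-- The identity map from `H_m`, as a Hilbert space, to `H_m`, as a space of polynomials. -/
def toPoly (m : ℕ) : H m ≃ₗ[ℂ] harmonic m where
  toFun p := p
  invFun p := p
  map_add' _ _ := rfl
  map_smul' _ _ := rfl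
  left_inv _ := rfl
  right_inv _ := rfl

instance (m : ℕ) : FiniteDimensional ℂ (H m) := Module.Finite.equiv (toPoly m).symm

/-- The linear form `x ↦ (k⁻¹ · x)ᵢ` as a polynomial. -/
def invCoord (k : SO3) (i : Fin 3) : MvPolynomial (Fin 3) ℂ :=
  ∑ j, C (((k⁻¹ : SO3) : Matrix (Fin 3) (Fin 3) ℝ) i j : ℂ) * X j

/-- The substitution `p(x) ↦ p(k⁻¹ · x)` on polynomials. -/
def substInv (k : SO3) : MvPolynomial (Fin 3) ℂ →ₐ[ℂ] MvPolynomial (Fin 3) ℂ :=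
  aeval (invCoord k)

theorem eval_substInv (k : SO3) (p : MvPolynomial (Fin 3) ℂ) (x : E3) :
    eval (fun i => (x i : ℂ)) (substInv k p) = eval (fun i => (rot k⁻¹ x i : ℂ)) p := by
  have h : (aeval (fun i => (x i : ℂ)) : MvPolynomial (Fin 3) ℂ →ₐ[ℂ] ℂ).comp (substInv k) =
      aeval (fun i => (rot k⁻¹ x i : ℂ)) := by
    ext i
    simp [substInv, invCoord, rot, Matrix.mulVec, dotProduct]
  have := DFunLike.congr_fun h p
  simpa [aeval_eq_eval] using this

theorem substInv_one : substInv 1 = AlgHom.id ℂ _ := by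
  ext i : 1
  simp [substInv, invCoord, Matrix.one_apply, apply_ite (Complex.ofReal),
    apply_ite (C : ℂ → MvPolynomial (Fin 3) ℂ)]

theorem substInv_mul (k k' : SO3) : substInv (k * k') = (substInv k).comp (substInv k') := by
  ext i : 1
  simp only [substInv, invCoord, aeval_X, AlgHom.comp_apply, map_sum, map_mul, algHom_C,
    algebraMap_eq, mul_inv_rev, Submonoid.coe_mul, Matrix.mul_apply, Finset.mul_sum,
    Complex.ofReal_sum, Complex.ofReal_mul, map_mul, Finset.sum_mul]
  rw [Finset.sum_comm]
  simp only [mul_assoc]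

theorem pderiv_substInv (k : SO3) (j : Fin 3) (p : MvPolynomial (Fin 3) ℂ) :
    pderiv j (substInv k p) =
      ∑ i, C (((k⁻¹ : SO3) : Matrix (Fin 3) (Fin 3) ℝ) i j : ℂ) * substInv k (pderiv i p) := by
  induction p using MvPolynomial.induction_on with
  | C a => simp [substInv]
  | add p q hp hq => simp [hp, hq, mul_add, Finset.sum_add_distrib]
  | mul_X p n hp =>
    have hX : pderiv j (substInv k (X n)) =
        C (((k⁻¹ : SO3) : Matrix (Fin 3) (Fin 3) ℝ) n j : ℂ) := by
      simp [substInv, invCoord, pderiv_X, Pi.single_apply]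
    rw [map_mul, Derivation.leibniz, hp, hX]
    simp only [Derivation.leibniz, smul_eq_mul, map_add, map_mul, pderiv_X, mul_add,
      Finset.sum_add_distrib, Pi.single_apply]
    simp only [Finset.mul_sum, apply_ite (substInv k), map_one, map_zero, mul_ite, mul_one,
      mul_zero]
    rw [Finset.sum_ite_eq, if_pos (Finset.mem_univ n), mul_comm (substInv k p)]
    refine congrArg₂ (· + ·) rfl (Finset.sum_congr rfl fun i _ => ?_)
    rw [mul_left_comm]

theorem polyLaplacian_apply (p : MvPolynomial (Fin 3) ℂ) :
    polyLaplacian p = ∑ i, pderiv i (pderiv i p) := by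
  simp [polyLaplacian]

theorem polyLaplacian_substInv (k : SO3) (p : MvPolynomial (Fin 3) ℂ) :
    polyLaplacian (substInv k p) = substInv k (polyLaplacian p) := by
  set A : Matrix (Fin 3) (Fin 3) ℝ := ((k⁻¹ : SO3) : Matrix (Fin 3) (Fin 3) ℝ) with hA
  have hAA : A * Aᵀ = 1 := by
    have h := (Matrix.mem_specialOrthogonalGroup_iff.1 (k⁻¹ : SO3).2).1
    rwa [Matrix.mem_orthogonalGroup_iff] at h
  have hent : ∀ i l, ∑ j, (A i j : ℂ) * (A l j : ℂ) = if i = l then 1 else 0 := by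
    intro i l
    have := congrFun (congrFun hAA i) l
    rw [Matrix.mul_apply, Matrix.one_apply] at this
    simp only [Matrix.transpose_apply] at this
    have h2 := congrArg (fun t : ℝ => (t : ℂ)) this
    push_cast at h2
    rw [h2]; split_ifs <;> simp
  rw [polyLaplacian_apply, polyLaplacian_apply, map_sum]
  have h1 : ∀ j, pderiv j (pderiv j (substInv k p)) =
      ∑ i, ∑ l, C ((A i j : ℂ) * (A l j : ℂ)) * substInv k (pderiv l (pderiv i p)) := by
    intro j
    rw [pderiv_substInv, map_sum]
    refine Finset.sum_congr rfl fun i _ => ?_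
    rw [Derivation.leibniz, pderiv_C, smul_zero, add_zero, pderiv_substInv, smul_eq_mul,
      Finset.mul_sum]
    refine Finset.sum_congr rfl fun l _ => ?_
    rw [C_mul, mul_assoc]
  simp only [h1]
  rw [Finset.sum_comm]
  refine Finset.sum_congr rfl fun i _ => ?_
  rw [Finset.sum_comm]
  simp only [← Finset.sum_mul, ← map_sum C, hent]
  simp [apply_ite (C : ℂ → MvPolynomial (Fin 3) ℂ)]

theorem substInv_mem (m : ℕ) (k : SO3) (p : MvPolynomial (Fin 3) ℂ) (hp : p ∈ harmonic m) :
    substInv k p ∈ harmonic m := by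
  refine ⟨?_, ?_⟩
  · have h := hp.1
    rw [SetLike.mem_coe, mem_homogeneousSubmodule] at h ⊢
    have hlin : ∀ i, (invCoord k i).IsHomogeneous 1 := fun i =>
      IsHomogeneous.sum _ _ _ fun j _ => by
        simpa using (isHomogeneous_C (Fin 3) _).mul (isHomogeneous_X ℂ j)
    simpa [substInv] using h.aeval (invCoord k) hlin
  · have h : polyLaplacian p = 0 := hp.2
    change polyLaplacian (substInv k p) = 0
    rw [polyLaplacian_substInv, h, map_zero]

/-- The representation `τ_m` of `SO(3)` on `H_m`, `(τ_m(k) p)(x) = p(k⁻¹ · x)`. -/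
def tau (m : ℕ) : SO3 →* (H m →L[ℂ] H m) where
  toFun k := LinearMap.toContinuousLinearMap ((toPoly m).symm.toLinearMap ∘ₗ
    (substInv k).toLinearMap.restrict (substInv_mem m k) ∘ₗ (toPoly m).toLinearMap)
  map_one' := by
    ext p
    apply (toPoly m).injective
    ext1
    simp [substInv_one]
  map_mul' k k' := by
    ext p
    apply (toPoly m).injective
    ext1
    simp [substInv_mul]
    rfl

theorem toPoly_tau (m : ℕ) (k : SO3) (p : H m) :
    (toPoly m (tau m k p) : MvPolynomial (Fin 3) ℂ) = substInv k (toPoly m p) := by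
  simp [tau]
  rfl

end EuclideanMotion

end

noncomputable section

namespace EuclideanMotion

set_option linter.unusedSectionVars false

/-! ### Rotations of `ℝ³` -/

/-! The argument uses only four properties of the representation, collected in `IsWeightRep`:
unitarity, a differential `J`, simple weights `-m, …, m`, and Schur's lemma. The trivial
representation satisfies them with `m = 0` (`isWeightRep_one`) and `τ_m` satisfies them by a highest
weight argument (`isWeightRep_tau`), so classical and matrix-valued spherical functions are treated
at once.

Regularity and eigenvalue equations. The forms `G ↦ ∫ Tr[G(u) Ψ(-u)] du` on `L¹_τ` separate `L^∞_τ`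
(`ae_eq_zero_of_pairing`), so multiplicativity of the transform is equivalent to a convolution
equation: `F * Φ` is a scalar multiple of `Φ`, the scalar being the transform of `F`
(`lconv_ae_eq`). For a radial bump `F` with nonzero transform this makes `Φ` smooth. Moving
derivatives onto the bump shows that `Φ` is a joint eigenfunction of the Laplacian and `D_τ`
(`exists_laplacian`, `exists_Dop`), that `Tr Φ(0) = dim V` (`tr_zero`), and that iterated
directional derivatives grow at most geometrically (`bernstein`).

Uniqueness. The form `P ↦ Tr[P(∂)Ψ](0)` on matrices of polynomials turns multiplication by the
symbol of `D_τ` on the right, and by `|X|²`, into multiplication by the eigenvalues. The `n`-th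
Taylor coefficient of an equivariant `Ψ` is, up to powers of `|v|`, a polynomial in `J(v)`, because
`J(v)` has simple spectrum and commutes with it (`exists_expansion`). Hence, if `Tr Ψ(0) = 0`, the
form vanishes on the adjoint of that coefficient, where its value is a sum of squares of all
derivatives of order `n`; so every Taylor coefficient is zero (`taylorCoef_eq_zero`). With the
Bernstein bounds, `Ψ = 0`. Applied to a difference, this gives uniqueness for given eigenvalues
(`eq_of_eigen`).

Possible eigenvalues. The normalized trace of `Φ` is a bounded radial eigenfunction of the
Laplacian, so `r ψ(r)` solves `u'' = ev u` and boundedness forces `ev = -s²` with `s > 0`, or `ev =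
0` (`radial_eigenvalue`). In the second case a Liouville argument makes `Φ` constant, hence the
identity by Schur (`eq_one_of_harmonic`). In the first, the identity `Y (Y² + |w|²) ⋯ (Y² + m²|w|²)
= 0` for `Y = J(w)` passes through the same form to the eigenvalue `μ` of `D_τ` and gives `μ = s j`
(`weightProd_eigenvalue`).

Existence. Applied to a superposition of plane waves `e^{is⟨w,x⟩}` over the unit sphere, `D_τ`
multiplies the integrand by `i s J(w)`. So `D_{s,j}`, a Lagrange polynomial in `D_τ`, turns `φ_s I`
into the superposition of the spectral projections of `i s J(w)` for `s j` (`Dlagrange_eq`). Its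
transform at `F` is a diagonal entry of the Fourier transform of `F` at `s e₃/2π` in the weight
basis. That matrix commutes with `J(e₃)`, hence is diagonal, and its entries are multiplicative
under convolution (`isSphericalEigen`). -/

theorem rot_apply (k : SO3) (x : E3) (i : Fin 3) :
    rot k x i = ∑ j, (k : Matrix (Fin 3) (Fin 3) ℝ) i j * x j := rfl

theorem rot_one (x : E3) : rot 1 x = x := by
  simp [rot]

theorem rot_mul (k l : SO3) (x : E3) : rot (k * l) x = rot k (rot l x) := by
  simp [rot, Matrix.mulVec_mulVec]

theorem rot_add (k : SO3) (x y : E3) : rot k (x + y) = rot k x + rot k y := by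
  simp [rot, Matrix.mulVec_add]

theorem rot_smul (k : SO3) (c : ℝ) (x : E3) : rot k (c • x) = c • rot k x := by
  simp [rot, Matrix.mulVec_smul]

theorem rot_neg (k : SO3) (x : E3) : rot k (-x) = -rot k x := by
  simpa using rot_smul k (-1) x

theorem rot_sub (k : SO3) (x y : E3) : rot k (x - y) = rot k x - rot k y := by
  rw [sub_eq_add_neg, rot_add, rot_neg, ← sub_eq_add_neg]

theorem rot_zero (k : SO3) : rot k 0 = 0 := by
  simpa using rot_smul k 0 0

theorem rot_inv_rot (k : SO3) (x : E3) : rot k⁻¹ (rot k x) = x := by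
  rw [← rot_mul, inv_mul_cancel, rot_one]

theorem rot_rot_inv (k : SO3) (x : E3) : rot k (rot k⁻¹ x) = x := by
  rw [← rot_mul, mul_inv_cancel, rot_one]

theorem SO3_mul_transpose (k : SO3) :
    (k : Matrix (Fin 3) (Fin 3) ℝ) * (k : Matrix (Fin 3) (Fin 3) ℝ)ᵀ = 1 := by
  have h := (Matrix.mem_specialOrthogonalGroup_iff.1 k.2).1
  rwa [Matrix.mem_orthogonalGroup_iff] at h

theorem SO3_transpose_mul (k : SO3) :
    (k : Matrix (Fin 3) (Fin 3) ℝ)ᵀ * (k : Matrix (Fin 3) (Fin 3) ℝ) = 1 :=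
  mul_eq_one_comm.1 (SO3_mul_transpose k)

theorem SO3_det (k : SO3) : (k : Matrix (Fin 3) (Fin 3) ℝ).det = 1 :=
  (Matrix.mem_specialOrthogonalGroup_iff.1 k.2).2

theorem SO3_coe_inv (k : SO3) :
    ((k⁻¹ : SO3) : Matrix (Fin 3) (Fin 3) ℝ) = (k : Matrix (Fin 3) (Fin 3) ℝ)ᵀ := by
  have h : ((k⁻¹ : SO3) : Matrix (Fin 3) (Fin 3) ℝ) * (k : Matrix (Fin 3) (Fin 3) ℝ) = 1 := by
    rw [← Submonoid.coe_mul, inv_mul_cancel]; rfl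
  calc ((k⁻¹ : SO3) : Matrix (Fin 3) (Fin 3) ℝ)
      = ((k⁻¹ : SO3) : Matrix (Fin 3) (Fin 3) ℝ) *
        ((k : Matrix (Fin 3) (Fin 3) ℝ) * (k : Matrix (Fin 3) (Fin 3) ℝ)ᵀ) := by
          rw [SO3_mul_transpose, mul_one]
    _ = _ := by rw [← mul_assoc, h, one_mul]

theorem inner_rot (k : SO3) (x y : E3) : ⟪rot k x, rot k y⟫_ℝ = ⟪x, y⟫_ℝ := by
  simp only [EuclideanSpace.inner_eq_star_dotProduct, rot, star_trivial]
  rw [Matrix.dotProduct_mulVec, Matrix.vecMul_mulVec, SO3_transpose_mul, Matrix.vecMul_one]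

theorem norm_rot (k : SO3) (x : E3) : ‖rot k x‖ = ‖x‖ := by
  rw [norm_eq_sqrt_real_inner, norm_eq_sqrt_real_inner, inner_rot]

/-- A rotation as a linear isometry. -/
def rotL (k : SO3) : E3 ≃ₗᵢ[ℝ] E3 where
  toFun := rot k
  invFun := rot k⁻¹
  map_add' := rot_add k
  map_smul' := rot_smul k
  left_inv := rot_inv_rot k
  right_inv := rot_rot_inv k
  norm_map' := norm_rot k

theorem measurePreserving_rot (k : SO3) : MeasurePreserving (rot k) (volume : Measure E3) volume :=
  (rotL k).measurePreserving

theorem measurableEmbedding_rot (k : SO3) : MeasurableEmbedding (rot k) :=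
  (rotL k).toHomeomorph.measurableEmbedding

theorem continuous_rot (k : SO3) : Continuous (rot k) := (rotL k).continuous

theorem contDiff_rot (k : SO3) : ContDiff ℝ ∞ (rot k) :=
  (rotL k).toContinuousLinearEquiv.contDiff

theorem integral_rot {W : Type*} [NormedAddCommGroup W] [NormedSpace ℝ W] (k : SO3) (f : E3 → W) :
    ∫ x, f (rot k x) = ∫ x, f x :=
  (measurePreserving_rot k).integral_comp (measurableEmbedding_rot k) f

/-- The standard basis vectors. -/
abbrev unitVec (i : Fin 3) : E3 := EuclideanSpace.single i 1

theorem sum_smul_unitVec (x : E3) : ∑ i, x i • unitVec i = x := by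
  ext j
  fin_cases j <;> simp [Fin.sum_univ_three, unitVec]

/-- The element `∑ wᵢ Yᵢ` of `so(3)`. -/
def Yv (w : E3) : so3 := ∑ i, w i • Ybasis i

theorem Yv_coe (w : E3) : (Yv w : Matrix (Fin 3) (Fin 3) ℝ) =
    !![0, w 2, -w 1; -w 2, 0, w 0; w 1, -w 0, 0] := by
  ext i j
  fin_cases i <;> fin_cases j <;> simp [Yv, Ybasis, Fin.sum_univ_three]

theorem Yv_unitVec (i : Fin 3) : Yv (unitVec i) = Ybasis i := by
  fin_cases i <;> simp [Yv, unitVec]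

/-- Identifying `ℝ³` with `so(3)` turns the natural action into the adjoint one. This is the
invariance of the cross product under rotations, encoded in the equality of the adjugate and the
transpose of a rotation matrix. -/
theorem Yv_conj (k : SO3) (w : E3) : (Yv (rot k w) : Matrix (Fin 3) (Fin 3) ℝ) =
    (k : Matrix (Fin 3) (Fin 3) ℝ) * (Yv w : Matrix (Fin 3) (Fin 3) ℝ) *
      (k : Matrix (Fin 3) (Fin 3) ℝ)ᵀ := by
  have hadj : (k : Matrix (Fin 3) (Fin 3) ℝ).adjugate = (k : Matrix (Fin 3) (Fin 3) ℝ)ᵀ := by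
    have h : (k : Matrix (Fin 3) (Fin 3) ℝ).adjugate * (k : Matrix (Fin 3) (Fin 3) ℝ) = 1 := by
      rw [Matrix.adjugate_mul, SO3_det, one_smul]
    calc _ = (k : Matrix (Fin 3) (Fin 3) ℝ).adjugate * ((k : Matrix (Fin 3) (Fin 3) ℝ) *
        (k : Matrix (Fin 3) (Fin 3) ℝ)ᵀ) := by rw [SO3_mul_transpose, mul_one]
      _ = _ := by rw [← mul_assoc, h, one_mul]
  rw [Matrix.adjugate_fin_three] at hadj
  have h := fun i j => congrFun (congrFun hadj i) j
  have h00 := h 0 0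
  have h01 := h 0 1
  have h02 := h 0 2
  have h10 := h 1 0
  have h11 := h 1 1
  have h12 := h 1 2
  have h20 := h 2 0
  have h21 := h 2 1
  have h22 := h 2 2
  simp [Matrix.transpose_apply] at h00 h01 h02 h10 h11 h12 h20 h21 h22
  rw [Yv_coe, Yv_coe]
  ext i j
  fin_cases i <;> fin_cases j <;> simp [Matrix.mul_apply, Fin.sum_univ_three, rot_apply]
  · ring
  · linear_combination -h02 * w 0 - h12 * w 1 - h22 * w 2
  · linear_combination h01 * w 0 + h11 * w 1 + h21 * w 2
  · linear_combination h02 * w 0 + h12 * w 1 + h22 * w 2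
  · ring
  · linear_combination -h00 * w 0 - h10 * w 1 - h20 * w 2
  · linear_combination -h01 * w 0 - h11 * w 1 - h21 * w 2
  · linear_combination h00 * w 0 + h10 * w 1 + h20 * w 2
  · ring

theorem expSO3_conj (k : SO3) (w : E3) (t : ℝ) :
    expSO3 (t • Yv (rot k w)) = k * expSO3 (t • Yv w) * k⁻¹ := by
  apply Subtype.ext
  have hinv : (k : Matrix (Fin 3) (Fin 3) ℝ)⁻¹ = (k : Matrix (Fin 3) (Fin 3) ℝ)ᵀ :=
    Matrix.inv_eq_right_inv (SO3_mul_transpose k)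
  have hu : IsUnit (k : Matrix (Fin 3) (Fin 3) ℝ) :=
    (Matrix.isUnit_iff_isUnit_det _).2 (by rw [SO3_det]; exact isUnit_one)
  have h := Matrix.exp_conj (k : Matrix (Fin 3) (Fin 3) ℝ)
    (t • (Yv w : Matrix (Fin 3) (Fin 3) ℝ)) hu
  rw [hinv] at h
  simp only [expSO3, Submonoid.coe_mul, SO3_coe_inv]
  rw [← show ((t • Yv w : so3) : Matrix (Fin 3) (Fin 3) ℝ) =
    t • (Yv w : Matrix (Fin 3) (Fin 3) ℝ) from rfl] at h
  rw [← h]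
  congr 1
  change t • (Yv (rot k w) : Matrix (Fin 3) (Fin 3) ℝ) = _
  rw [Yv_conj]
  change _ = (k : Matrix (Fin 3) (Fin 3) ℝ) * (t • (Yv w : Matrix (Fin 3) (Fin 3) ℝ)) * _
  simp

theorem expSO3_zero_smul (Y : so3) : expSO3 ((0 : ℝ) • Y) = 1 := by
  apply Subtype.ext
  simp [expSO3]

theorem hasDerivAt_expSO3_apply (Y : so3) (i j : Fin 3) :
    HasDerivAt (fun t : ℝ => (expSO3 (t • Y) : Matrix (Fin 3) (Fin 3) ℝ) i j)
      ((Y : Matrix (Fin 3) (Fin 3) ℝ) i j) 0 := by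
  let _ : NormedRing (Matrix (Fin 3) (Fin 3) ℝ) := Matrix.linftyOpNormedRing
  let _ : NormedAlgebra ℝ (Matrix (Fin 3) (Fin 3) ℝ) := Matrix.linftyOpNormedAlgebra
  have h := hasDerivAt_exp_smul_const (𝕂 := ℝ) (Y : Matrix (Fin 3) (Fin 3) ℝ) (0 : ℝ)
  rw [zero_smul, NormedSpace.exp_zero, one_mul] at h
  exact (hasDerivAt_pi.1 ((hasDerivAt_pi.1 h) i)) j

theorem hasDerivAt_rot_expSO3 (Y : so3) (x : E3) :
    HasDerivAt (fun t : ℝ => rot (expSO3 (t • Y)) x)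
      (WithLp.toLp 2 ((Y : Matrix (Fin 3) (Fin 3) ℝ) *ᵥ x.ofLp)) 0 := by
  have h : HasDerivAt (fun t : ℝ => (expSO3 (t • Y) : Matrix (Fin 3) (Fin 3) ℝ) *ᵥ x.ofLp)
      ((Y : Matrix (Fin 3) (Fin 3) ℝ) *ᵥ x.ofLp) 0 := by
    rw [hasDerivAt_pi]
    intro i
    simp only [Matrix.mulVec, dotProduct]
    exact HasDerivAt.fun_sum fun j _ => (hasDerivAt_expSO3_apply Y i j).mul_const _
  exact ((PiLp.continuousLinearEquiv 2 ℝ (fun _ : Fin 3 => ℝ)).symm.hasFDerivAt.comp_hasDerivAt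
    0 h)

/-- `Yv w` annihilates `w`, so the curve has zero derivative: `w` spans the axis of the
one-parameter group it generates. -/
theorem rot_expSO3_self (w : E3) (t : ℝ) : rot (expSO3 (t • Yv w)) w = w := by
  let _ : NormedRing (Matrix (Fin 3) (Fin 3) ℝ) := Matrix.linftyOpNormedRing
  let _ : NormedAlgebra ℝ (Matrix (Fin 3) (Fin 3) ℝ) := Matrix.linftyOpNormedAlgebra
  have h0 : (Yv w : Matrix (Fin 3) (Fin 3) ℝ) *ᵥ w.ofLp = 0 := by
    rw [Yv_coe]
    ext i
    fin_cases i <;> simp [Matrix.mulVec, dotProduct, Fin.sum_univ_three] <;> ring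
  have hd : ∀ t : ℝ, HasDerivAt (fun t : ℝ => (expSO3 (t • Yv w) : Matrix (Fin 3) (Fin 3) ℝ) *ᵥ
      w.ofLp) 0 t := by
    intro t
    have h := hasDerivAt_exp_smul_const (𝕂 := ℝ) (Yv w : Matrix (Fin 3) (Fin 3) ℝ) t
    rw [hasDerivAt_pi]
    intro i
    have h2 : HasDerivAt (fun t : ℝ => ∑ j, (expSO3 (t • Yv w) : Matrix (Fin 3) (Fin 3) ℝ) i j *
        w j) (∑ j, (NormedSpace.exp (t • (Yv w : Matrix (Fin 3) (Fin 3) ℝ)) *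
          (Yv w : Matrix (Fin 3) (Fin 3) ℝ)) i j * w j) t :=
      HasDerivAt.fun_sum fun j _ =>
        ((hasDerivAt_pi.1 ((hasDerivAt_pi.1 h) i)) j).mul_const _
    have h3 : (∑ j, (NormedSpace.exp (t • (Yv w : Matrix (Fin 3) (Fin 3) ℝ)) *
          (Yv w : Matrix (Fin 3) (Fin 3) ℝ)) i j * w j) = 0 := by
      change ((NormedSpace.exp (t • (Yv w : Matrix (Fin 3) (Fin 3) ℝ)) *
          (Yv w : Matrix (Fin 3) (Fin 3) ℝ)) *ᵥ w.ofLp) i = 0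
      rw [← Matrix.mulVec_mulVec, h0]
      simp
    rw [h3] at h2
    exact h2
  have hc := is_const_of_deriv_eq_zero (fun t => (hd t).differentiableAt)
    (fun t => (hd t).deriv) t 0
  have h1 := expSO3_zero_smul (Yv w)
  simp only [h1] at hc
  have : rot (expSO3 (t • Yv w)) w = rot 1 w := by
    simp only [rot]
    rw [hc]
  rw [this, rot_one]

theorem exists_rot_unitVec_two (w : E3) (hw : ‖w‖ = 1) : ∃ k : SO3, rot k (unitVec 2) = w := by
  have h1 : w 0 ^ 2 + w 1 ^ 2 + w 2 ^ 2 = 1 := by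
    have := EuclideanSpace.real_norm_sq_eq w
    rw [hw, Fin.sum_univ_three] at this
    linarith
  set ρ := √(w 0 ^ 2 + w 1 ^ 2) with hρ
  have hρ2 : ρ ^ 2 = w 0 ^ 2 + w 1 ^ 2 := Real.sq_sqrt (by positivity)
  obtain ⟨p, q, hpq, h0, h1'⟩ : ∃ p q : ℝ, p ^ 2 + q ^ 2 = 1 ∧ w 0 = ρ * p ∧ w 1 = ρ * q := by
    by_cases hz : ρ = 0
    -- On the polar axis the longitude is arbitrary; angle zero is taken.
    · refine ⟨1, 0, by norm_num, ?_, ?_⟩ <;> rw [hz] at hρ2 ⊢ <;> nlinarith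
    · refine ⟨w 0 / ρ, w 1 / ρ, ?_, ?_, ?_⟩ <;> field_simp
      exact hρ2.symm
  set c := w 2 with hc
  have hcr : c ^ 2 + ρ ^ 2 = 1 := by linarith
  -- The orthonormal frame of spherical coordinates: the columns are the meridian direction, the
  -- parallel direction and `w` itself.
  refine ⟨⟨!![c * p, -q, ρ * p; c * q, p, ρ * q; -ρ, 0, c], ?_⟩, ?_⟩
  · rw [Matrix.mem_specialOrthogonalGroup_iff, Matrix.mem_orthogonalGroup_iff]
    constructor
    · ext i j
      fin_cases i <;> fin_cases j <;>
        simp [Matrix.mul_apply, Fin.sum_univ_three]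
      · linear_combination p ^ 2 * hcr + hpq
      · linear_combination p * q * hcr
      · ring
      · linear_combination p * q * hcr
      · linear_combination q ^ 2 * hcr + hpq
      · ring
      · ring
      · ring
      · linear_combination hcr
    · rw [Matrix.det_fin_three]
      simp
      linear_combination (p ^ 2 + q ^ 2) * hcr + hpq
  · ext i
    fin_cases i <;> simp [rot_apply, unitVec, h0, h1', hc]

theorem exists_rot_eq (x y : E3) (h : ‖x‖ = ‖y‖) : ∃ k : SO3, rot k x = y := by
  by_cases hx : x = 0
  · subst hx
    rw [norm_zero, eq_comm, norm_eq_zero] at h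
    exact ⟨1, by rw [h, rot_one]⟩
  have hnx : ‖x‖ ≠ 0 := norm_ne_zero_iff.2 hx
  obtain ⟨k, hk⟩ := exists_rot_unitVec_two (‖x‖⁻¹ • x) (by simp [norm_smul, hnx])
  obtain ⟨l, hl⟩ := exists_rot_unitVec_two (‖x‖⁻¹ • y) (by simp [norm_smul, ← h, hnx])
  refine ⟨l * k⁻¹, ?_⟩
  have hk' : rot k⁻¹ x = ‖x‖ • unitVec 2 := by
    rw [← rot_inv_rot k (unitVec 2), hk, rot_smul, smul_inv_smul₀ hnx]
  rw [rot_mul, hk', rot_smul, hl, smul_inv_smul₀ hnx]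

/-! ### Unitary representations with weights `-m, …, m` -/

section Rep

variable {V : Type*} [NormedAddCommGroup V] [InnerProductSpace ℂ V] [FiniteDimensional ℂ V]

/-- `τ` is an irreducible unitary representation with differential `J`, and the weights of
`J(e₃)` are `-m, …, m`, each of multiplicity one. -/
structure IsWeightRep (τ : SO3 →* (V →L[ℂ] V)) (J : E3 →ₗ[ℝ] (V →L[ℂ] V)) (m : ℕ) : Prop where
  unitary : ∀ k, ContinuousLinearMap.adjoint (τ k) = τ k⁻¹
  hasDerivAt : ∀ w, HasDerivAt (fun t : ℝ => τ (expSO3 (t • Yv w))) (J w) 0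
  exists_basis : ∃ b : Module.Basis (Finset.Icc (-(m : ℤ)) m) ℂ V,
    ∀ l, J (unitVec 2) (b l) = (-(Complex.I * ((l : ℤ) : ℂ))) • b l
  schur : ∀ A : V →L[ℂ] V, (∀ k, τ k * A = A * τ k) → ∃ c : ℂ, A = c • 1

/-- The product `Y (Y² + N) (Y² + 4 N) ⋯ (Y² + k² N)`. -/
def weightProd {A : Type*} [Ring A] (Y N : A) : ℕ → A
  | 0 => Y
  | k + 1 => weightProd Y N k * (Y ^ 2 + ((k + 1 : ℕ) : A) ^ 2 * N)

theorem map_weightProd {A B : Type*} [Ring A] [Ring B] (f : A →+* B) (Y N : A) (k : ℕ) :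
    f (weightProd Y N k) = weightProd (f Y) (f N) k := by
  induction k with
  | zero => rfl
  | succ k ih => simp [weightProd, ih]

theorem weightProd_smul {A : Type*} [Ring A] [Algebra ℂ A] (c : ℂ) (Y N : A) (k : ℕ) :
    weightProd (c • Y) (c ^ 2 • N) k = c ^ (2 * k + 1) • weightProd Y N k := by
  induction k with
  | zero => simp [weightProd]
  | succ k ih =>
    rw [weightProd, ih, weightProd, smul_pow, mul_smul_comm, ← smul_add, smul_mul_smul_comm]
    ring_nf

/-- The factor with index `|l|` is `(-il)² + l² = 0`, or the leading factor if `l = 0`. -/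
theorem weightProd_weight (l : ℤ) (k : ℕ) (h : l.natAbs ≤ k) :
    weightProd (-(Complex.I * (l : ℂ))) 1 k = 0 := by
  induction k with
  | zero =>
    have : l = 0 := by omega
    simp [this, weightProd]
  | succ k ih =>
    rw [weightProd]
    rcases Nat.lt_or_ge k l.natAbs with h1 | h1
    · have h2 : l.natAbs = k + 1 := by omega
      have h3 : ((k + 1 : ℕ) : ℂ) ^ 2 = (l : ℂ) ^ 2 := by
        rw [← h2]
        rw [← Int.cast_natCast l.natAbs, ← Int.cast_pow, Int.natAbs_sq, Int.cast_pow]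
      rw [h3, neg_sq, mul_pow, Complex.I_sq]
      ring
    · rw [ih h1, zero_mul]

theorem mul_app (A B : V →L[ℂ] V) (v : V) : (A * B) v = A (B v) := rfl

theorem tau_inv_mul (τ : SO3 →* (V →L[ℂ] V)) (k : SO3) : τ k⁻¹ * τ k = 1 := by
  rw [← map_mul, inv_mul_cancel, map_one]

theorem tau_mul_inv (τ : SO3 →* (V →L[ℂ] V)) (k : SO3) : τ k * τ k⁻¹ = 1 := by
  rw [← map_mul, mul_inv_cancel, map_one]

/-- Conjugation by `τ(k)` as a ring homomorphism. -/
def conjHom (τ : SO3 →* (V →L[ℂ] V)) (k : SO3) : (V →L[ℂ] V) →ₐ[ℂ] (V →L[ℂ] V) where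
  toFun A := τ k * A * τ k⁻¹
  map_one' := by rw [mul_one, tau_mul_inv]
  map_mul' A B := by
    have : τ k * (A * B) * τ k⁻¹ = τ k * A * 1 * B * τ k⁻¹ := by simp [mul_assoc]
    rw [this, ← tau_inv_mul τ k]
    simp [mul_assoc]
  map_zero' := by simp
  map_add' A B := by simp [mul_add, add_mul]
  commutes' c := by
    rw [← Algebra.commutes, mul_assoc, tau_mul_inv, mul_one]

theorem conjHom_apply (τ : SO3 →* (V →L[ℂ] V)) (k : SO3) (A : V →L[ℂ] V) :
    conjHom τ k A = τ k * A * τ k⁻¹ := rfl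

/-- The trace on `End(V)` as a continuous linear form. -/
def tr (V : Type*) [NormedAddCommGroup V] [InnerProductSpace ℂ V] [FiniteDimensional ℂ V] :
    (V →L[ℂ] V) →L[ℂ] ℂ :=
  LinearMap.toContinuousLinearMap
    ((LinearMap.trace ℂ V) ∘ₗ (ContinuousLinearMap.coeLM ℂ : (V →L[ℂ] V) →ₗ[ℂ] (V →ₗ[ℂ] V)))

theorem tr_apply (A : V →L[ℂ] V) : tr V A = LinearMap.trace ℂ V (A : V →ₗ[ℂ] V) := rfl

theorem tr_mul_comm (A B : V →L[ℂ] V) : tr V (A * B) = tr V (B * A) := by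
  rw [tr_apply, tr_apply]
  exact LinearMap.trace_mul_comm ℂ _ _

theorem tr_one : tr V 1 = Module.finrank ℂ V := by
  rw [tr_apply]
  exact LinearMap.trace_one ℂ V

theorem tr_conj (τ : SO3 →* (V →L[ℂ] V)) (k : SO3) (A : V →L[ℂ] V) :
    tr V (τ k * A * τ k⁻¹) = tr V A := by
  rw [tr_mul_comm, ← mul_assoc, tau_inv_mul, one_mul]

theorem tr_eq_sum {ι : Type*} [Fintype ι] (b : OrthonormalBasis ι ℂ V) (A : V →L[ℂ] V) :
    tr V A = ∑ i, ⟪b i, A (b i)⟫_ℂ := by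
  rw [tr_apply, LinearMap.trace_eq_sum_inner _ b]
  rfl

theorem tr_eq_sum_basis {ι : Type*} [Fintype ι] [DecidableEq ι] (b : Module.Basis ι ℂ V)
    (A : V →L[ℂ] V) : tr V A = ∑ i, b.repr (A (b i)) i := by
  rw [tr_apply, LinearMap.trace_eq_matrix_trace ℂ b, Matrix.trace]
  simp [LinearMap.toMatrix_apply]

theorem tr_adjoint_mul_self (A : V →L[ℂ] V) :
    tr V (ContinuousLinearMap.adjoint A * A) =
      ((∑ i, ‖A (stdOrthonormalBasis ℂ V i)‖ ^ 2 : ℝ) : ℂ) := by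
  rw [tr_eq_sum (stdOrthonormalBasis ℂ V)]
  push_cast
  refine Finset.sum_congr rfl fun i _ => ?_
  exact (ContinuousLinearMap.adjoint_inner_right A _ _).trans (inner_self_eq_norm_sq_to_K _)

theorem eq_zero_of_sum_norm_sq {A : V →L[ℂ] V}
    (h : ∑ i, ‖A (stdOrthonormalBasis ℂ V i)‖ ^ 2 = 0) : A = 0 := by
  rw [Finset.sum_eq_zero_iff_of_nonneg (fun _ _ => by positivity)] at h
  have : (A : V →ₗ[ℂ] V) = 0 := (stdOrthonormalBasis ℂ V).toBasis.ext fun i => by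
    have := h i (Finset.mem_univ _)
    simpa using this
  ext v
  exact LinearMap.congr_fun this v

namespace IsWeightRep

variable {τ : SO3 →* (V →L[ℂ] V)} {J : E3 →ₗ[ℝ] (V →L[ℂ] V)} {m : ℕ}

theorem finrank_eq (h : IsWeightRep τ J m) : Module.finrank ℂ V = 2 * m + 1 := by
  obtain ⟨b, -⟩ := h.exists_basis
  rw [Module.finrank_eq_card_basis b]
  simp
  omega

theorem dRep_eq (h : IsWeightRep τ J m) (i : Fin 3) : dRep τ (Ybasis i) = J (unitVec i) := by
  rw [dRep, ← Yv_unitVec]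
  exact (h.hasDerivAt _).deriv

theorem J_rot (h : IsWeightRep τ J m) (k : SO3) (w : E3) : J (rot k w) = τ k * J w * τ k⁻¹ := by
  refine (h.hasDerivAt (rot k w)).unique ?_
  simp only [expSO3_conj, map_mul]
  exact ((h.hasDerivAt w).const_mul (τ k)).mul_const (τ k⁻¹)

/-- The rotations `exp(t Yv w)` fix `w`, so `A` commutes with their images under `τ`;
differentiation at `t = 0` gives the claim. Every value at `w` of an equivariant function falls
under this. -/
theorem commute_J (h : IsWeightRep τ J m) {w : E3} {A : V →L[ℂ] V}
    (hA : ∀ k, rot k w = w → τ k * A * τ k⁻¹ = A) : J w * A = A * J w := by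
  have h1 := (h.hasDerivAt w).mul_const A
  have h2 := (h.hasDerivAt w).const_mul A
  refine h1.unique (h2.congr_of_eventuallyEq (Eventually.of_forall fun t => ?_))
  change τ _ * A = A * τ _
  have := hA _ (rot_expSO3_self w t)
  calc _ = τ (expSO3 (t • Yv w)) * A * 1 := by rw [mul_one]
    _ = _ := by rw [← tau_inv_mul τ (expSO3 (t • Yv w)), ← mul_assoc, this]

theorem weightProd_unitVec (h : IsWeightRep τ J m) : weightProd (J (unitVec 2)) 1 m = 0 := by
  obtain ⟨b, hb⟩ := h.exists_basis
  have key : ∀ k l, weightProd (J (unitVec 2)) 1 k (b l) =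
      weightProd (-(Complex.I * ((l : ℤ) : ℂ))) 1 k • b l := by
    intro k l
    induction k with
    | zero => exact hb l
    | succ k ih =>
      have h1 : ((J (unitVec 2)) ^ 2 + ((k + 1 : ℕ) : V →L[ℂ] V) ^ 2 * 1 : V →L[ℂ] V) (b l) =
          ((-(Complex.I * ((l : ℤ) : ℂ))) ^ 2 + ((k + 1 : ℕ) : ℂ) ^ 2 * 1) • b l := by
        have h2 : ((k + 1 : ℕ) : V →L[ℂ] V) ^ 2 = ((k + 1 : ℕ) : ℂ) ^ 2 • 1 := by
          rw [← Nat.cast_pow, ← Nat.cast_pow, Nat.cast_smul_eq_nsmul, nsmul_one]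
        rw [h2, sq (J _), mul_one, add_apply, mul_app,
          hb, map_smul, hb, smul_smul, add_smul, ← sq, mul_one]
        rfl
      rw [weightProd, mul_app, h1, map_smul, ih, weightProd, smul_smul,
        mul_comm]
  have : ((weightProd (J (unitVec 2)) 1 m : V →L[ℂ] V) : V →ₗ[ℂ] V) = 0 := b.ext fun l => by
    have h1 := key m l
    rw [weightProd_weight, zero_smul] at h1
    · simpa using h1
    · have := Finset.mem_Icc.1 l.2
      omega
  ext v
  exact LinearMap.congr_fun this v

/-- `J w` is `‖w‖` times a conjugate of `J(e₃)`, and the product is homogeneous. Clearing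
denominators with `‖w‖²` makes the relation polynomial in `w`, so that it can be read as an identity
of differential operators. -/
theorem weightProd_eq_zero (h : IsWeightRep τ J m) (w : E3) :
    weightProd (J w) (((‖w‖ : ℂ) ^ 2) • (1 : V →L[ℂ] V)) m = 0 := by
  obtain ⟨k, hk⟩ := exists_rot_eq (‖w‖ • unitVec 2) w (by simp [norm_smul])
  have h1 : J w = (‖w‖ : ℂ) • conjHom τ k (J (unitVec 2)) := by
    rw [conjHom_apply, ← h.J_rot]
    conv_lhs => rw [← hk, rot_smul, map_smul]
    exact (Complex.coe_smul _ _).symm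
  have h2 := weightProd_smul (‖w‖ : ℂ) (conjHom τ k (J (unitVec 2))) 1 m
  have h3 := map_weightProd (conjHom τ k).toRingHom (J (unitVec 2)) 1 m
  rw [map_one, h.weightProd_unitVec, map_zero] at h3
  rw [h1, h2]
  exact (congrArg _ h3.symm).trans (smul_zero _)

/-- Operators commuting with `J(e₃)` are diagonal in a basis of weight vectors. -/
theorem exists_diag {b : Module.Basis (Finset.Icc (-(m : ℤ)) m) ℂ V}
    (hb : ∀ l, J (unitVec 2) (b l) = (-(Complex.I * ((l : ℤ) : ℂ))) • b l) {A : V →L[ℂ] V}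
    (hA : J (unitVec 2) * A = A * J (unitVec 2)) : ∃ a : Finset.Icc (-(m : ℤ)) m → ℂ,
      ∀ l, A (b l) = a l • b l := by
  have hrep : ∀ v n, b.repr (J (unitVec 2) v) n =
      (-(Complex.I * ((n : ℤ) : ℂ))) * b.repr v n := by
    intro v n
    conv_lhs => rw [← b.sum_repr v]
    simp only [map_sum, map_smul, hb, Finsupp.coe_finsetSum, Finset.sum_apply, Finsupp.smul_apply,
      b.repr_self, Finsupp.single_apply, smul_eq_mul, mul_ite, mul_one, mul_zero]
    rw [Finset.sum_eq_single n (fun i _ hi => by simp [hi]) (by simp)]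
    simp [mul_comm]
  refine ⟨fun l => b.repr (A (b l)) l, fun l => ?_⟩
  apply b.repr.injective
  ext n
  have h1 := congrArg (fun B : V →L[ℂ] V => b.repr (B (b l)) n) hA
  simp only [mul_app, hrep, hb, map_smul, Finsupp.smul_apply,
    smul_eq_mul] at h1
  by_cases hn : l = n
  · subst hn
    simp
  · have h2 : ((n : ℤ) : ℂ) ≠ ((l : ℤ) : ℂ) := by
      intro h
      exact hn (Subtype.ext (by exact_mod_cast h.symm))
    have h3 : b.repr (A (b l)) n = 0 := by
      have : (Complex.I * (((n : ℤ) : ℂ) - ((l : ℤ) : ℂ))) * b.repr (A (b l)) n = 0 := by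
        linear_combination -h1
      exact (mul_eq_zero.1 this).resolve_left
        (mul_ne_zero Complex.I_ne_zero (sub_ne_zero.2 h2))
    simp [h3, hn]

theorem aeval_weight {v : V} {c : ℂ} {B : V →L[ℂ] V} (hv : B v = c • v) (p : Polynomial ℂ) :
    (Polynomial.aeval B p) v = p.eval c • v := by
  induction p using Polynomial.induction_on' with
  | add p q hp hq => simp [hp, hq, add_smul]
  | monomial n a =>
    have : ∀ n : ℕ, (B ^ n) v = c ^ n • v := by
      intro n
      induction n with
      | zero => simp
      | succ n ih => rw [pow_succ, mul_app, hv, map_smul, ih, smul_smul,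
          pow_succ, mul_comm]
    simp [Polynomial.aeval_monomial, this, smul_smul, mul_comm]

/-- Operators commuting with `J(e₃)` are polynomials in `J(e₃)` of degree at most `2m`. -/
theorem exists_poly (h : IsWeightRep τ J m) {A : V →L[ℂ] V}
    (hA : J (unitVec 2) * A = A * J (unitVec 2)) : ∃ c : ℕ → ℂ,
      A = ∑ l ∈ Finset.range (2 * m + 1), c l • J (unitVec 2) ^ l := by
  obtain ⟨b, hb⟩ := h.exists_basis
  obtain ⟨a, ha⟩ := exists_diag hb hA
  set node : Finset.Icc (-(m : ℤ)) m → ℂ := fun l => -(Complex.I * ((l : ℤ) : ℂ)) with hnode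
  have hinj : Set.InjOn node (Finset.univ : Finset (Finset.Icc (-(m : ℤ)) m)) := by
    intro x _ y _ hxy
    have : ((x : ℤ) : ℂ) = ((y : ℤ) : ℂ) := by
      simpa [hnode, Complex.I_ne_zero] using hxy
    exact Subtype.ext (by exact_mod_cast this)
  -- The `2m + 1` weights are distinct, so a polynomial of degree at most `2m` takes the prescribed
  -- diagonal entries at them.
  set p := Lagrange.interpolate Finset.univ node a with hp
  have hdeg : p.natDegree < 2 * m + 1 := by
    have h1 := Lagrange.degree_interpolate_lt (r := a) hinj
    have hcard : (Finset.univ : Finset (Finset.Icc (-(m : ℤ)) m)).card = 2 * m + 1 := by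
      simp
      omega
    rw [hcard] at h1
    by_cases hp0 : p = 0
    · rw [hp0]; simp
    · exact (Polynomial.natDegree_lt_iff_degree_lt hp0).2 h1
  have hAp : A = Polynomial.aeval (J (unitVec 2)) p := by
    have : (A : V →ₗ[ℂ] V) =
        ((Polynomial.aeval (J (unitVec 2)) p : V →L[ℂ] V) : V →ₗ[ℂ] V) := b.ext fun l => by
      have h1 := aeval_weight (hb l) p
      have h2 : p.eval (node l) = a l := Lagrange.eval_interpolate_at_node a hinj (Finset.mem_univ l)
      change A (b l) = (Polynomial.aeval (J (unitVec 2)) p) (b l)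
      rw [h1, ha]
      exact congrArg (· • b l) h2.symm
    ext v
    exact LinearMap.congr_fun this v
  exact ⟨p.coeff, by rw [hAp, Polynomial.aeval_eq_sum_range' hdeg]⟩

end IsWeightRep

end Rep

/-! ### Derivatives of smooth functions -/

section Calculus

variable {W : Type*} [NormedAddCommGroup W] [NormedSpace ℂ W]
variable {W' : Type*} [NormedAddCommGroup W'] [NormedSpace ℂ W']

theorem differentiable_smooth (f : Smooth W) : Differentiable ℝ f.1 :=
  (contDiff_of_smooth f).differentiable (by simp)

theorem continuous_smooth (f : Smooth W) : Continuous f.1 := (contDiff_of_smooth f).continuous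

/-- The directional derivative along `v`. -/
def pd (v : E3) : Module.End ℂ (Smooth W) where
  toFun f := ⟨fun x => fderiv ℝ f.1 x v,
    ((contDiff_of_smooth f).fderiv_right (m := ∞) (by simp)).clm_apply contDiff_const⟩
  map_add' f g := by
    ext1; funext x
    simp [fderiv_add (differentiable_smooth f x) (differentiable_smooth g x)]
  map_smul' c f := by
    ext1; funext x
    simp [fderiv_const_smul (differentiable_smooth f x)]

theorem pd_apply (v : E3) (f : Smooth W) (x : E3) : (pd v f).1 x = fderiv ℝ f.1 x v := rfl

theorem pd_add (v w : E3) : (pd (v + w) : Module.End ℂ (Smooth W)) = pd v + pd w := by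
  ext f x
  simp [pd_apply]

theorem pd_smul (c : ℝ) (v : E3) : (pd (c • v) : Module.End ℂ (Smooth W)) = (c : ℂ) • pd v := by
  ext f x
  simp [pd_apply]

theorem pd_eq_sum (v : E3) :
    (pd v : Module.End ℂ (Smooth W)) = ∑ i, (v i : ℂ) • pd (unitVec i) := by
  conv_lhs => rw [← sum_smul_unitVec v]
  simp only [Fin.sum_univ_three, pd_add, pd_smul]

theorem pd_comm (v w : E3) (f : Smooth W) : pd v (pd w f) = pd w (pd v f) := by
  ext1; funext x
  have h2 : ContDiffAt ℝ 2 f.1 x := ((contDiff_of_smooth f).of_le (by norm_cast)).contDiffAt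
  have hsymm := h2.isSymmSndFDerivAt (by simp)
  have hd : DifferentiableAt ℝ (fderiv ℝ f.1) x :=
    (((contDiff_of_smooth f).fderiv_right (m := ∞) (by simp)).differentiable (by simp)) x
  have key : ∀ a b : E3, (pd a (pd b f)).1 x = fderiv ℝ (fderiv ℝ f.1) x a b := by
    intro a b
    change fderiv ℝ (fun y => fderiv ℝ f.1 y b) x a = _
    rw [fderiv_clm_apply hd (differentiableAt_const b)]
    simp
  rw [key, key]
  exact hsymm v w

theorem laplacian_eq (f : Smooth W) (x : E3) :
    Laplacian.laplacian f.1 x = (∑ i, pd (unitVec i) (pd (unitVec i) f)).1 x := by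
  have hd : DifferentiableAt ℝ (fderiv ℝ f.1) x :=
    (((contDiff_of_smooth f).fderiv_right (m := ∞) (by simp)).differentiable (by simp)) x
  have key : ∀ a b : E3, (pd a (pd b f)).1 x = fderiv ℝ (fderiv ℝ f.1) x a b := by
    intro a b
    change fderiv ℝ (fun y => fderiv ℝ f.1 y b) x a = _
    rw [fderiv_clm_apply hd (differentiableAt_const b)]
    simp
  rw [InnerProductSpace.laplacian_eq_iteratedFDeriv_orthonormalBasis f.1
    (EuclideanSpace.basisFun (Fin 3) ℝ)]
  simp only [iteratedFDeriv_two_apply, Submodule.coe_sum, Finset.sum_apply]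
  refine Finset.sum_congr rfl fun i _ => ?_
  rw [key]
  simp

open scoped IsMulCommutative in
/-- The algebra homomorphism `p ↦ p(∂)`. -/
theorem exists_op (W : Type*) [NormedAddCommGroup W] [NormedSpace ℂ W] :
    ∃ T : MvPolynomial (Fin 3) ℂ →ₐ[ℂ] Module.End ℂ (Smooth W), ∀ i, T (X i) = pd (unitVec i) := by
  have hcomm : ∀ a ∈ Set.range (fun i : Fin 3 => (pd (unitVec i) : Module.End ℂ (Smooth W))),
      ∀ b ∈ Set.range (fun i : Fin 3 => (pd (unitVec i) : Module.End ℂ (Smooth W))),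
        a * b = b * a := by
    rintro _ ⟨i, rfl⟩ _ ⟨j, rfl⟩
    exact LinearMap.ext fun f => pd_comm _ _ f
  have := Algebra.isMulCommutative_adjoin ℂ hcomm
  let S := Algebra.adjoin ℂ
    (Set.range (fun i : Fin 3 => (pd (unitVec i) : Module.End ℂ (Smooth W))))
  let g : Fin 3 → S := fun i => ⟨pd (unitVec i), Algebra.subset_adjoin ⟨i, rfl⟩⟩
  refine ⟨S.val.comp (aeval g), fun i => ?_⟩
  simp [g]

/-- The constant-coefficient operator `p(∂)`. -/
def Op : MvPolynomial (Fin 3) ℂ →ₐ[ℂ] Module.End ℂ (Smooth W) := (exists_op W).choose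

theorem Op_X (i : Fin 3) : (Op (X i) : Module.End ℂ (Smooth W)) = pd (unitVec i) :=
  (exists_op W).choose_spec i

/-- The linear form `∑ vᵢ Xᵢ`. -/
def linForm (v : E3) : MvPolynomial (Fin 3) ℂ := ∑ i, C (v i : ℂ) * X i

theorem Op_linForm (v : E3) : (Op (linForm v) : Module.End ℂ (Smooth W)) = pd v := by
  rw [pd_eq_sum, linForm, map_sum]
  refine Finset.sum_congr rfl fun i _ => ?_
  rw [map_mul, Op_X, ← algebraMap_eq, AlgHom.commutes, Algebra.algebraMap_eq_smul_one,
    smul_mul_assoc, one_mul]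

/-- Composition of a smooth function with a continuous linear map. -/
def postComp (T : W →L[ℂ] W') : Smooth W →ₗ[ℂ] Smooth W' where
  toFun f := ⟨fun x => T (f.1 x), (T.restrictScalars ℝ).contDiff.comp (contDiff_of_smooth f)⟩
  map_add' f g := by ext1; funext x; simp
  map_smul' c f := by ext1; funext x; simp

theorem postComp_apply (T : W →L[ℂ] W') (f : Smooth W) (x : E3) :
    (postComp T f).1 x = T (f.1 x) := rfl

theorem pd_postComp (T : W →L[ℂ] W') (v : E3) (f : Smooth W) :
    pd v (postComp T f) = postComp T (pd v f) := by
  ext1; funext x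
  exact congrArg (fun L => L v)
    ((T.restrictScalars ℝ).hasFDerivAt.comp x (differentiable_smooth f x).hasFDerivAt).fderiv

theorem Op_postComp (T : W →L[ℂ] W') (p : MvPolynomial (Fin 3) ℂ) (f : Smooth W) :
    Op p (postComp T f) = postComp T (Op p f) := by
  induction p using MvPolynomial.induction_on generalizing f with
  | C a => simp [← algebraMap_eq, Algebra.algebraMap_eq_smul_one]
  | add p q hp hq => simp [hp, hq]
  | mul_X p i hp => rw [map_mul, map_mul, Op_X, Op_X, Module.End.mul_apply, Module.End.mul_apply,
      pd_postComp, hp]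

/-- Precomposition of a smooth function with a rotation. -/
def rotComp (k : SO3) (f : Smooth W) : Smooth W :=
  ⟨fun x => f.1 (rot k x), (contDiff_of_smooth f).comp (contDiff_rot k)⟩

theorem pd_rotComp (k : SO3) (v : E3) (f : Smooth W) :
    pd v (rotComp k f) = rotComp k (pd (rot k v) f) := by
  ext1; funext x
  have h := ((differentiable_smooth f (rot k x)).hasFDerivAt.comp x
    ((rotL k).toContinuousLinearEquiv.hasFDerivAt)).fderiv
  exact congrArg (fun L => L v) h

theorem smooth_hasDerivAt_line (f : Smooth W) (x v : E3) (t : ℝ) :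
    HasDerivAt (fun t : ℝ => f.1 (x + t • v)) ((pd v f).1 (x + t • v)) t := by
  have h1 : HasDerivAt (fun t : ℝ => x + t • v) v t := by
    simpa using ((hasDerivAt_id t).smul_const v).const_add x
  exact (differentiable_smooth f _).hasFDerivAt.comp_hasDerivAt t h1

/-- A sequence of functions, each the derivative of the preceding one, vanishing at `0` and of
geometric growth, is zero. -/
theorem eq_zero_of_deriv_bound {g : ℕ → ℝ → W} {A C : ℝ}
    (hd : ∀ n t, HasDerivAt (g n) (g (n + 1) t) t) (h0 : ∀ n, g n 0 = 0)
    (hb : ∀ n t, ‖g n t‖ ≤ A * C ^ n) : g 0 1 = 0 := by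
  -- Integrating the bound on `g (n + k)` from `0`, where all functions vanish, `k` times. At `n =
  -- 0`, `t = 1` the right side tends to zero as `k` grows.
  have key : ∀ k n, ∀ t ∈ Set.Icc (0 : ℝ) 1, ‖g n t‖ ≤ A * C ^ (n + k) * (t ^ k / k.factorial) := by
    intro k
    induction k with
    | zero => intro n t _; simpa using hb n t
    | succ k ih =>
      intro n t ht
      have hB : ∀ x, HasDerivAt (fun x : ℝ => A * C ^ (n + (k + 1)) * (x ^ (k + 1) /
          (k + 1).factorial)) (A * C ^ (n + 1 + k) * (x ^ k / k.factorial)) x := by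
        intro x
        have h1 := (((hasDerivAt_id x).pow (k + 1)).div_const ((k + 1).factorial : ℝ)).const_mul
          (A * C ^ (n + (k + 1)))
        refine h1.congr_deriv ?_
        have : (k.factorial : ℝ) ≠ 0 := by positivity
        simp only [Nat.factorial_succ, Nat.cast_mul, id, Nat.add_sub_cancel, mul_one]
        rw [show n + 1 + k = n + (k + 1) by ring]
        have : ((k + 1 : ℕ) : ℝ) ≠ 0 := by positivity
        field_simp
      refine image_norm_le_of_norm_deriv_right_le_deriv_boundary
        (f := g n) (f' := g (n + 1)) (a := 0) (b := 1)
        (fun x _ => (hd n x).continuousAt.continuousWithinAt)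
        (fun x _ => (hd n x).hasDerivWithinAt) (by simp [h0]) hB
        (fun x hx => ih (n + 1) x ⟨hx.1, hx.2.le⟩) ht
  have hlim : Tendsto (fun k : ℕ => A * (C ^ k / k.factorial)) atTop (𝓝 (A * 0)) :=
    (FloorSemiring.tendsto_pow_div_factorial_atTop C).const_mul A
  rw [mul_zero] at hlim
  have hle : ‖g 0 1‖ ≤ 0 := by
    refine ge_of_tendsto' hlim fun k => ?_
    have := key k 0 1 ⟨zero_le_one, le_rfl⟩
    simpa [mul_div_assoc, div_eq_mul_inv, mul_assoc] using this
  exact norm_le_zero_iff.1 hle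

theorem smooth_eq_zero_of_bound {f : Smooth W} {v : E3} {A C : ℝ}
    (hb : ∀ n x, ‖((pd v ^ n) f).1 x‖ ≤ A * C ^ n) (h0 : ∀ n, ((pd v ^ n) f).1 0 = 0) :
    f.1 v = 0 := by
  have := eq_zero_of_deriv_bound (g := fun n t => ((pd v ^ n) f).1 (0 + t • v)) (A := A) (C := C)
    (fun n t => by
      rw [pow_succ']
      exact smooth_hasDerivAt_line _ _ _ _)
    (fun n => by simpa using h0 n) (fun n t => hb n _)
  simpa using this

end Calculus

/-! ### Eigenfunctions are determined by their eigenvalues -/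

section Eigen

variable {V : Type*} [NormedAddCommGroup V] [InnerProductSpace ℂ V] [FiniteDimensional ℂ V]

/-- The index set of the standard orthonormal basis of `V`. -/
abbrev Idx (V : Type*) [NormedAddCommGroup V] [InnerProductSpace ℂ V] : Type :=
  Fin (Module.finrank ℂ V)

/-- The matrix of an operator in the standard orthonormal basis. -/
def mat : (V →L[ℂ] V) →ₐ[ℂ] Matrix (Idx V) (Idx V) ℂ :=
  (LinearMap.toMatrixAlgEquiv (stdOrthonormalBasis ℂ V).toBasis).toAlgHom.comp
    { (ContinuousLinearMap.toLinearMapRingHom : (V →L[ℂ] V) →+* (V →ₗ[ℂ] V)) with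
      commutes' := fun _ => rfl }

theorem mat_apply (A : V →L[ℂ] V) (a c : Idx V) :
    mat A a c = ⟪stdOrthonormalBasis ℂ V a, A (stdOrthonormalBasis ℂ V c)⟫_ℂ := by
  change LinearMap.toMatrixAlgEquiv (stdOrthonormalBasis ℂ V).toBasis (A : V →ₗ[ℂ] V) a c = _
  rw [LinearMap.toMatrixAlgEquiv_apply]
  simp [OrthonormalBasis.repr_apply_apply]

theorem mat_injective : Function.Injective (mat : (V →L[ℂ] V) → _) := by
  intro A B h
  have : (A : V →ₗ[ℂ] V) = B :=
    (LinearMap.toMatrixAlgEquiv (stdOrthonormalBasis ℂ V).toBasis).injective h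
  ext v
  exact LinearMap.congr_fun this v

theorem mat_adjoint (A : V →L[ℂ] V) (a c : Idx V) :
    mat (ContinuousLinearMap.adjoint A) a c = starRingEnd ℂ (mat A c a) := by
  rw [mat_apply, mat_apply, ContinuousLinearMap.adjoint_inner_right, inner_conj_symm]

theorem tr_eq_mat (A : V →L[ℂ] V) : tr V A = ∑ a, mat A a a := by
  simp only [tr_eq_sum (stdOrthonormalBasis ℂ V), mat_apply]

/-- A matrix entry of `p(∂)Ψ(0)` as a linear form in `p`. -/
def coefForm (Ψ : Smooth (V →L[ℂ] V)) (a c : Idx V) : MvPolynomial (Fin 3) ℂ →ₗ[ℂ] ℂ where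
  toFun p := mat ((Op p Ψ).1 0) a c
  map_add' p q := by simp
  map_smul' c p := by simp

theorem coefForm_apply (Ψ : Smooth (V →L[ℂ] V)) (a c : Idx V) (p : MvPolynomial (Fin 3) ℂ) :
    coefForm Ψ a c p = mat ((Op p Ψ).1 0) a c := rfl

/-- The trace of `P(∂)Ψ(0)` for a matrix `P` of polynomials. -/
def pairing (Ψ : Smooth (V →L[ℂ] V)) :
    Matrix (Idx V) (Idx V) (MvPolynomial (Fin 3) ℂ) →ₗ[ℂ] ℂ where
  toFun P := ∑ a, ∑ c, coefForm Ψ c a (P a c)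
  map_add' P Q := by simp [Finset.sum_add_distrib]
  map_smul' c P := by simp [Finset.mul_sum]

theorem pairing_apply (Ψ : Smooth (V →L[ℂ] V))
    (P : Matrix (Idx V) (Idx V) (MvPolynomial (Fin 3) ℂ)) :
    pairing Ψ P = ∑ a, ∑ c, coefForm Ψ c a (P a c) := rfl

/-- The symbol of `D_τ` as a matrix of polynomials. -/
def symbolMat (J : E3 →ₗ[ℝ] (V →L[ℂ] V)) : Matrix (Idx V) (Idx V) (MvPolynomial (Fin 3) ℂ) :=
  fun a c => ∑ i, C (mat (J (unitVec i)) a c) * X i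

/-- The polynomial `X₁² + X₂² + X₃²`. -/
def normSqPoly : MvPolynomial (Fin 3) ℂ := ∑ i, X i * X i

theorem pairing_one (Ψ : Smooth (V →L[ℂ] V)) : pairing Ψ 1 = tr V (Ψ.1 0) := by
  rw [pairing_apply, tr_eq_mat]
  refine Finset.sum_congr rfl fun a _ => ?_
  rw [Finset.sum_eq_single a (fun c _ hc => by rw [Matrix.one_apply_ne hc.symm, map_zero])
    (by simp), Matrix.one_apply_eq, coefForm_apply, map_one]
  rfl

theorem pairing_normSq {Ψ : Smooth (V →L[ℂ] V)} {ev : ℂ} (hΨ : Op normSqPoly Ψ = ev • Ψ)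
    (P : Matrix (Idx V) (Idx V) (MvPolynomial (Fin 3) ℂ)) :
    pairing Ψ (normSqPoly • P) = ev * pairing Ψ P := by
  simp only [pairing_apply, Finset.mul_sum]
  refine Finset.sum_congr rfl fun a _ => Finset.sum_congr rfl fun c _ => ?_
  rw [Matrix.smul_apply, smul_eq_mul, mul_comm, coefForm_apply, map_mul, Module.End.mul_apply, hΨ]
  simp [coefForm_apply]

theorem pairing_normSq_pow {Ψ : Smooth (V →L[ℂ] V)} {ev : ℂ} (hΨ : Op normSqPoly Ψ = ev • Ψ)
    (P : Matrix (Idx V) (Idx V) (MvPolynomial (Fin 3) ℂ)) (n : ℕ) :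
    pairing Ψ (normSqPoly ^ n • P) = ev ^ n * pairing Ψ P := by
  induction n with
  | zero => simp
  | succ n ih => rw [pow_succ', mul_smul, pairing_normSq hΨ, ih, pow_succ', mul_assoc]

variable {τ : SO3 →* (V →L[ℂ] V)} {J : E3 →ₗ[ℝ] (V →L[ℂ] V)} {m : ℕ}

theorem IsWeightRep.Dop_eq (h : IsWeightRep τ J m) (f : Smooth (V →L[ℂ] V)) :
    Dop τ f = ∑ i, postComp (ContinuousLinearMap.mul ℂ (V →L[ℂ] V) (J (unitVec i)))
      (pd (unitVec i) f) := by
  ext1; funext x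
  simp only [Submodule.coe_sum, Finset.sum_apply]
  change ∑ i, dRep τ (Ybasis i) * partialDeriv i f.1 x = _
  simp only [h.dRep_eq]
  rfl

/-- The form is the trace of `P(∂)Ψ` at the origin. A symbol on the right of `P` acts on `Ψ` first,
as `D_τ`, and contributes its eigenvalue; `key` is this computation for one entry of `P`. -/
theorem IsWeightRep.pairing_symbol (h : IsWeightRep τ J m) {Ψ : Smooth (V →L[ℂ] V)} {ev : ℂ}
    (hΨ : Dop τ Ψ = ev • Ψ) (P : Matrix (Idx V) (Idx V) (MvPolynomial (Fin 3) ℂ)) :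
    pairing Ψ (P * symbolMat J) = ev * pairing Ψ P := by
  have key : ∀ (q : MvPolynomial (Fin 3) ℂ) (a c : Idx V),
      ∑ b, ∑ i, mat (J (unitVec i)) c b * coefForm Ψ b a (q * X i) = ev * coefForm Ψ c a q := by
    intro q a c
    have h1 : Op q (Dop τ Ψ) = ev • Op q Ψ := by rw [hΨ, map_smul]
    rw [h.Dop_eq, map_sum] at h1
    have h2 := congrArg (fun f : Smooth (V →L[ℂ] V) => mat (f.1 0) c a) h1
    simp only [Submodule.coe_sum, Finset.sum_apply, Op_postComp, map_sum, Matrix.sum_apply] at h2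
    rw [Finset.sum_comm]
    have h3 : mat ((ev • Op q Ψ : Smooth (V →L[ℂ] V)).1 0) c a = ev * coefForm Ψ c a q := by
      simp [coefForm_apply]
    rw [← h3, ← h2]
    refine Finset.sum_congr rfl fun i _ => ?_
    rw [postComp_apply, ContinuousLinearMap.mul_apply', map_mul, Matrix.mul_apply]
    refine Finset.sum_congr rfl fun b _ => ?_
    rw [coefForm_apply, map_mul, Op_X]
    rfl
  calc pairing Ψ (P * symbolMat J)
      = ∑ a, ∑ c, ∑ b, ∑ i, mat (J (unitVec i)) c b * coefForm Ψ b a (P a c * X i) := by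
        rw [pairing_apply]
        refine Finset.sum_congr rfl fun a _ => ?_
        rw [Finset.sum_comm]
        refine Finset.sum_congr rfl fun b _ => ?_
        rw [Matrix.mul_apply, map_sum]
        refine Finset.sum_congr rfl fun c _ => ?_
        rw [symbolMat, Finset.mul_sum, map_sum]
        refine Finset.sum_congr rfl fun i _ => ?_
        rw [mul_left_comm, ← MvPolynomial.smul_eq_C_mul, map_smul, smul_eq_mul]
    _ = ev * pairing Ψ P := by
        rw [pairing_apply, Finset.mul_sum]
        refine Finset.sum_congr rfl fun a _ => ?_
        rw [Finset.mul_sum]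
        exact Finset.sum_congr rfl fun c _ => key (P a c) a c

theorem IsWeightRep.pairing_symbol_pow (h : IsWeightRep τ J m) {Ψ : Smooth (V →L[ℂ] V)} {ev : ℂ}
    (hΨ : Dop τ Ψ = ev • Ψ) (P : Matrix (Idx V) (Idx V) (MvPolynomial (Fin 3) ℂ)) (n : ℕ) :
    pairing Ψ (P * symbolMat J ^ n) = ev ^ n * pairing Ψ P := by
  induction n with
  | zero => simp
  | succ n ih => rw [pow_succ, ← mul_assoc, h.pairing_symbol hΨ, ih, pow_succ', mul_assoc]

/-- Evaluation of a matrix of polynomials at a real point. -/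
def evalMat (w : E3) : Matrix (Idx V) (Idx V) (MvPolynomial (Fin 3) ℂ) →+*
    Matrix (Idx V) (Idx V) ℂ :=
  (eval (fun i => (w i : ℂ))).mapMatrix

theorem evalMat_apply (w : E3) (P : Matrix (Idx V) (Idx V) (MvPolynomial (Fin 3) ℂ))
    (a c : Idx V) : evalMat w P a c = eval (fun i => (w i : ℂ)) (P a c) := rfl

theorem evalMat_smul (w : E3) (q : MvPolynomial (Fin 3) ℂ)
    (P : Matrix (Idx V) (Idx V) (MvPolynomial (Fin 3) ℂ)) :
    evalMat w (q • P) = eval (fun i => (w i : ℂ)) q • evalMat w P := by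
  ext a c
  simp [evalMat_apply]

theorem eval_normSqPoly (w : E3) : eval (fun i => (w i : ℂ)) normSqPoly = (‖w‖ : ℂ) ^ 2 := by
  rw [← Complex.ofReal_pow, EuclideanSpace.real_norm_sq_eq]
  simp [normSqPoly, sq]

theorem evalMat_symbolMat (w : E3) : evalMat w (symbolMat J) = mat (J w) := by
  conv_rhs => rw [← sum_smul_unitVec w]
  ext a c
  rw [map_sum, map_sum, Matrix.sum_apply, evalMat_apply, symbolMat, map_sum]
  refine Finset.sum_congr rfl fun i _ => ?_
  rw [map_smul, ← Complex.coe_smul, map_smul]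
  simp [mul_comm]

/-- Real points suffice because `ℝ` is infinite. Relations between `J(w)` and `‖w‖²`, proved by
rotating `w` to the axis, become identities between symbols in this way. -/
theorem ext_evalMat {P Q : Matrix (Idx V) (Idx V) (MvPolynomial (Fin 3) ℂ)}
    (h : ∀ w, evalMat w P = evalMat w Q) : P = Q := by
  ext1 a c
  have hinf : ∀ _ : Fin 3, (Set.range (Complex.ofReal)).Infinite := fun _ =>
    Set.infinite_range_of_injective Complex.ofReal_injective
  refine MvPolynomial.funext_set (fun _ : Fin 3 => Set.range (Complex.ofReal)) hinf ?_
  intro x hx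
  choose y hy using fun i => hx i (Set.mem_univ i)
  have := congrFun (congrFun (h (WithLp.toLp 2 y)) a) c
  simp only [evalMat_apply, hy] at this
  exact this

theorem Op_normSqPoly {f : Smooth (V →L[ℂ] V)} {ev : ℂ}
    (hf : ∀ x, Laplacian.laplacian f.1 x = ev • f.1 x) : Op normSqPoly f = ev • f := by
  ext1; funext x
  have := hf x
  rw [laplacian_eq] at this
  simp only [normSqPoly, map_sum, map_mul, Op_X]
  rw [LinearMap.sum_apply]
  exact this

/-- The relation satisfied by `J(w)` and `‖w‖²` holds for the symbol matrix and `|X|²`. The form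
sends it to the same expression in the eigenvalues, multiplied by the nonzero trace at the origin.
-/
theorem IsWeightRep.weightProd_eigenvalue (h : IsWeightRep τ J m) {Ψ : Smooth (V →L[ℂ] V)}
    {μ ev : ℂ} (hD : Dop τ Ψ = μ • Ψ) (hL : ∀ x, Laplacian.laplacian Ψ.1 x = ev • Ψ.1 x)
    (h0 : tr V (Ψ.1 0) ≠ 0) : weightProd μ ev m = 0 := by
  have hN := Op_normSqPoly hL
  have h1 : weightProd (symbolMat J) (normSqPoly • (1 : Matrix (Idx V) (Idx V) _)) m = 0 := by
    refine ext_evalMat fun w => ?_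
    rw [map_weightProd, evalMat_symbolMat, evalMat_smul, eval_normSqPoly, map_zero, map_one]
    have h2 := map_weightProd (mat (V := V)).toRingHom (J w)
      (((‖w‖ : ℂ) ^ 2) • (1 : V →L[ℂ] V)) m
    rw [h.weightProd_eq_zero, map_zero] at h2
    rw [h2]
    congr 1
    exact ((map_smul mat _ _).trans (by rw [map_one])).symm
  have h2 : ∀ k, pairing Ψ (weightProd (symbolMat J)
      (normSqPoly • (1 : Matrix (Idx V) (Idx V) _)) k) = weightProd μ ev k * tr V (Ψ.1 0) := by
    intro k
    induction k with
    | zero =>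
      have := h.pairing_symbol hD 1
      rw [one_mul, pairing_one] at this
      exact this
    | succ k ih =>
      have h3 : ((k + 1 : ℕ) : Matrix (Idx V) (Idx V) (MvPolynomial (Fin 3) ℂ)) ^ 2 =
          (((k + 1 : ℕ) : ℂ) ^ 2) • 1 := by
        rw [← Nat.cast_pow, ← Nat.cast_pow, Nat.cast_smul_eq_nsmul, nsmul_one]
      rw [weightProd, mul_add, map_add, h.pairing_symbol_pow hD, h3, smul_one_mul, mul_smul_comm,
        map_smul, mul_smul_comm, mul_one, pairing_normSq hN, ih, weightProd, smul_eq_mul]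
      ring
  have h3 := h2 m
  rw [h1, map_zero] at h3
  exact (mul_eq_zero.1 h3.symm).resolve_right h0

/-- With `ev = -s²` the factors become `μ² - (s l)² = (μ - s l)(μ + s l)`. -/
theorem exists_int_of_weightProd {μ : ℂ} {s : ℝ} (k : ℕ)
    (h : weightProd μ (-(s : ℂ) ^ 2) k = 0) : ∃ j ∈ Finset.Icc (-(k : ℤ)) k, μ = s * j := by
  induction k with
  | zero => exact ⟨0, by simp, by simpa [weightProd] using h⟩
  | succ k ih =>
    rw [weightProd] at h
    rcases mul_eq_zero.1 h with h | h
    · obtain ⟨j, hj, hj'⟩ := ih h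
      rw [Finset.mem_Icc] at hj
      exact ⟨j, by rw [Finset.mem_Icc]; push_cast; omega, hj'⟩
    · have h2 : (μ - s * (k + 1 : ℕ)) * (μ + s * (k + 1 : ℕ)) = 0 := by linear_combination h
      rcases mul_eq_zero.1 h2 with h3 | h3
      · exact ⟨(k + 1 : ℕ), by rw [Finset.mem_Icc]; push_cast; omega, by
          push_cast at h3 ⊢; linear_combination h3⟩
      · exact ⟨-(k + 1 : ℕ), by rw [Finset.mem_Icc]; push_cast; omega, by
          push_cast at h3 ⊢; linear_combination h3⟩

/-- The `n`-th derivative at the origin in the direction `v`. -/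
def taylorCoef (Ψ : Smooth (V →L[ℂ] V)) (n : ℕ) (v : E3) : V →L[ℂ] V := ((pd v ^ n) Ψ).1 0

theorem taylorCoef_smul (Ψ : Smooth (V →L[ℂ] V)) (n : ℕ) (c : ℝ) (v : E3) :
    taylorCoef Ψ n (c • v) = (c : ℂ) ^ n • taylorCoef Ψ n v := by
  rw [taylorCoef, pd_smul, smul_pow]
  rfl

theorem pd_pow_rotComp {W : Type*} [NormedAddCommGroup W] [NormedSpace ℂ W] (k : SO3) (v : E3)
    (f : Smooth W) (n : ℕ) : (pd v ^ n) (rotComp k f) = rotComp k ((pd (rot k v) ^ n) f) := by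
  induction n with
  | zero => simp
  | succ n ih => rw [pow_succ', Module.End.mul_apply, ih, pd_rotComp, pow_succ',
      Module.End.mul_apply]

theorem pd_pow_postComp {W W' : Type*} [NormedAddCommGroup W] [NormedSpace ℂ W]
    [NormedAddCommGroup W'] [NormedSpace ℂ W'] (T : W →L[ℂ] W') (v : E3)
    (f : Smooth W) (n : ℕ) : (pd v ^ n) (postComp T f) = postComp T ((pd v ^ n) f) := by
  rw [← Op_linForm, ← map_pow, Op_postComp, map_pow, Op_linForm, ← Op_linForm, ← map_pow, map_pow]

theorem taylorCoef_rot {Ψ : Smooth (V →L[ℂ] V)}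
    (hΨ : ∀ k x, Ψ.1 (rot k x) = τ k * Ψ.1 x * τ k⁻¹) (n : ℕ) (k : SO3) (v : E3) :
    taylorCoef Ψ n (rot k v) = τ k * taylorCoef Ψ n v * τ k⁻¹ := by
  have h1 : rotComp k Ψ = postComp (LinearMap.toContinuousLinearMap
      (conjHom τ k).toLinearMap) Ψ := by
    ext1; funext x
    exact hΨ k x
  have h2 := pd_pow_rotComp k v Ψ n
  rw [h1, pd_pow_postComp] at h2
  have h3 := congrArg (fun f : Smooth (V →L[ℂ] V) => f.1 0) h2
  simp only [postComp_apply] at h3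
  have h4 : (rotComp k ((pd (rot k v) ^ n) Ψ)).1 0 = taylorCoef Ψ n (rot k v) := by
    change ((pd (rot k v) ^ n) Ψ).1 (rot k 0) = _
    rw [rot_zero]
    rfl
  rw [← h4, ← h3]
  rfl

theorem linForm_pow (v : E3) (n : ℕ) :
    linForm v ^ n = ∑ f : Fin n → Fin 3, C (∏ i, (v (f i) : ℂ)) * ∏ i, X (f i) := by
  rw [linForm, Fintype.sum_pow]
  refine Finset.sum_congr rfl fun f _ => ?_
  rw [Finset.prod_mul_distrib, map_prod]

theorem mat_taylorCoef (Ψ : Smooth (V →L[ℂ] V)) (n : ℕ) (v : E3) (a c : Idx V) :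
    mat (taylorCoef Ψ n v) a c =
      ∑ f : Fin n → Fin 3, (∏ i, (v (f i) : ℂ)) * coefForm Ψ a c (∏ i, X (f i)) := by
  have h1 : mat (taylorCoef Ψ n v) a c = coefForm Ψ a c (linForm v ^ n) := by
    rw [coefForm_apply, map_pow, Op_linForm]
    rfl
  rw [h1, linForm_pow, map_sum]
  refine Finset.sum_congr rfl fun f _ => ?_
  rw [← MvPolynomial.smul_eq_C_mul, map_smul, smul_eq_mul]

/-- The adjoint of the `n`-th Taylor coefficient as a matrix of polynomials. -/
def adjointPoly (Ψ : Smooth (V →L[ℂ] V)) (n : ℕ) :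
    Matrix (Idx V) (Idx V) (MvPolynomial (Fin 3) ℂ) :=
  fun a c => ∑ f : Fin n → Fin 3,
    C (starRingEnd ℂ (coefForm Ψ c a (∏ i, X (f i)))) * ∏ i, X (f i)

theorem evalMat_adjointPoly (Ψ : Smooth (V →L[ℂ] V)) (n : ℕ) (v : E3) :
    evalMat v (adjointPoly Ψ n) = mat (ContinuousLinearMap.adjoint (taylorCoef Ψ n v)) := by
  ext a c
  rw [mat_adjoint, mat_taylorCoef, map_sum, evalMat_apply, adjointPoly, map_sum]
  refine Finset.sum_congr rfl fun f _ => ?_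
  simp only [map_mul, eval_C, map_prod, eval_X, Complex.conj_ofReal]
  rw [mul_comm]

/-- The conjugated derivatives of order `n` used as coefficients meet the derivatives themselves,
leaving a sum of squares. Its vanishing therefore kills all derivatives of order `n` at the origin.
-/
theorem pairing_adjointPoly (Ψ : Smooth (V →L[ℂ] V)) (n : ℕ) :
    pairing Ψ (adjointPoly Ψ n) =
      ((∑ a, ∑ c, ∑ f : Fin n → Fin 3, ‖coefForm Ψ c a (∏ i, X (f i))‖ ^ 2 : ℝ) : ℂ) := by
  rw [pairing_apply]
  push_cast
  refine Finset.sum_congr rfl fun a _ => Finset.sum_congr rfl fun c _ => ?_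
  rw [adjointPoly, map_sum]
  refine Finset.sum_congr rfl fun f _ => ?_
  rw [← MvPolynomial.smul_eq_C_mul, map_smul, smul_eq_mul, Complex.conj_mul']

theorem taylorCoef_eq_zero_of_pairing {Ψ : Smooth (V →L[ℂ] V)} {n : ℕ}
    (h : pairing Ψ (adjointPoly Ψ n) = 0) (v : E3) : taylorCoef Ψ n v = 0 := by
  rw [pairing_adjointPoly, Complex.ofReal_eq_zero] at h
  rw [Finset.sum_eq_zero_iff_of_nonneg (fun _ _ => by positivity)] at h
  apply mat_injective
  ext a c
  rw [mat_taylorCoef, map_zero]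
  refine Finset.sum_eq_zero fun f _ => ?_
  have h1 := h c (Finset.mem_univ _)
  rw [Finset.sum_eq_zero_iff_of_nonneg (fun _ _ => by positivity)] at h1
  have h2 := h1 a (Finset.mem_univ _)
  rw [Finset.sum_eq_zero_iff_of_nonneg (fun _ _ => by positivity)] at h2
  have h3 := h2 f (Finset.mem_univ _)
  rw [sq_eq_zero_iff, norm_eq_zero] at h3
  rw [h3, mul_zero]

theorem IsWeightRep.adjoint_conj (h : IsWeightRep τ J m) (k : SO3) (A : V →L[ℂ] V) :
    ContinuousLinearMap.adjoint (τ k * A * τ k⁻¹) =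
      τ k * ContinuousLinearMap.adjoint A * τ k⁻¹ := by
  rw [← ContinuousLinearMap.star_eq_adjoint, star_mul, star_mul,
    ContinuousLinearMap.star_eq_adjoint, ContinuousLinearMap.star_eq_adjoint,
    ContinuousLinearMap.star_eq_adjoint, h.unitary, h.unitary, inv_inv, mul_assoc]

/-- Expansion of an equivariant homogeneous function in powers of `J`, with parity. -/
theorem IsWeightRep.exists_expansion (h : IsWeightRep τ J m) {T : E3 → (V →L[ℂ] V)} {n : ℕ}
    (hT : ∀ k v, T (rot k v) = τ k * T v * τ k⁻¹)
    (hn : ∀ (c : ℝ) v, T (c • v) = (c : ℂ) ^ n • T v) :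
    ∃ c : ℕ → ℂ, (∀ l, Odd (n + l) → c l = 0) ∧ ∀ (N : ℕ) (v : E3), m ≤ N →
      (‖v‖ : ℂ) ^ (2 * N) • T v =
        ∑ l ∈ Finset.range (2 * m + 1), c l • (‖v‖ : ℂ) ^ (2 * N + n - l) • J v ^ l := by
  obtain ⟨c, hc⟩ := h.exists_poly (A := T (unitVec 2)) (h.commute_J fun k hk => by rw [← hT, hk])
  have hconj : ∀ k, T (rot k (unitVec 2)) =
      ∑ l ∈ Finset.range (2 * m + 1), c l • J (rot k (unitVec 2)) ^ l := by
    intro k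
    rw [hT, hc, ← conjHom_apply, map_sum]
    refine Finset.sum_congr rfl fun l _ => ?_
    rw [map_smul, map_pow, conjHom_apply, h.J_rot]
  -- A half-turn reverses `e₃`. Comparing equivariance under it with homogeneity under `-1` shows
  -- that the coefficients multiplied by `(-1)^(n+l)` represent the same operator; the mean of both
  -- expansions keeps only `l` with `n + l` even.
  obtain ⟨k0, hk0⟩ := exists_rot_eq (unitVec 2) (-unitVec 2) (norm_neg _).symm
  have hneg := hconj k0
  rw [hk0] at hneg
  have h1 : T (-unitVec 2) = (-1 : ℂ) ^ n • T (unitVec 2) := by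
    have := hn (-1) (unitVec 2)
    rw [neg_one_smul] at this
    rw [this]
    simp
  have hpar : T (unitVec 2) = ∑ l ∈ Finset.range (2 * m + 1),
      ((1 + (-1) ^ (n + l)) / 2 * c l) • J (unitVec 2) ^ l := by
    have h2 : T (unitVec 2) = ∑ l ∈ Finset.range (2 * m + 1),
        ((-1) ^ (n + l) * c l) • J (unitVec 2) ^ l := by
      have h3 : T (unitVec 2) = (-1 : ℂ) ^ n • T (-unitVec 2) := by
        rw [h1, smul_smul, ← mul_pow]
        simp
      rw [h3, hneg, Finset.smul_sum]
      refine Finset.sum_congr rfl fun l _ => ?_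
      have h4 : J (-unitVec 2) ^ l = (-1 : ℂ) ^ l • J (unitVec 2) ^ l := by
        rw [map_neg, ← smul_pow, neg_one_smul]
      rw [h4, smul_smul, smul_smul, pow_add]
      ring_nf
    have h3 : T (unitVec 2) = (2⁻¹ : ℂ) • (T (unitVec 2) + T (unitVec 2)) := by
      rw [← two_smul ℂ, smul_smul, inv_mul_cancel₀ two_ne_zero, one_smul]
    rw [h3]
    nth_rewrite 1 [hc]
    rw [h2, ← Finset.sum_add_distrib, Finset.smul_sum]
    refine Finset.sum_congr rfl fun l _ => ?_
    rw [← add_smul, smul_smul]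
    ring_nf
  refine ⟨fun l => (1 + (-1) ^ (n + l)) / 2 * c l, fun l hl => by simp [hl.neg_one_pow],
    fun N v hN => ?_⟩
  obtain ⟨k, hk⟩ := exists_rot_eq (‖v‖ • unitVec 2) v (by simp [norm_smul])
  have hJ : ∀ l, J v ^ l = (‖v‖ : ℂ) ^ l • conjHom τ k (J (unitVec 2) ^ l) := by
    intro l
    rw [map_pow, conjHom_apply, ← h.J_rot, ← smul_pow]
    congr 1
    conv_lhs => rw [← hk, rot_smul, map_smul]
    exact (Complex.coe_smul _ _).symm
  have hTv : T v = (‖v‖ : ℂ) ^ n • conjHom τ k (T (unitVec 2)) := by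
    rw [conjHom_apply, ← hT, ← hn, ← rot_smul, hk]
  rw [hTv, hpar, map_sum, Finset.smul_sum, Finset.smul_sum]
  refine Finset.sum_congr rfl fun l hl => ?_
  rw [Finset.mem_range] at hl
  rw [hJ, map_smul, smul_smul, smul_smul, smul_smul, smul_smul]
  congr 1
  have : (‖v‖ : ℂ) ^ (2 * N + n) = (‖v‖ : ℂ) ^ (2 * N + n - l) * (‖v‖ : ℂ) ^ l := by
    rw [← pow_add]
    congr 1
    -- The hypothesis `m ≤ N` gives `l ≤ 2m ≤ 2N + n`, so the natural subtraction in the exponent is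
    -- not truncated.
    omega
  rw [← pow_add, this]
  ring

/-- The adjoint of the Taylor coefficient is again equivariant and homogeneous, so after
multiplication by `|X|^(2m)` it is a combination of products of powers of `|X|²` and of the symbol.
The form sends each such term to a multiple of `Tr Ψ(0) = 0`; the factor `ev^m` produced by clearing
denominators is cancelled since `ev ≠ 0`. -/
theorem IsWeightRep.taylorCoef_eq_zero (h : IsWeightRep τ J m) {Ψ : Smooth (V →L[ℂ] V)}
    {μ ev : ℂ} (hΨ : ∀ k x, Ψ.1 (rot k x) = τ k * Ψ.1 x * τ k⁻¹)
    (hD : Dop τ Ψ = μ • Ψ) (hL : ∀ x, Laplacian.laplacian Ψ.1 x = ev • Ψ.1 x) (hev : ev ≠ 0)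
    (h0 : tr V (Ψ.1 0) = 0) (n : ℕ) (v : E3) : taylorCoef Ψ n v = 0 := by
  have hN := Op_normSqPoly hL
  refine taylorCoef_eq_zero_of_pairing ?_ v
  obtain ⟨c, hc, hexp⟩ := h.exists_expansion (n := n)
    (T := fun v => ContinuousLinearMap.adjoint (taylorCoef Ψ n v))
    (fun k v => by rw [taylorCoef_rot hΨ, h.adjoint_conj])
    (fun c v => by
      rw [taylorCoef_smul, ← ContinuousLinearMap.star_eq_adjoint, star_smul, star_pow]
      simp [ContinuousLinearMap.star_eq_adjoint])
  have hid : normSqPoly ^ m • adjointPoly Ψ n = ∑ l ∈ Finset.range (2 * m + 1),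
      c l • (normSqPoly ^ ((2 * m + n - l) / 2) • symbolMat J ^ l) := by
    refine ext_evalMat fun w => ?_
    rw [evalMat_smul, map_pow, eval_normSqPoly, evalMat_adjointPoly, ← pow_mul, ← map_smul,
      hexp m w le_rfl, map_sum, map_sum]
    refine Finset.sum_congr rfl fun l hl => ?_
    rw [Finset.mem_range] at hl
    have h1 : evalMat w (c l • (normSqPoly ^ ((2 * m + n - l) / 2) • symbolMat J ^ l)) =
        c l • evalMat w (normSqPoly ^ ((2 * m + n - l) / 2) • symbolMat J ^ l) := by
      ext a b
      simp [evalMat_apply]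
    rw [h1, evalMat_smul, map_pow, map_pow, eval_normSqPoly, evalMat_symbolMat, map_smul, map_smul,
      map_pow, ← pow_mul]
    -- Parity is needed here: for even `n + l` the power of `‖w‖` is a power of `‖w‖²`, hence
    -- polynomial; the odd terms have zero coefficient.
    rcases Nat.even_or_odd (n + l) with he | ho
    · obtain ⟨r, hr⟩ := he
      congr 3
      omega
    · rw [hc l ho, zero_smul, zero_smul]
  have h2 := congrArg (pairing Ψ) hid
  rw [pairing_normSq_pow hN, map_sum, Finset.sum_eq_zero] at h2
  · exact (mul_eq_zero.1 h2).resolve_left (pow_ne_zero _ hev)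
  · intro l _
    have := h.pairing_symbol_pow hD 1 l
    rw [one_mul] at this
    rw [map_smul, pairing_normSq_pow hN, this, pairing_one, h0]
    simp

/-- Two bounded eigenfunctions of exponential type with the same eigenvalues and the same trace at
the origin are equal. -/
theorem IsWeightRep.eq_of_eigen (h : IsWeightRep τ J m) {Φ₁ Φ₂ : Smooth (V →L[ℂ] V)}
    {μ ev : ℂ} (hΦ₁ : ∀ k x, Φ₁.1 (rot k x) = τ k * Φ₁.1 x * τ k⁻¹)
    (hΦ₂ : ∀ k x, Φ₂.1 (rot k x) = τ k * Φ₂.1 x * τ k⁻¹)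
    (hD₁ : Dop τ Φ₁ = μ • Φ₁) (hD₂ : Dop τ Φ₂ = μ • Φ₂)
    (hL₁ : ∀ x, Laplacian.laplacian Φ₁.1 x = ev • Φ₁.1 x)
    (hL₂ : ∀ x, Laplacian.laplacian Φ₂.1 x = ev • Φ₂.1 x) (hev : ev ≠ 0)
    (h0 : tr V (Φ₁.1 0) = tr V (Φ₂.1 0))
    (hb₁ : ∀ v, ∃ A C : ℝ, ∀ n x, ‖((pd v ^ n) Φ₁).1 x‖ ≤ A * C ^ n)
    (hb₂ : ∀ v, ∃ A C : ℝ, ∀ n x, ‖((pd v ^ n) Φ₂).1 x‖ ≤ A * C ^ n) : Φ₁ = Φ₂ := by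
  have hz := h.taylorCoef_eq_zero (Ψ := Φ₁ - Φ₂) (μ := μ) (ev := ev)
    (fun k x => by
      change Φ₁.1 (rot k x) - Φ₂.1 (rot k x) = τ k * (Φ₁.1 x - Φ₂.1 x) * τ k⁻¹
      rw [hΦ₁, hΦ₂, mul_sub, sub_mul])
    (by rw [map_sub, hD₁, hD₂, smul_sub])
    (fun x => by
      have h1 := hL₁ x
      have h2 := hL₂ x
      rw [laplacian_eq] at h1 h2 ⊢
      simp only [map_sub, Finset.sum_sub_distrib]
      change _ - _ = ev • (Φ₁.1 x - Φ₂.1 x)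
      rw [smul_sub, ← h1, ← h2])
    hev (by
      change tr V (Φ₁.1 0 - Φ₂.1 0) = 0
      rw [map_sub, h0, sub_self])
  rw [← sub_eq_zero]
  ext1; funext v
  obtain ⟨A, C, hA⟩ := hb₁ v
  obtain ⟨A', C', hA'⟩ := hb₂ v
  -- The given constants carry no sign information, hence the absolute values.
  refine smooth_eq_zero_of_bound (A := |A| + |A'|) (C := max |C| |C'|) (fun n x => ?_)
    (fun n => hz n v)
  have h1 : ((pd v ^ n) (Φ₁ - Φ₂)).1 x = ((pd v ^ n) Φ₁).1 x - ((pd v ^ n) Φ₂).1 x := by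
    rw [map_sub]
    rfl
  rw [h1]
  have e1 : A * C ^ n ≤ |A| * max |C| |C'| ^ n :=
    (le_abs_self _).trans (by rw [abs_mul, abs_pow]; gcongr; exact le_max_left _ _)
  have e2 : A' * C' ^ n ≤ |A'| * max |C| |C'| ^ n :=
    (le_abs_self _).trans (by rw [abs_mul, abs_pow]; gcongr; exact le_max_right _ _)
  calc _ ≤ ‖((pd v ^ n) Φ₁).1 x‖ + ‖((pd v ^ n) Φ₂).1 x‖ := norm_sub_le _ _
    _ ≤ A * C ^ n + A' * C' ^ n := add_le_add (hA n x) (hA' n x)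
    _ ≤ _ := by rw [add_mul]; exact add_le_add e1 e2

end Eigen

/-! ### Convolution equations for spherical functions -/

section Convolution

variable {V : Type*} [NormedAddCommGroup V] [InnerProductSpace ℂ V] [FiniteDimensional ℂ V]
variable {τ : SO3 →* (V →L[ℂ] V)} {J : E3 →ₗ[ℝ] (V →L[ℂ] V)} {m : ℕ}

theorem exists_bound_of_memLp_top {W : Type*} [NormedAddCommGroup W] {Φ : E3 → W}
    (h : MemLp Φ ⊤) : ∃ C : ℝ, ∀ᵐ x : E3, ‖Φ x‖ ≤ C := by
  refine ⟨(eLpNorm Φ ⊤ volume).toReal, ?_⟩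
  filter_upwards [ae_le_eLpNormEssSup (f := Φ) (μ := volume)] with x hx
  rw [← eLpNorm_exponent_top] at hx
  simpa using ENNReal.toReal_mono h.2.ne hx

theorem ae_comp_neg {p : E3 → Prop} (h : ∀ᵐ x : E3, p x) : ∀ᵐ x : E3, p (-x) :=
  (Measure.measurePreserving_neg (volume : Measure E3)).quasiMeasurePreserving.ae h

theorem ae_comp_sub_left {p : E3 → Prop} (h : ∀ᵐ x : E3, p x) (a : E3) : ∀ᵐ x : E3, p (a - x) :=
  (quasiMeasurePreserving_sub_left (volume : Measure E3) a).ae h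

theorem ae_comp_rot {p : E3 → Prop} (h : ∀ᵐ x : E3, p x) (k : SO3) : ∀ᵐ x : E3, p (rot k x) :=
  (measurePreserving_rot k).quasiMeasurePreserving.ae h

theorem aestronglyMeasurable_comp_neg {W : Type*} [TopologicalSpace W] {Φ : E3 → W}
    (h : AEStronglyMeasurable Φ) : AEStronglyMeasurable (fun x => Φ (-x)) :=
  h.comp_quasiMeasurePreserving
    (Measure.measurePreserving_neg (volume : Measure E3)).quasiMeasurePreserving

theorem integrable_mul_sub {F Φ : E3 → (V →L[ℂ] V)} (hF : Integrable F) (hΦ : MemLp Φ ⊤) (a : E3) :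
    Integrable (fun y => F y * Φ (a - y)) := by
  obtain ⟨C, hC⟩ := exists_bound_of_memLp_top hΦ
  have h1 : AEStronglyMeasurable (fun y => Φ (a - y)) :=
    hΦ.1.comp_quasiMeasurePreserving (quasiMeasurePreserving_sub_left (volume : Measure E3) a)
  refine (hF.norm.mul_const C).mono' (hF.1.mul h1) ?_
  filter_upwards [ae_comp_sub_left hC a] with y hy
  exact (norm_mul_le _ _).trans (mul_le_mul_of_nonneg_left hy (norm_nonneg _))

/-- Fubini and the substitution `u = x - y` move `F` onto `Φ`: the transform of `G * F` against `Φ`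
is that of `G` against the convolution of `F` with `Φ`. -/
theorem sphericalTransform_conv {G F Φ : E3 → (V →L[ℂ] V)} (hG : Integrable G) (hF : Integrable F)
    (hΦ : MemLp Φ ⊤) : sphericalTransform (conv G F) Φ = ((Module.finrank ℂ V : ℂ))⁻¹ *
      ∫ u : E3, tr V (G u * ∫ y : E3, F y * Φ (-u - y)) := by
  obtain ⟨C, hC⟩ := exists_bound_of_memLp_top hΦ
  have hneg := aestronglyMeasurable_comp_neg hΦ.1
  have hCn := ae_comp_neg hC
  have h1 : Integrable (fun p : E3 × E3 => G (p.1 - p.2) * F p.2) (volume.prod volume) :=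
    Integrable.convolution_integrand (ContinuousLinearMap.mul ℝ (V →L[ℂ] V)).flip hF hG
  have h2 : Integrable (fun p : E3 × E3 => G (p.1 - p.2) * F p.2 * Φ (-p.1))
      (volume.prod volume) := by
    have hm : AEStronglyMeasurable (fun p : E3 × E3 => Φ (-p.1)) (volume.prod volume) :=
      hneg.comp_quasiMeasurePreserving Measure.quasiMeasurePreserving_fst
    refine (h1.norm.mul_const C).mono' (h1.1.mul hm) ?_
    filter_upwards [Measure.quasiMeasurePreserving_fst.ae hCn] with p hp
    exact (norm_mul_le _ _).trans (mul_le_mul_of_nonneg_left hp (norm_nonneg _))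
  have h3 : Integrable (fun p : E3 × E3 => tr V (G (p.1 - p.2) * F p.2 * Φ (-p.1)))
      (volume.prod volume) := (tr V).integrable_comp h2
  have h4 : Integrable (fun p : E3 × E3 => tr V (G p.1 * F p.2 * Φ (-p.1 - p.2)))
      (volume.prod volume) := by
    have := (measurePreserving_add_prod (volume : Measure E3) (volume : Measure E3)).integrable_comp
      h3.1 |>.2 h3
    refine this.congr (Eventually.of_forall fun p => ?_)
    simp [sub_eq_add_neg, add_comm]
  rw [sphericalTransform]
  congr 1
  calc ∫ x : E3, tr V (conv G F x * Φ (-x))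
      = ∫ x : E3, ∫ y : E3, tr V (G (x - y) * F y * Φ (-x)) := by
        refine integral_congr_ae ?_
        filter_upwards [h1.prod_right_ae] with x hx
        rw [conv, ← ContinuousLinearMap.mul_apply' ℝ (V →L[ℂ] V), ← ContinuousLinearMap.flip_apply,
          ← ContinuousLinearMap.integral_comp_comm _ hx,
          ← ContinuousLinearMap.integral_comp_comm _ (ContinuousLinearMap.integrable_comp _ hx)]
        rfl
    _ = ∫ y : E3, ∫ x : E3, tr V (G (x - y) * F y * Φ (-x)) := integral_integral_swap h3
    _ = ∫ y : E3, ∫ u : E3, tr V (G u * F y * Φ (-u - y)) := by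
        refine integral_congr_ae (Eventually.of_forall fun y => ?_)
        change _ = ∫ u : E3, tr V (G u * F y * Φ (-u - y))
        rw [← integral_sub_right_eq_self _ y]
        refine integral_congr_ae (Eventually.of_forall fun x => ?_)
        simp
    _ = ∫ u : E3, ∫ y : E3, tr V (G u * F y * Φ (-u - y)) := (integral_integral_swap h4).symm
    _ = _ := by
        refine integral_congr_ae (Eventually.of_forall fun u => ?_)
        have hi := integrable_mul_sub hF hΦ (-u)
        change ∫ y : E3, tr V (G u * F y * Φ (-u - y)) = tr V (G u * ∫ y : E3, F y * Φ (-u - y))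
        rw [← ContinuousLinearMap.mul_apply' ℝ (V →L[ℂ] V),
          ← ContinuousLinearMap.integral_comp_comm _ hi,
          ← ContinuousLinearMap.integral_comp_comm _ (ContinuousLinearMap.integrable_comp _ hi)]
        simp only [ContinuousLinearMap.mul_apply', mul_assoc]

theorem integrable_indicator_of_memLp_top {W : Type*} [NormedAddCommGroup W] {Φ : E3 → W}
    (h : MemLp Φ ⊤) (R : ℝ) : Integrable ((Metric.ball (0 : E3) R).indicator Φ) := by
  rw [integrable_indicator_iff measurableSet_ball]
  exact ((h.locallyIntegrable le_top).integrableOn_isCompact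
    (isCompact_closedBall (0 : E3) R)).mono_set Metric.ball_subset_closedBall

/-- Testing against the adjoint of `Ψ(-x)`, cut off to a ball, gives the integral of the squared
Hilbert–Schmidt norm over that ball. The test function is admissible: it is integrable, and
equivariant because `τ` is unitary and balls are rotation invariant. -/
theorem IsWeightRep.ae_eq_zero_of_pairing (h : IsWeightRep τ J m) {Ψ : E3 → (V →L[ℂ] V)}
    (hΨ : MemLinfty τ Ψ) (hp : ∀ G, MemL1 τ G → ∫ u : E3, tr V (G u * Ψ (-u)) = 0) :
    Ψ =ᵐ[volume] 0 := by
  have hneg := aestronglyMeasurable_comp_neg hΨ.1.1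
  obtain ⟨C, hC⟩ := exists_bound_of_memLp_top hΨ.1
  have hadj : Continuous (fun A : V →L[ℂ] V => ContinuousLinearMap.adjoint A) :=
    (ContinuousLinearMap.adjoint (𝕜 := ℂ) (E := V) (F := V)).continuous
  have hlinf : MemLp (fun x => ContinuousLinearMap.adjoint (Ψ (-x))) ⊤ := by
    refine memLp_top_of_bound (hadj.comp_aestronglyMeasurable hneg) C ?_
    filter_upwards [ae_comp_neg hC] with x hx
    rwa [LinearIsometryEquiv.norm_map]
  have key : ∀ R : ℕ, ∀ᵐ u : E3, u ∈ Metric.ball (0 : E3) R → Ψ (-u) = 0 := by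
    intro R
    set G : E3 → (V →L[ℂ] V) :=
      (Metric.ball (0 : E3) R).indicator (fun x => ContinuousLinearMap.adjoint (Ψ (-x))) with hG
    have hG1 : MemL1 τ G := by
      refine ⟨integrable_indicator_of_memLp_top hlinf _, fun k => ?_⟩
      filter_upwards [ae_comp_neg (hΨ.2 k)] with x hx
      have hmem : rot k x ∈ Metric.ball (0 : E3) R ↔ x ∈ Metric.ball (0 : E3) R := by
        simp [norm_rot]
      by_cases hb : x ∈ Metric.ball (0 : E3) R
      · rw [hG, Set.indicator_of_mem hb, Set.indicator_of_mem (hmem.2 hb), ← rot_neg, hx,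
          h.adjoint_conj]
      · rw [hG, Set.indicator_of_notMem hb, Set.indicator_of_notMem (fun h => hb (hmem.1 h))]
        simp
    have h0 := hp G hG1
    set f : E3 → ℝ := (Metric.ball (0 : E3) R).indicator
      (fun u => ∑ i, ‖Ψ (-u) (stdOrthonormalBasis ℂ V i)‖ ^ 2) with hf
    have hGf : ∀ u, tr V (G u * Ψ (-u)) = (f u : ℂ) := by
      intro u
      by_cases hb : u ∈ Metric.ball (0 : E3) R
      · rw [hG, hf, Set.indicator_of_mem hb, Set.indicator_of_mem hb, tr_adjoint_mul_self]
      · rw [hG, hf, Set.indicator_of_notMem hb, Set.indicator_of_notMem hb]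
        simp
    have hint : Integrable (fun u => tr V (G u * Ψ (-u))) := by
      have := (tr V).integrable_comp (integrable_mul_sub hG1.1 hΨ.1 0)
      simpa using this
    simp only [hGf] at h0 hint
    rw [integral_complex_ofReal, Complex.ofReal_eq_zero, integral_eq_zero_iff_of_nonneg
      (fun u => Set.indicator_nonneg (fun _ _ => by positivity) u) (by simpa using hint.re)] at h0
    filter_upwards [h0] with u hu hb
    simp only [Set.indicator_of_mem hb] at hu
    exact eq_zero_of_sum_norm_sq hu
  have hall : ∀ᵐ u : E3, Ψ (-u) = 0 := by
    filter_upwards [ae_all_iff.2 key] with u hu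
    obtain ⟨R, hR⟩ := exists_nat_gt ‖u‖
    exact hu R (by simpa using hR)
  filter_upwards [ae_comp_neg hall] with u hu
  simpa using hu

/-- The convolution of a compactly supported function with a locally integrable one. -/
def lconv (F Φ : E3 → (V →L[ℂ] V)) (x : E3) : V →L[ℂ] V := ∫ y : E3, F y * Φ (x - y)

theorem memLinfty_locallyIntegrable {Φ : E3 → (V →L[ℂ] V)} (hΦ : MemLp Φ ⊤) :
    LocallyIntegrable Φ := hΦ.locallyIntegrable le_top

theorem continuous_lconv {F Φ : E3 → (V →L[ℂ] V)} (hF : Continuous F) (hc : HasCompactSupport F)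
    (hΦ : MemLp Φ ⊤) : Continuous (lconv F Φ) :=
  hc.continuous_convolution_left (ContinuousLinearMap.mul ℝ (V →L[ℂ] V)) hF
    (memLinfty_locallyIntegrable hΦ)

theorem memLinfty_lconv {F Φ : E3 → (V →L[ℂ] V)} (hF : Continuous F) (hc : HasCompactSupport F)
    (hFτ : ∀ k x, F (rot k x) = τ k * F x * τ k⁻¹) (hΦ : MemLinfty τ Φ) :
    MemLinfty τ (lconv F Φ) := by
  obtain ⟨C, hC⟩ := exists_bound_of_memLp_top hΦ.1
  have hFi : Integrable F := hF.integrable_of_hasCompactSupport hc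
  refine ⟨memLp_top_of_bound (continuous_lconv hF hc hΦ.1).aestronglyMeasurable
    (∫ y, ‖F y‖ * C) (Eventually.of_forall fun x => ?_), fun k => Eventually.of_forall fun x => ?_⟩
  · refine norm_integral_le_of_norm_le (hFi.norm.mul_const C) ?_
    filter_upwards [ae_comp_sub_left hC x] with y hy
    exact (norm_mul_le _ _).trans (mul_le_mul_of_nonneg_left hy (norm_nonneg _))
  · have hi := integrable_mul_sub hFi hΦ.1 x
    calc lconv F Φ (rot k x) = ∫ y, F (rot k y) * Φ (rot k x - rot k y) :=
          (integral_rot k (fun y => F y * Φ (rot k x - y))).symm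
      _ = ∫ y, conjHom τ k (F y * Φ (x - y)) := by
          refine integral_congr_ae ?_
          filter_upwards [ae_comp_sub_left (hΦ.2 k) x] with y hy
          rw [← rot_sub, hy, hFτ, map_mul]
          rfl
      _ = conjHom τ k (lconv F Φ x) := ContinuousLinearMap.integral_comp_comm
          (LinearMap.toContinuousLinearMap (conjHom τ k).toLinearMap) hi
      _ = _ := rfl

/-- The convolution equation satisfied by a spherical function. -/
theorem IsWeightRep.lconv_ae_eq (h : IsWeightRep τ J m) {F Φ : E3 → (V →L[ℂ] V)}
    (hF : Continuous F) (hc : HasCompactSupport F)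
    (hFτ : ∀ k x, F (rot k x) = τ k * F x * τ k⁻¹) (hΦ : IsSpherical τ Φ) :
    lconv F Φ =ᵐ[volume] fun x => sphericalTransform F Φ • Φ x := by
  have hFi : Integrable F := hF.integrable_of_hasCompactSupport hc
  have hF1 : MemL1 τ F := ⟨hFi, fun k => Eventually.of_forall (hFτ k)⟩
  have hl := memLinfty_lconv hF hc hFτ hΦ.memLinfty
  set c := sphericalTransform F Φ with hcdef
  have hmem : MemLinfty τ (fun x => lconv F Φ x - c • Φ x) := by
    refine ⟨hl.1.sub (hΦ.memLinfty.1.const_smul c), fun k => ?_⟩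
    filter_upwards [hl.2 k, hΦ.memLinfty.2 k] with x h1 h2
    rw [h1, h2, mul_sub, sub_mul]
    simp
  -- Multiplicativity on the product `G * F`, rewritten by Fubini, says exactly that this difference
  -- pairs to zero with `G`.
  have hz := h.ae_eq_zero_of_pairing hmem fun G hG => by
    have h1 := hΦ.map_conv G F hG hF1
    rw [sphericalTransform_conv hG.1 hFi hΦ.memLinfty.1] at h1
    have hi1 : Integrable (fun u => tr V (G u * lconv F Φ (-u))) := by
      have := (tr V).integrable_comp (integrable_mul_sub hG.1 hl.1 0)
      simpa using this
    have hi2 : Integrable (fun u => tr V (G u * Φ (-u))) := by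
      have := (tr V).integrable_comp (integrable_mul_sub hG.1 hΦ.memLinfty.1 0)
      simpa using this
    have hd : (Module.finrank ℂ V : ℂ)⁻¹ ≠ 0 := by
      rw [h.finrank_eq]
      exact inv_ne_zero (Nat.cast_ne_zero.2 (by omega))
    simp only [mul_sub, map_sub, mul_smul_comm, map_smul]
    rw [integral_sub hi1 (hi2.fun_smul c), integral_smul]
    have h2 : sphericalTransform G Φ =
      (Module.finrank ℂ V : ℂ)⁻¹ * ∫ u : E3, tr V (G u * Φ (-u)) := rfl
    rw [h2] at h1
    apply mul_left_cancel₀ hd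
    rw [mul_sub, mul_zero, sub_eq_zero, smul_eq_mul]
    refine h1.trans ?_
    rw [hcdef]
    ring
  filter_upwards [hz] with x hx
  exact sub_eq_zero.1 hx

end Convolution

/-! ### Smoothness of spherical functions -/

section Smoothing

variable {V : Type*} [NormedAddCommGroup V] [InnerProductSpace ℂ V] [FiniteDimensional ℂ V]
variable {τ : SO3 →* (V →L[ℂ] V)} {J : E3 →ₗ[ℝ] (V →L[ℂ] V)} {m : ℕ}

/-- A radial bump function, equal to `1` on the ball of radius `R` and supported in the ball of
radius `2R`. -/
def bump (R : ℝ) : Smooth ℂ :=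
  ⟨fun x => (Real.smoothTransition (2 - ‖x‖ ^ 2 / R ^ 2) : ℂ), by
    have h : ContDiff ℝ ∞ (fun x : E3 => 2 - ‖x‖ ^ 2 / R ^ 2) :=
      contDiff_const.sub ((contDiff_norm_sq ℝ).div_const _)
    exact Complex.ofRealCLM.contDiff.comp (Real.smoothTransition.contDiff.comp h)⟩

/-- The real-valued profile of `bump`. -/
def bumpReal (R : ℝ) (x : E3) : ℝ := Real.smoothTransition (2 - ‖x‖ ^ 2 / R ^ 2)

theorem bump_apply (R : ℝ) (x : E3) : (bump R).1 x = (bumpReal R x : ℂ) := rfl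

theorem bump_rot (R : ℝ) (k : SO3) (x : E3) : (bump R).1 (rot k x) = (bump R).1 x := by
  rw [bump_apply, bump_apply, bumpReal, bumpReal, norm_rot]

theorem bumpReal_nonneg (R : ℝ) (x : E3) : 0 ≤ bumpReal R x := Real.smoothTransition.nonneg _

theorem bumpReal_le_one (R : ℝ) (x : E3) : bumpReal R x ≤ 1 := Real.smoothTransition.le_one _

theorem bumpReal_eq_one {R : ℝ} (hR : 0 < R) {x : E3} (hx : ‖x‖ ≤ R) : bumpReal R x = 1 := by
  apply Real.smoothTransition.one_of_one_le
  have : ‖x‖ ^ 2 / R ^ 2 ≤ 1 := by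
    rw [div_le_one (by positivity)]
    gcongr
  linarith

theorem bumpReal_eq_zero {R : ℝ} (hR : 0 < R) {x : E3} (hx : 2 * R < ‖x‖) : bumpReal R x = 0 := by
  apply Real.smoothTransition.zero_of_nonpos
  have : 2 ≤ ‖x‖ ^ 2 / R ^ 2 := by
    rw [le_div_iff₀ (by positivity)]
    nlinarith
  linarith

theorem bumpReal_smul {R : ℝ} (hR : 0 < R) (x : E3) : bumpReal R (R • x) = bumpReal 1 x := by
  rw [bumpReal, bumpReal, norm_smul, mul_pow, Real.norm_eq_abs, sq_abs, one_pow, div_one,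
    mul_div_cancel_left₀ _ (by positivity)]

theorem hasCompactSupport_bump {R : ℝ} (hR : 0 < R) : HasCompactSupport (bump R).1 := by
  refine HasCompactSupport.of_support_subset_isCompact (isCompact_closedBall (0 : E3) (2 * R)) ?_
  intro x hx
  by_contra h
  rw [mem_closedBall_zero_iff, not_le] at h
  exact hx (by rw [bump_apply, bumpReal_eq_zero hR h, Complex.ofReal_zero])

theorem integrable_bumpReal {R : ℝ} (hR : 0 < R) : Integrable (bumpReal R) := by
  have h : Integrable (bump R).1 :=
    (continuous_smooth _).integrable_of_hasCompactSupport (hasCompactSupport_bump hR)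
  exact h.re

theorem integral_bumpReal_pos {R : ℝ} (hR : 0 < R) : 0 < ∫ x, bumpReal R x := by
  rw [integral_pos_iff_support_of_nonneg (bumpReal_nonneg R) (integrable_bumpReal hR)]
  refine (Metric.measure_ball_pos volume (0 : E3) hR).trans_le (measure_mono fun x hx => ?_)
  rw [mem_ball_zero_iff] at hx
  rw [Function.mem_support, bumpReal_eq_one hR hx.le]
  exact one_ne_zero

/-- Convolution with a scalar function. -/
def sconv {W : Type*} [NormedAddCommGroup W] [NormedSpace ℂ W] (f : E3 → ℂ) (Φ : E3 → W) (x : E3) :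
    W := ∫ y : E3, f y • Φ (x - y)

theorem hasCompactSupport_pd {W : Type*} [NormedAddCommGroup W] [NormedSpace ℂ W] {f : Smooth W}
    (hc : HasCompactSupport f.1) (v : E3) : HasCompactSupport (pd v f).1 :=
  (hc.fderiv (𝕜 := ℝ)).comp_left (g := fun L : E3 →L[ℝ] W => L v) rfl

theorem contDiff_sconv {f : Smooth ℂ} {Φ : E3 → (V →L[ℂ] V)} (hc : HasCompactSupport f.1)
    (hΦ : MemLp Φ ⊤) : ContDiff ℝ ∞ (sconv f.1 Φ) :=
  hc.contDiff_convolution_left (ContinuousLinearMap.lsmul ℝ ℂ) (n := ⊤) (contDiff_of_smooth f)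
    (memLinfty_locallyIntegrable hΦ)

theorem integrable_smul_sub {W : Type*} [NormedAddCommGroup W] [NormedSpace ℂ W]
    {f : E3 → ℂ} {Φ : E3 → W} (hf : Integrable f) (hΦ : MemLp Φ ⊤) (a : E3) :
    Integrable (fun y => f y • Φ (a - y)) := by
  obtain ⟨C, hC⟩ := exists_bound_of_memLp_top hΦ
  have h1 : AEStronglyMeasurable (fun y => Φ (a - y)) :=
    hΦ.1.comp_quasiMeasurePreserving (quasiMeasurePreserving_sub_left (volume : Measure E3) a)
  refine (hf.norm.mul_const C).mono' (hf.1.smul h1) ?_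
  filter_upwards [ae_comp_sub_left hC a] with y hy
  rw [norm_smul]
  exact mul_le_mul_of_nonneg_left hy (norm_nonneg _)

theorem fderiv_sconv {f : Smooth ℂ} {Φ : E3 → (V →L[ℂ] V)} (hc : HasCompactSupport f.1)
    (hΦ : MemLp Φ ⊤) (x v : E3) : fderiv ℝ (sconv f.1 Φ) x v = sconv (pd v f).1 Φ x := by
  have hloc := memLinfty_locallyIntegrable hΦ
  have h1 := hc.hasFDerivAt_convolution_left (ContinuousLinearMap.lsmul ℝ ℂ (E := V →L[ℂ] V))
    ((contDiff_of_smooth f).of_le (by norm_cast)) hloc x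
  have h2 : HasFDerivAt (sconv f.1 Φ) _ x := h1
  rw [h2.fderiv]
  have hex := (hc.fderiv (𝕜 := ℝ)).convolutionExists_left (μ := volume) (𝕜 := ℝ)
      (F := E3 →L[ℝ] V →L[ℂ] V)
      ((ContinuousLinearMap.lsmul ℝ ℂ (E := V →L[ℂ] V)).precompL E3)
      ((contDiff_of_smooth f).continuous_fderiv (by simp)) hloc x
  rw [convolution, ContinuousLinearMap.integral_apply hex]
  rfl

/-- Convolution with a compactly supported smooth function, as a smooth function. -/
def smoothConv (f : Smooth ℂ) (hc : HasCompactSupport f.1) {Φ : E3 → (V →L[ℂ] V)}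
    (hΦ : MemLp Φ ⊤) : Smooth (V →L[ℂ] V) := ⟨sconv f.1 Φ, contDiff_sconv hc hΦ⟩

theorem pd_smoothConv {f : Smooth ℂ} {Φ : E3 → (V →L[ℂ] V)} (hc : HasCompactSupport f.1)
    (hΦ : MemLp Φ ⊤) (v : E3) :
    pd v (smoothConv f hc hΦ) = smoothConv (pd v f) (hasCompactSupport_pd hc v) hΦ := by
  ext1; funext x
  exact fderiv_sconv hc hΦ x v

theorem lconv_smul_one (f : E3 → ℂ) (Φ : E3 → (V →L[ℂ] V)) (A : V →L[ℂ] V) (x : E3) :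
    lconv (fun y => f y • A) Φ x = ∫ y, A * (f y • Φ (x - y)) := by
  refine integral_congr_ae (Eventually.of_forall fun y => ?_)
  simp

theorem sconv_eq_lconv (f : E3 → ℂ) (Φ : E3 → (V →L[ℂ] V)) :
    sconv f Φ = lconv (fun y => f y • 1) Φ := by
  funext x
  simp [lconv_smul_one, sconv]

theorem smul_one_equivariant {f : E3 → ℂ} (hf : ∀ k x, f (rot k x) = f x) (k : SO3) (x : E3) :
    f (rot k x) • (1 : V →L[ℂ] V) = τ k * (f x • 1) * τ k⁻¹ := by
  rw [hf, mul_smul_comm, mul_one, smul_mul_assoc, tau_mul_inv]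

theorem hasCompactSupport_smul_const {f : E3 → ℂ} (hc : HasCompactSupport f) (A : V →L[ℂ] V) :
    HasCompactSupport (fun y => f y • A) :=
  hc.comp_left (g := fun c : ℂ => c • A) (zero_smul _ _)

theorem IsWeightRep.sconv_ae_eq (h : IsWeightRep τ J m) {f : Smooth ℂ} {Φ : E3 → (V →L[ℂ] V)}
    (hc : HasCompactSupport f.1) (hf : ∀ k x, f.1 (rot k x) = f.1 x) (hΦ : IsSpherical τ Φ) :
    sconv f.1 Φ =ᵐ[volume]
      fun x => sphericalTransform (fun y => f.1 y • (1 : V →L[ℂ] V)) Φ • Φ x := by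
  rw [sconv_eq_lconv]
  exact h.lconv_ae_eq (F := fun y => f.1 y • (1 : V →L[ℂ] V))
    ((continuous_smooth f).smul continuous_const) (hasCompactSupport_smul_const hc 1)
    (smul_one_equivariant hf) hΦ

theorem sphericalTransform_congr {F Φ Ψ : E3 → (V →L[ℂ] V)} (h : Φ =ᵐ[volume] Ψ) :
    sphericalTransform F Φ = sphericalTransform F Ψ := by
  rw [sphericalTransform, sphericalTransform]
  congr 1
  refine integral_congr_ae ?_
  filter_upwards [ae_comp_neg h] with x hx
  rw [hx]

theorem IsSpherical.congr {Φ Ψ : E3 → (V →L[ℂ] V)} (hΦ : IsSpherical τ Φ) (h : Φ =ᵐ[volume] Ψ) :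
    IsSpherical τ Ψ where
  memLinfty := by
    refine ⟨hΦ.memLinfty.1.ae_eq h, fun k => ?_⟩
    filter_upwards [ae_comp_rot h k, h, hΦ.memLinfty.2 k] with x h1 h2 h3
    rw [← h1, ← h2, h3]
  ne_zero h0 := hΦ.ne_zero (h.trans h0)
  map_conv F₁ F₂ h₁ h₂ := by
    simp only [← sphericalTransform_congr h]
    exact hΦ.map_conv F₁ F₂ h₁ h₂

/-- Mollification at small scale recovers a bounded function almost everywhere. -/
theorem ae_tendsto_sconv_bump {Φ : E3 → (V →L[ℂ] V)} (hΦ : MemLp Φ ⊤) :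
    ∀ᵐ x : E3, Tendsto (fun r : ℝ => ((∫ y, bumpReal r y : ℝ) : ℂ)⁻¹ • sconv (bump r).1 Φ x)
      (𝓝[>] 0) (𝓝 (Φ x)) := by
  have hloc := memLinfty_locallyIntegrable hΦ
  filter_upwards [(Besicovitch.vitaliFamily (volume : Measure E3)).ae_tendsto_average_norm_sub
    hloc] with x hx
  have h2 : Tendsto (fun r : ℝ => 2 * r) (𝓝[>] 0) (𝓝[>] 0) := by
    refine tendsto_nhdsWithin_iff.2 ⟨?_, ?_⟩
    · have : Tendsto (fun r : ℝ => 2 * r) (𝓝 0) (𝓝 (2 * 0)) := tendsto_id.const_mul 2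
      rw [mul_zero] at this
      exact this.mono_left nhdsWithin_le_nhds
    · filter_upwards [self_mem_nhdsWithin] with r hr
      have hr' : (0 : ℝ) < r := hr
      exact mul_pos two_pos hr'
  have havg := (hx.comp (Besicovitch.tendsto_filterAt volume x)).comp h2
  -- Lebesgue differentiation on the balls of radius `2r` containing the supports. The kernel is at
  -- most the inverse volume of the ball of radius `r`, that is, `2³` times that of the ball of
  -- radius `2r`.
  have key := tendsto_integral_smul_of_tendsto_average_norm_sub
    (g := fun (r : ℝ) y => (∫ z, bumpReal r z)⁻¹ * bumpReal r (x - y)) (2 ^ 3 : ℝ) havg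
    (Eventually.of_forall fun r => hloc.integrableOn_isCompact (isCompact_closedBall _ _))
    (by
      refine tendsto_const_nhds.congr' ?_
      filter_upwards [self_mem_nhdsWithin] with r hr
      rw [integral_const_mul, integral_sub_left_eq_self (bumpReal r) volume x,
        inv_mul_cancel₀ (integral_bumpReal_pos hr).ne'])
    (by
      filter_upwards [self_mem_nhdsWithin] with r hr y hy
      have h3 : bumpReal r (x - y) ≠ 0 := right_ne_zero_of_mul hy
      have h4 : ‖x - y‖ ≤ 2 * r := by
        by_contra h
        exact h3 (bumpReal_eq_zero hr (not_le.1 h))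
      change y ∈ Metric.closedBall x (2 * r)
      rwa [Metric.mem_closedBall, dist_eq_norm, norm_sub_rev])
    (by
      filter_upwards [self_mem_nhdsWithin] with r hr y
      have hr' : (0 : ℝ) < r := hr
      have hpos := integral_bumpReal_pos hr'
      rw [abs_of_nonneg (mul_nonneg (inv_nonneg.2 hpos.le) (bumpReal_nonneg _ _))]
      have hball : volume.real (Metric.closedBall x (2 * r)) =
          2 ^ 3 * volume.real (Metric.closedBall (0 : E3) r) := by
        rw [Measure.addHaar_real_closedBall _ _ (by positivity), Measure.addHaar_real_closedBall _ _ hr'.le]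
        simp
        ring
      have hint : volume.real (Metric.closedBall (0 : E3) r) ≤ ∫ z, bumpReal r z := by
        rw [← setIntegral_one_eq_measureReal]
        calc ∫ _ in Metric.closedBall (0 : E3) r, (1 : ℝ) = ∫ z in Metric.closedBall (0 : E3) r, bumpReal r z := by
              refine setIntegral_congr_fun measurableSet_closedBall fun z hz => ?_
              rw [mem_closedBall_zero_iff] at hz
              exact (bumpReal_eq_one hr' hz).symm
          _ ≤ _ := setIntegral_le_integral (integrable_bumpReal hr')
              (Eventually.of_forall (bumpReal_nonneg r))
      have hbpos : 0 < volume.real (Metric.closedBall (0 : E3) r) :=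
        ENNReal.toReal_pos (Metric.measure_closedBall_pos volume _ hr').ne' measure_closedBall_lt_top.ne
      change _ ≤ 2 ^ 3 / volume.real (Metric.closedBall x (2 * r))
      rw [hball, div_mul_eq_div_div, div_self (by norm_num), one_div]
      calc _ ≤ (∫ z, bumpReal r z)⁻¹ * 1 := by
            gcongr
            exact bumpReal_le_one _ _
        _ ≤ _ := by
            rw [mul_one]
            gcongr)
  refine key.congr fun r => ?_
  rw [sconv, ← integral_smul, ← integral_sub_left_eq_self _ volume x]
  refine integral_congr_ae (Eventually.of_forall fun y => ?_)
  simp only [sub_sub_cancel]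
  rw [mul_smul, bump_apply, Complex.coe_smul, ← Complex.ofReal_inv, Complex.coe_smul]

/-- If every bump had transform zero, the convolution equation would make all mollifications of `Φ`
vanish, and `Φ` with them. Radii `1/(n+1)` are used so that only countably many null sets are
removed. -/
theorem IsWeightRep.exists_transform_ne_zero (h : IsWeightRep τ J m) {Φ : E3 → (V →L[ℂ] V)}
    (hΦ : IsSpherical τ Φ) :
    ∃ R : ℝ, 0 < R ∧ sphericalTransform (fun y => (bump R).1 y • (1 : V →L[ℂ] V)) Φ ≠ 0 := by
  by_contra! hcon
  refine hΦ.ne_zero ?_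
  have hz : ∀ n : ℕ, sconv (bump (1 / ((n : ℝ) + 1))).1 Φ =ᵐ[volume] 0 := by
    intro n
    have hpos : (0 : ℝ) < 1 / ((n : ℝ) + 1) := by positivity
    have := h.sconv_ae_eq (hasCompactSupport_bump hpos) (bump_rot _) hΦ
    refine this.trans (Eventually.of_forall fun x => ?_)
    simp only [hcon _ hpos, zero_smul]
    rfl
  filter_upwards [ae_tendsto_sconv_bump hΦ.memLinfty.1, ae_all_iff.2 hz] with x hx h0
  have hseq : Tendsto (fun n : ℕ => 1 / ((n : ℝ) + 1)) atTop (𝓝[>] 0) :=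
    tendsto_nhdsWithin_iff.2 ⟨tendsto_one_div_add_atTop_nhds_zero_nat,
      Eventually.of_forall fun n => by
        have : (0 : ℝ) < 1 / ((n : ℝ) + 1) := by positivity
        exact this⟩
  have h1 := hx.comp hseq
  refine tendsto_nhds_unique h1 (tendsto_const_nhds.congr fun n => ?_)
  change _ = _ • sconv (bump (1 / ((n : ℝ) + 1))).1 Φ x
  rw [h0 n]
  simp

theorem IsWeightRep.exists_smooth (h : IsWeightRep τ J m) {Φ : E3 → (V →L[ℂ] V)}
    (hΦ : IsSpherical τ Φ) : ∃ Ψ : Smooth (V →L[ℂ] V), Φ =ᵐ[volume] Ψ.1 ∧ IsSpherical τ Ψ.1 := by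
  obtain ⟨R, hR, hne⟩ := h.exists_transform_ne_zero hΦ
  set c := sphericalTransform (fun y => (bump R).1 y • (1 : V →L[ℂ] V)) Φ
  have h1 := h.sconv_ae_eq (hasCompactSupport_bump hR) (bump_rot _) hΦ
  have h2 : Φ =ᵐ[volume] (c⁻¹ • smoothConv (bump R) (hasCompactSupport_bump hR)
      hΦ.memLinfty.1).1 := by
    filter_upwards [h1] with x hx
    change _ = c⁻¹ • sconv (bump R).1 Φ x
    rw [hx, smul_smul, inv_mul_cancel₀ hne, one_smul]
  exact ⟨_, h2, hΦ.congr h2⟩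

end Smoothing

/-! ### Spherical functions are joint eigenfunctions -/

section SphericalEigen

variable {V : Type*} [NormedAddCommGroup V] [InnerProductSpace ℂ V] [FiniteDimensional ℂ V]
variable {τ : SO3 →* (V →L[ℂ] V)} {J : E3 →ₗ[ℝ] (V →L[ℂ] V)} {m : ℕ}

theorem IsSpherical.equivariant {Φ : Smooth (V →L[ℂ] V)} (hΦ : IsSpherical τ Φ.1) (k : SO3)
    (x : E3) : Φ.1 (rot k x) = τ k * Φ.1 x * τ k⁻¹ := by
  have h1 : Continuous (fun x => Φ.1 (rot k x)) := (continuous_smooth Φ).comp (continuous_rot k)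
  have h2 : Continuous (fun x => τ k * Φ.1 x * τ k⁻¹) :=
    (continuous_const.mul (continuous_smooth Φ)).mul continuous_const
  exact congrFun ((h1.ae_eq_iff_eq volume h2).1 (hΦ.memLinfty.2 k)) x

theorem exists_bound_of_continuous {W : Type*} [NormedAddCommGroup W] {Φ : E3 → W}
    (hc : Continuous Φ) (h : MemLp Φ ⊤) : ∃ A : ℝ, 0 ≤ A ∧ ∀ x, ‖Φ x‖ ≤ A := by
  obtain ⟨A, hA⟩ := exists_bound_of_memLp_top h
  have hd : Dense {x | ‖Φ x‖ ≤ A} := Measure.dense_of_ae hA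
  have hcl : IsClosed {x | ‖Φ x‖ ≤ A} := isClosed_le hc.norm continuous_const
  have huniv := hd.closure_eq
  rw [hcl.closure_eq] at huniv
  have hall : ∀ x, ‖Φ x‖ ≤ A := fun x => by
    have hx : x ∈ {x | ‖Φ x‖ ≤ A} := by rw [huniv]; trivial
    exact hx
  exact ⟨A, (norm_nonneg _).trans (hall 0), hall⟩

theorem IsWeightRep.lconv_eq (h : IsWeightRep τ J m) {F : E3 → (V →L[ℂ] V)}
    {Φ : Smooth (V →L[ℂ] V)} (hF : Continuous F) (hc : HasCompactSupport F)
    (hFτ : ∀ k x, F (rot k x) = τ k * F x * τ k⁻¹) (hΦ : IsSpherical τ Φ.1) (x : E3) :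
    lconv F Φ.1 x = sphericalTransform F Φ.1 • Φ.1 x :=
  congrFun (((continuous_lconv hF hc hΦ.memLinfty.1).ae_eq_iff_eq volume
    ((continuous_smooth Φ).fun_const_smul _)).1 (h.lconv_ae_eq hF hc hFτ hΦ)) x

/-- The spherical transform of a scalar function. -/
def scalarTransform (f : E3 → ℂ) (Φ : E3 → (V →L[ℂ] V)) : ℂ :=
  sphericalTransform (fun y => f y • (1 : V →L[ℂ] V)) Φ

theorem scalarTransform_eq (f : E3 → ℂ) (Φ : E3 → (V →L[ℂ] V)) :
    scalarTransform f Φ =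
      (Module.finrank ℂ V : ℂ)⁻¹ * ∫ x : E3, f x * tr V (Φ (-x)) := by
  rw [scalarTransform, sphericalTransform]
  congr 1
  refine integral_congr_ae (Eventually.of_forall fun x => ?_)
  simp only [smul_mul_assoc, one_mul]
  exact (tr V).map_smul _ _

theorem IsWeightRep.sconv_eq (h : IsWeightRep τ J m) {f : Smooth ℂ} {Φ : Smooth (V →L[ℂ] V)}
    (hc : HasCompactSupport f.1) (hf : ∀ k x, f.1 (rot k x) = f.1 x) (hΦ : IsSpherical τ Φ.1)
    (x : E3) : sconv f.1 Φ.1 x = scalarTransform f.1 Φ.1 • Φ.1 x := by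
  rw [sconv_eq_lconv]
  exact h.lconv_eq (F := fun y => f.1 y • (1 : V →L[ℂ] V))
    ((continuous_smooth f).smul continuous_const) (hasCompactSupport_smul_const hc 1)
    (smul_one_equivariant hf) hΦ x

theorem IsWeightRep.smoothConv_eq (h : IsWeightRep τ J m) {f : Smooth ℂ} {Φ : Smooth (V →L[ℂ] V)}
    (hc : HasCompactSupport f.1) (hf : ∀ k x, f.1 (rot k x) = f.1 x) (hΦ : IsSpherical τ Φ.1) :
    smoothConv f hc hΦ.memLinfty.1 = scalarTransform f.1 Φ.1 • Φ := by
  ext1; funext x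
  exact h.sconv_eq hc hf hΦ x

/-- The trace of the convolution equation at the origin: its left side is `dim V` times the
transform of the bump, its right side that transform times `Tr Φ(0)`. -/
theorem IsWeightRep.tr_zero (h : IsWeightRep τ J m) {Φ : Smooth (V →L[ℂ] V)}
    (hΦ : IsSpherical τ Φ.1) : tr V (Φ.1 0) = Module.finrank ℂ V := by
  obtain ⟨R, hR, hne⟩ := h.exists_transform_ne_zero hΦ
  change scalarTransform (bump R).1 Φ.1 ≠ 0 at hne
  have h1 := congrArg (tr V) (h.sconv_eq (hasCompactSupport_bump hR) (bump_rot R) hΦ 0)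
  have hi : Integrable (fun y => (bump R).1 y • Φ.1 (0 - y)) :=
    integrable_smul_sub ((continuous_smooth _).integrable_of_hasCompactSupport
      (hasCompactSupport_bump hR)) hΦ.memLinfty.1 0
  rw [sconv, ← ContinuousLinearMap.integral_comp_comm _ hi, map_smul] at h1
  simp only [map_smul, zero_sub, smul_eq_mul] at h1
  have hd : (Module.finrank ℂ V : ℂ) ≠ 0 := by
    rw [h.finrank_eq]
    exact Nat.cast_ne_zero.2 (by omega)
  have h2 : (∫ x : E3, (bump R).1 x * tr V (Φ.1 (-x))) =
      Module.finrank ℂ V * scalarTransform (bump R).1 Φ.1 := by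
    rw [scalarTransform_eq, mul_inv_cancel_left₀ hd]
  rw [h2, mul_comm] at h1
  exact (mul_left_cancel₀ hne h1).symm

theorem pd_rot_apply {f : Smooth ℂ} (hf : ∀ k x, f.1 (rot k x) = f.1 x) (k : SO3) (v x : E3) :
    (pd v f).1 (rot k x) = (pd (rot k⁻¹ v) f).1 x := by
  have h1 : rotComp k f = f := by
    ext1; funext x
    exact hf k x
  have h2 := pd_rotComp k (rot k⁻¹ v) f
  rw [h1, rot_rot_inv] at h2
  exact (congrFun (congrArg Subtype.val h2) x).symm

theorem sum_pd_pd_rot {W : Type*} [NormedAddCommGroup W] [NormedSpace ℂ W] (f : Smooth W)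
    (k : SO3) : ∑ i, pd (rot k (unitVec i)) (pd (rot k (unitVec i)) f) =
      ∑ i, pd (unitVec i) (pd (unitVec i) f) := by
  have hk : ∀ i l, rot k (unitVec i) l = (k : Matrix (Fin 3) (Fin 3) ℝ) l i := by
    intro i l
    rw [rot_apply]
    simp [unitVec]
  have hent : ∀ l n, ∑ i, (k : Matrix (Fin 3) (Fin 3) ℝ) l i * (k : Matrix (Fin 3) (Fin 3) ℝ) n i =
      if l = n then 1 else 0 := by
    intro l n
    have := congrFun (congrFun (SO3_mul_transpose k) l) n
    rwa [Matrix.mul_apply, Matrix.one_apply] at this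
  have hexp : ∀ i, pd (rot k (unitVec i)) (pd (rot k (unitVec i)) f) =
      ∑ l, ∑ n, (((k : Matrix (Fin 3) (Fin 3) ℝ) l i * (k : Matrix (Fin 3) (Fin 3) ℝ) n i : ℝ) : ℂ) •
        pd (unitVec l) (pd (unitVec n) f) := by
    intro i
    rw [pd_eq_sum (rot k (unitVec i))]
    simp only [LinearMap.sum_apply, LinearMap.smul_apply, map_sum, map_smul, hk, Finset.smul_sum,
      smul_smul, Complex.ofReal_mul]
    rw [Finset.sum_comm]
    refine Finset.sum_congr rfl fun l _ => Finset.sum_congr rfl fun n _ => ?_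
    rw [mul_comm]
  simp only [hexp]
  rw [Finset.sum_comm]
  refine Finset.sum_congr rfl fun l _ => ?_
  rw [Finset.sum_comm]
  simp only [← Finset.sum_smul, ← Complex.ofReal_sum, hent]
  simp

theorem sum_pd_pd_rot_apply {f : Smooth ℂ} (hf : ∀ k x, f.1 (rot k x) = f.1 x) (k : SO3) (x : E3) :
    (∑ i, pd (unitVec i) (pd (unitVec i) f)).1 (rot k x) =
      (∑ i, pd (unitVec i) (pd (unitVec i) f)).1 x := by
  have h1 : rotComp k f = f := by
    ext1; funext x
    exact hf k x
  conv_rhs => rw [← h1]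
  conv_lhs => rw [← sum_pd_pd_rot f k]
  simp only [pd_rotComp, Submodule.coe_sum, Finset.sum_apply]
  rfl

theorem sconv_sum {ι : Type*} (s : Finset ι) {f : ι → E3 → ℂ} {Φ : E3 → (V →L[ℂ] V)}
    (hf : ∀ i, Integrable (f i)) (hΦ : MemLp Φ ⊤) (x : E3) :
    sconv (∑ i ∈ s, f i) Φ x = ∑ i ∈ s, sconv (f i) Φ x := by
  simp only [sconv, Finset.sum_apply, Finset.sum_smul]
  exact integral_finsetSum _ fun i _ => integrable_smul_sub (hf i) hΦ x

theorem integrable_of_compact {f : Smooth ℂ} (hc : HasCompactSupport f.1) : Integrable f.1 :=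
  (continuous_smooth _).integrable_of_hasCompactSupport hc

theorem hasCompactSupport_sum {ι W : Type*} [AddCommMonoid W] (s : Finset ι) {f : ι → E3 → W}
    (h : ∀ i, HasCompactSupport (f i)) : HasCompactSupport (∑ i ∈ s, f i) := by
  classical
  induction s using Finset.induction_on with
  | empty => simpa using HasCompactSupport.zero
  | insert i s hi ih =>
    rw [Finset.sum_insert hi]
    exact (h i).add ih

/-- If `f` is a bump with `f * Φ = c Φ` and `c ≠ 0`, then `c ΔΦ = (Δf) * Φ`. Since `Δf` is again
radial with compact support, the right side is a multiple of `Φ`. -/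
theorem IsWeightRep.exists_laplacian (h : IsWeightRep τ J m) {Φ : Smooth (V →L[ℂ] V)}
    (hΦ : IsSpherical τ Φ.1) : ∃ ev : ℂ, ∀ x, Laplacian.laplacian Φ.1 x = ev • Φ.1 x := by
  obtain ⟨R, hR, hne⟩ := h.exists_transform_ne_zero hΦ
  change scalarTransform (bump R).1 Φ.1 ≠ 0 at hne
  set c := scalarTransform (bump R).1 Φ.1
  have hb := hasCompactSupport_bump hR
  have h1 := h.smoothConv_eq hb (bump_rot R) hΦ
  set f : Smooth ℂ := ∑ i, pd (unitVec i) (pd (unitVec i) (bump R)) with hf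
  have hfc : f.1 = ∑ i, (pd (unitVec i) (pd (unitVec i) (bump R))).1 := by
    rw [hf, Submodule.coe_sum]
  have hfs : HasCompactSupport f.1 := by
    rw [hfc]
    exact hasCompactSupport_sum _ fun i => hasCompactSupport_pd (hasCompactSupport_pd hb _) _
  refine ⟨c⁻¹ * scalarTransform f.1 Φ.1, fun x => ?_⟩
  rw [laplacian_eq, mul_smul, ← h.sconv_eq hfs (sum_pd_pd_rot_apply (bump_rot R)) hΦ, hfc,
    sconv_sum _ (fun i => integrable_of_compact (hasCompactSupport_pd (hasCompactSupport_pd hb _) _))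
      hΦ.memLinfty.1, Finset.smul_sum, Submodule.coe_sum, Finset.sum_apply]
  refine Finset.sum_congr rfl fun i _ => ?_
  have h2 := congrArg (fun g : Smooth (V →L[ℂ] V) => pd (unitVec i) (pd (unitVec i) g)) h1
  simp only [pd_smoothConv, map_smul] at h2
  have h3 := congrFun (congrArg Subtype.val h2) x
  have h4 : sconv (pd (unitVec i) (pd (unitVec i) (bump R))).1 Φ.1 x =
    c • (pd (unitVec i) (pd (unitVec i) Φ)).1 x := h3
  rw [h4, smul_smul, inv_mul_cancel₀ hne, one_smul]

/-- Here `c D_τ Φ = F * Φ` with `F = ∑ ∂ᵢf J(eᵢ)`. The gradient of a radial function and `J` both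
transform as vectors, so `F` is equivariant and the convolution equation applies to it. -/
theorem IsWeightRep.exists_Dop (h : IsWeightRep τ J m) {Φ : Smooth (V →L[ℂ] V)}
    (hΦ : IsSpherical τ Φ.1) : ∃ μ : ℂ, Dop τ Φ = μ • Φ := by
  obtain ⟨R, hR, hne⟩ := h.exists_transform_ne_zero hΦ
  change scalarTransform (bump R).1 Φ.1 ≠ 0 at hne
  set c := scalarTransform (bump R).1 Φ.1
  have hb := hasCompactSupport_bump hR
  have h1 := h.smoothConv_eq hb (bump_rot R) hΦ
  set F : E3 → (V →L[ℂ] V) := ∑ i, fun y => (pd (unitVec i) (bump R)).1 y • J (unitVec i) with hF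
  have hFapp : ∀ y, F y = ∑ i, (pd (unitVec i) (bump R)).1 y • J (unitVec i) := by
    intro y
    rw [hF, Finset.sum_apply]
  have hFs : HasCompactSupport F := hasCompactSupport_sum _ fun i =>
    hasCompactSupport_smul_const (hasCompactSupport_pd hb _) _
  have hFcont : Continuous F := by
    rw [show F = fun y => ∑ i, (pd (unitVec i) (bump R)).1 y • J (unitVec i) from funext hFapp]
    exact continuous_finsetSum _ fun i _ => (continuous_smooth _).fun_smul continuous_const
  have hFτ : ∀ k x, F (rot k x) = τ k * F x * τ k⁻¹ := by
    intro k x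
    have e1 : ∀ i, (pd (unitVec i) (bump R)).1 (rot k x) = ∑ l,
        ((k : Matrix (Fin 3) (Fin 3) ℝ) i l : ℂ) * (pd (unitVec l) (bump R)).1 x := by
      intro i
      rw [pd_rot_apply (bump_rot R), pd_eq_sum (rot k⁻¹ (unitVec i))]
      simp only [LinearMap.sum_apply, Submodule.coe_sum, Finset.sum_apply]
      refine Finset.sum_congr rfl fun l _ => ?_
      have : rot k⁻¹ (unitVec i) l = (k : Matrix (Fin 3) (Fin 3) ℝ) i l := by
        rw [rot_apply, SO3_coe_inv]
        simp [unitVec]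
      rw [this]
      rfl
    have e2 : ∀ l, τ k * J (unitVec l) * τ k⁻¹ = ∑ i,
        ((k : Matrix (Fin 3) (Fin 3) ℝ) i l : ℂ) • J (unitVec i) := by
      intro l
      rw [← h.J_rot, ← sum_smul_unitVec (rot k (unitVec l)), map_sum]
      refine Finset.sum_congr rfl fun i _ => ?_
      have : rot k (unitVec l) i = (k : Matrix (Fin 3) (Fin 3) ℝ) i l := by
        rw [rot_apply]
        simp [unitVec]
      rw [this, map_smul, Complex.coe_smul]
    rw [hFapp, hFapp, ← conjHom_apply, map_sum]
    simp only [map_smul, conjHom_apply, e1, e2, Finset.sum_smul, Finset.smul_sum, smul_smul]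
    rw [Finset.sum_comm]
    refine Finset.sum_congr rfl fun l _ => Finset.sum_congr rfl fun i _ => ?_
    rw [mul_comm]
  refine ⟨c⁻¹ * sphericalTransform F Φ.1, ?_⟩
  ext1; funext x
  change _ = (c⁻¹ * sphericalTransform F Φ.1) • Φ.1 x
  rw [mul_smul, ← h.lconv_eq hFcont hFs hFτ hΦ x, h.Dop_eq]
  have e3 : lconv F Φ.1 x = ∑ i, J (unitVec i) * sconv (pd (unitVec i) (bump R)).1 Φ.1 x := by
    have hi : ∀ i, Integrable (fun y => (pd (unitVec i) (bump R)).1 y • Φ.1 (x - y)) := fun i =>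
      integrable_smul_sub (integrable_of_compact (hasCompactSupport_pd hb _)) hΦ.memLinfty.1 x
    have e4 : ∀ i, J (unitVec i) * sconv (pd (unitVec i) (bump R)).1 Φ.1 x =
        ∫ y, J (unitVec i) * ((pd (unitVec i) (bump R)).1 y • Φ.1 (x - y)) := fun i =>
      ((ContinuousLinearMap.mul ℝ (V →L[ℂ] V) (J (unitVec i))).integral_comp_comm (hi i)).symm
    simp only [e4]
    refine Eq.trans ?_ (integral_finsetSum Finset.univ fun i _ =>
      (ContinuousLinearMap.mul ℝ (V →L[ℂ] V) (J (unitVec i))).integrable_comp (hi i))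
    rw [lconv]
    refine integral_congr_ae (Eventually.of_forall fun y => ?_)
    simp [hFapp, Finset.sum_mul]
  rw [e3, Submodule.coe_sum, Finset.sum_apply, Finset.smul_sum]
  refine Finset.sum_congr rfl fun i _ => ?_
  have h2 := congrArg (fun g : Smooth (V →L[ℂ] V) => pd (unitVec i) g) h1
  simp only [pd_smoothConv, map_smul] at h2
  have h3 := congrFun (congrArg Subtype.val h2) x
  have h4 : sconv (pd (unitVec i) (bump R)).1 Φ.1 x = c • (pd (unitVec i) Φ).1 x := h3
  rw [h4, postComp_apply, mul_smul_comm, smul_smul, inv_mul_cancel₀ hne, one_smul]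
  rfl

theorem memLp_top_of_smooth_bound {Φ : Smooth (V →L[ℂ] V)} {A : ℝ} (h : ∀ x, ‖Φ.1 x‖ ≤ A) :
    MemLp Φ.1 ⊤ :=
  memLp_top_of_bound (continuous_smooth Φ).aestronglyMeasurable A (Eventually.of_forall h)

theorem norm_sconv_le {f : E3 → ℂ} {Φ : E3 → (V →L[ℂ] V)} (hf : Integrable f) {A : ℝ}
    (hA : ∀ x, ‖Φ x‖ ≤ A) (x : E3) : ‖sconv f Φ x‖ ≤ (∫ y, ‖f y‖) * A := by
  rw [← integral_mul_const]
  refine norm_integral_le_of_norm_le (hf.norm.mul_const A) (Eventually.of_forall fun y => ?_)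
  rw [norm_smul]
  exact mul_le_mul_of_nonneg_left (hA _) (norm_nonneg _)

/-- Convolution commutes with differentiation of the second factor. -/
theorem pd_smoothConv_right {f : Smooth ℂ} {Φ : Smooth (V →L[ℂ] V)} (hc : HasCompactSupport f.1)
    {A B : ℝ} (hA : ∀ x, ‖Φ.1 x‖ ≤ A) {v : E3} (hB : ∀ x, ‖(pd v Φ).1 x‖ ≤ B) :
    pd v (smoothConv f hc (memLp_top_of_smooth_bound hA)) =
      smoothConv f hc (memLp_top_of_smooth_bound hB) := by
  ext1; funext x
  have hf := integrable_of_compact hc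
  have h1 := smooth_hasDerivAt_line (smoothConv f hc (memLp_top_of_smooth_bound hA)) x v 0
  rw [zero_smul, add_zero] at h1
  refine h1.unique ?_
  have h2 := hasDerivAt_integral_of_dominated_loc_of_deriv_le (μ := (volume : Measure E3))
    (F := fun (t : ℝ) y => f.1 y • Φ.1 (x + t • v - y))
    (F' := fun (t : ℝ) y => f.1 y • (pd v Φ).1 (x + t • v - y)) (x₀ := 0)
    (bound := fun y => ‖f.1 y‖ * B) (s := Set.univ) Filter.univ_mem
    (Eventually.of_forall fun t =>
      ((continuous_smooth f).smul ((continuous_smooth Φ).comp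
        (continuous_const.sub continuous_id))).aestronglyMeasurable)
    (integrable_smul_sub hf (memLp_top_of_smooth_bound hA) _)
    ((continuous_smooth f).smul ((continuous_smooth (pd v Φ)).comp
        (continuous_const.sub continuous_id))).aestronglyMeasurable
    (Eventually.of_forall fun y t _ => by
      rw [norm_smul]
      exact mul_le_mul_of_nonneg_left (hB _) (norm_nonneg _))
    (hf.norm.mul_const B)
    (Eventually.of_forall fun y t _ => by
      have := (smooth_hasDerivAt_line Φ (x - y) v t).fun_const_smul (f.1 y)
      simpa only [add_sub_right_comm] using this)
  have h3 := h2.2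
  simp only [zero_smul, add_zero] at h3
  exact h3

/-- From `c ∂Φ = (∂f) * Φ` one differentiation costs the constant factor `|c|⁻¹ ‖∂f‖₁`. The
derivative satisfies the same equation `f * ∂Φ = c ∂Φ`, so the step repeats; the induction therefore
varies both `Φ` and its bound. -/
theorem bernstein {f : Smooth ℂ} (hc : HasCompactSupport f.1) {c : ℂ} (hne : c ≠ 0) (v : E3)
    (n : ℕ) : ∀ {A : ℝ} {Φ : Smooth (V →L[ℂ] V)} (hA : ∀ x, ‖Φ.1 x‖ ≤ A),
      smoothConv f hc (memLp_top_of_smooth_bound hA) = c • Φ →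
      ∀ x, ‖((pd v ^ n) Φ).1 x‖ ≤ A * (‖c‖⁻¹ * ∫ y, ‖(pd v f).1 y‖) ^ n := by
  induction n with
  | zero => intro A Φ hA _ x; simpa using hA x
  | succ n ih =>
    intro A Φ hA heq x
    have hv := integrable_of_compact (hasCompactSupport_pd hc v)
    have h1 := congrArg (pd v) heq
    rw [map_smul] at h1
    have hB : ∀ x, ‖(pd v Φ).1 x‖ ≤ A * (‖c‖⁻¹ * ∫ y, ‖(pd v f).1 y‖) := by
      intro x
      have h2 := h1
      rw [pd_smoothConv] at h2
      have h3 : sconv (pd v f).1 Φ.1 x = c • (pd v Φ).1 x :=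
        congrFun (congrArg Subtype.val h2) x
      have h4 : (pd v Φ).1 x = c⁻¹ • sconv (pd v f).1 Φ.1 x := by
        rw [h3, smul_smul, inv_mul_cancel₀ hne, one_smul]
      rw [h4, norm_smul, norm_inv]
      calc _ ≤ ‖c‖⁻¹ * ((∫ y, ‖(pd v f).1 y‖) * A) := by
            gcongr
            exact norm_sconv_le hv hA x
        _ = _ := by ring
    rw [pd_smoothConv_right hc hA hB] at h1
    have h5 := ih hB h1 x
    rw [pow_succ, Module.End.mul_apply, pow_succ']
    rw [← mul_assoc]
    exact h5

theorem IsWeightRep.exists_bernstein (h : IsWeightRep τ J m) {Φ : Smooth (V →L[ℂ] V)}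
    (hΦ : IsSpherical τ Φ.1) (v : E3) :
    ∃ A C : ℝ, ∀ n x, ‖((pd v ^ n) Φ).1 x‖ ≤ A * C ^ n := by
  obtain ⟨R, hR, hne⟩ := h.exists_transform_ne_zero hΦ
  obtain ⟨A, -, hA⟩ := exists_bound_of_continuous (continuous_smooth Φ) hΦ.memLinfty.1
  exact ⟨A, _, fun n x => bernstein (hasCompactSupport_bump hR) hne v n hA
    (h.smoothConv_eq (hasCompactSupport_bump hR) (bump_rot R) hΦ) x⟩

end SphericalEigen

/-! ### The possible eigenvalues -/

section RadialEquation

theorem eq_exp_of_hasDerivAt {w : ℝ → ℂ} {c : ℂ} (hw : ∀ r, HasDerivAt w (c * w r) r)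
    (h0 : w 0 = 1) (r : ℝ) : w r = Complex.exp (c * r) := by
  have hexp : ∀ r : ℝ, HasDerivAt (fun r : ℝ => Complex.exp (-(c * r)))
      (Complex.exp (-(c * r)) * -(c * 1)) r := fun r =>
    (((hasDerivAt_id r).ofReal_comp.const_mul c).neg).cexp
  have hd : ∀ r : ℝ, HasDerivAt (fun r : ℝ => w r * Complex.exp (-(c * r))) 0 r := by
    intro r
    refine ((hw r).mul (hexp r)).congr_deriv ?_
    ring
  have h1 := is_const_of_deriv_eq_zero (fun r => (hd r).differentiableAt)
    (fun r => (hd r).deriv) r 0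
  simp only [h0, Complex.ofReal_zero, mul_zero, neg_zero, Complex.exp_zero, mul_one] at h1
  calc w r = w r * Complex.exp (-(c * r)) * Complex.exp (c * r) := by
        rw [mul_assoc, ← Complex.exp_add]
        simp
    _ = _ := by rw [h1, one_mul]

/-- The equation `u'' = c² u` factors: `u' + c u` and `u' - c u` satisfy first-order equations with
value `1` at the origin. -/
theorem two_mul_eq_exp_sub {u u' : ℝ → ℂ} {c : ℂ} (hu : ∀ r, HasDerivAt u (u' r) r)
    (hu' : ∀ r, HasDerivAt u' (c ^ 2 * u r) r) (h0 : u 0 = 0) (h0' : u' 0 = 1) (r : ℝ) :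
    2 * c * u r = Complex.exp (c * r) - Complex.exp (-c * r) := by
  have h1 := eq_exp_of_hasDerivAt (w := fun r => u' r + c * u r) (c := c)
    (fun r => ((hu' r).add ((hu r).const_mul c)).congr_deriv (by ring)) (by simp [h0, h0']) r
  have h2 := eq_exp_of_hasDerivAt (w := fun r => u' r + -c * u r) (c := -c)
    (fun r => ((hu' r).add ((hu r).const_mul (-c))).congr_deriv (by ring)) (by simp [h0, h0']) r
  rw [← h1, ← h2]
  ring

theorem re_eq_zero_of_linear_growth {c : ℂ} {B : ℝ}
    (h : ∀ r : ℝ, 0 < r → ‖Complex.exp (c * r) - Complex.exp (-c * r)‖ ≤ B * r) : c.re = 0 := by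
  have hB : ∀ a : ℝ, (∀ r : ℝ, 0 < r → Real.exp (a * r) - Real.exp (-a * r) ≤ B * r) → a ≤ 0 := by
    intro a ha
    by_contra hpos
    push Not at hpos
    have hB0 : 0 ≤ B := by
      have := ha 1 one_pos
      have h2 : Real.exp (-a * 1) ≤ Real.exp (a * 1) := Real.exp_le_exp.2 (by linarith)
      linarith
    -- Chosen so that the quadratic term `(a r)²/2` of the exponential equals `B r + r/2`, which
    -- exceeds the linear bound.
    set r := (2 * B + 1) / a ^ 2 with hr
    have hrpos : 0 < r := by positivity
    have h1 := ha r hrpos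
    have h2 := Real.quadratic_le_exp_of_nonneg (mul_pos hpos hrpos).le
    have h3 : Real.exp (-a * r) ≤ 1 := Real.exp_le_one_iff.2 (by nlinarith [mul_pos hpos hrpos])
    have h4 : a ^ 2 * r = 2 * B + 1 := by
      rw [hr]
      field_simp
    have h5 : (a * r) ^ 2 / 2 = (2 * B + 1) * r / 2 := by rw [← h4]; ring
    have h6 := mul_pos hpos hrpos
    nlinarith
  have hn : ∀ d : ℂ, ∀ r : ℝ, ‖Complex.exp (d * r)‖ = Real.exp (d.re * r) := by
    intro d r
    rw [Complex.norm_exp]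
    simp
  refine le_antisymm (hB _ fun r hr => ?_) ?_
  · have := (norm_sub_norm_le _ _).trans (h r hr)
    rwa [hn, hn, Complex.neg_re] at this
  · have := hB (-c.re) fun r hr => by
      have h1 := h r hr
      rw [norm_sub_rev] at h1
      have := (norm_sub_norm_le _ _).trans h1
      rw [hn, hn, Complex.neg_re] at this
      simpa using this
    linarith

variable {ψ : Smooth ℂ}

/-- A rotation-invariant function has zero derivative along the orbits; the vector field used is the
rotation in the plane of coordinates `0` and `a`. -/
theorem radial_rotation (hψ : ∀ k x, ψ.1 (rot k x) = ψ.1 x) {a : Fin 3} (ha : a ≠ 0) (x : E3) :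
    (x a : ℂ) * (pd (unitVec 0) ψ).1 x = (x 0 : ℂ) * (pd (unitVec a) ψ).1 x := by
  have key : ∀ Y : so3, fderiv ℝ ψ.1 x
      (WithLp.toLp 2 ((Y : Matrix (Fin 3) (Fin 3) ℝ) *ᵥ x.ofLp)) = 0 := by
    intro Y
    have h1 := hasDerivAt_rot_expSO3 Y x
    have h0 : rot (expSO3 ((0 : ℝ) • Y)) x = x := by rw [expSO3_zero_smul, rot_one]
    have h2 : HasFDerivAt ψ.1 (fderiv ℝ ψ.1 x) (rot (expSO3 ((0 : ℝ) • Y)) x) := by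
      rw [h0]
      exact (differentiable_smooth ψ x).hasFDerivAt
    have h3 := h2.comp_hasDerivAt 0 h1
    have h4 : (ψ.1 ∘ fun t : ℝ => rot (expSO3 (t • Y)) x) = fun _ => ψ.1 x := by
      funext t
      exact hψ _ _
    rw [h4] at h3
    exact h3.unique (hasDerivAt_const _ _)
  have hvec : ∀ b : Fin 3, b ≠ 0 → ∃ Y : so3,
      WithLp.toLp 2 ((Y : Matrix (Fin 3) (Fin 3) ℝ) *ᵥ x.ofLp) =
        x b • unitVec 0 - x 0 • unitVec b := by
    intro b hb
    fin_cases b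
    · exact absurd rfl hb
    · refine ⟨Yv (unitVec 2), ?_⟩
      rw [Yv_coe]
      ext i
      fin_cases i <;> simp [unitVec, Matrix.mulVec, dotProduct, Fin.sum_univ_three]
    · refine ⟨Yv (-unitVec 1), ?_⟩
      rw [Yv_coe]
      ext i
      fin_cases i <;> simp [unitVec, Matrix.mulVec, dotProduct, Fin.sum_univ_three]
  obtain ⟨Y, hY⟩ := hvec a ha
  have h := key Y
  rw [hY, map_sub, map_smul, map_smul, sub_eq_zero] at h
  simpa [pd_apply] using h

/-- Differentiating `t ∂₀ψ = r ∂ₐψ` at `t = 0` along the line `r e₀ + t eₐ` gives the tangential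
second derivative without dividing by `r`. -/
theorem radial_second_deriv (hψ : ∀ k x, ψ.1 (rot k x) = ψ.1 x) {a : Fin 3} (ha : a ≠ 0) (r : ℝ) :
    (pd (unitVec 0) ψ).1 (r • unitVec 0) =
      r * (pd (unitVec a) (pd (unitVec a) ψ)).1 (r • unitVec 0) := by
  have h1 : ∀ t : ℝ, (t : ℂ) * (pd (unitVec 0) ψ).1 (r • unitVec 0 + t • unitVec a) =
      r * (pd (unitVec a) ψ).1 (r • unitVec 0 + t • unitVec a) := by
    intro t
    have := radial_rotation hψ ha (r • unitVec 0 + t • unitVec a)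
    have e1 : (r • unitVec 0 + t • unitVec a) a = t := by simp [unitVec, ha]
    have e2 : (r • unitVec 0 + t • unitVec a) 0 = r := by simp [unitVec, ha]
    rwa [e1, e2] at this
  have d1 := (hasDerivAt_id (0 : ℝ)).ofReal_comp.mul
    (smooth_hasDerivAt_line (pd (unitVec 0) ψ) (r • unitVec 0) (unitVec a) 0)
  have d2 := (smooth_hasDerivAt_line (pd (unitVec a) ψ) (r • unitVec 0) (unitVec a) 0).const_mul
    (r : ℂ)
  have d3 := d2.unique (d1.congr_of_eventuallyEq (Eventually.of_forall fun t => (h1 t).symm))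
  simpa using d3.symm

/-- In three dimensions `r Δψ = r ψ'' + 2 ψ' = (r ψ)''`. The differentiated function is `(r ψ)'`. -/
theorem radial_ode (hψ : ∀ k x, ψ.1 (rot k x) = ψ.1 x) {ev : ℂ}
    (hL : ∀ x, Laplacian.laplacian ψ.1 x = ev * ψ.1 x) (r : ℝ) :
    HasDerivAt (fun r : ℝ => ψ.1 (r • unitVec 0) + r * (pd (unitVec 0) ψ).1 (r • unitVec 0))
      (ev * (r * ψ.1 (r • unitVec 0))) r := by
  have hline : ∀ f : Smooth ℂ, HasDerivAt (fun r : ℝ => f.1 (r • unitVec 0))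
      ((pd (unitVec 0) f).1 (r • unitVec 0)) r := by
    intro f
    simpa using smooth_hasDerivAt_line f 0 (unitVec 0) r
  have h1 := (hline ψ).add ((hasDerivAt_id r).ofReal_comp.mul (hline (pd (unitVec 0) ψ)))
  refine h1.congr_deriv ?_
  have h2 := hL (r • unitVec 0)
  rw [laplacian_eq, Fin.sum_univ_three] at h2
  change (pd (unitVec 0) (pd (unitVec 0) ψ)).1 _ + (pd (unitVec 1) (pd (unitVec 1) ψ)).1 _ +
    (pd (unitVec 2) (pd (unitVec 2) ψ)).1 _ = _ at h2
  have e1 := radial_second_deriv hψ (a := 1) (by decide) r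
  have e2 := radial_second_deriv hψ (a := 2) (by decide) r
  simp only [Complex.ofReal_one, one_mul, id]
  linear_combination (r : ℂ) * h2 + e1 + e2

theorem radial_hasDerivAt (r : ℝ) : HasDerivAt (fun r : ℝ => (r : ℂ) * ψ.1 (r • unitVec 0))
    (ψ.1 (r • unitVec 0) + r * (pd (unitVec 0) ψ).1 (r • unitVec 0)) r := by
  have h1 := smooth_hasDerivAt_line ψ 0 (unitVec 0) r
  simp only [zero_add] at h1
  refine ((hasDerivAt_id r).ofReal_comp.mul h1).congr_deriv ?_
  simp

/-- A bounded radial eigenfunction of the Laplacian has non-positive real eigenvalue, and is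
constant if the eigenvalue vanishes. -/
theorem radial_eigenvalue (hψ : ∀ k x, ψ.1 (rot k x) = ψ.1 x) {ev : ℂ} (h1 : ψ.1 0 = 1)
    (hL : ∀ x, Laplacian.laplacian ψ.1 x = ev * ψ.1 x) {A : ℝ} (hA : ∀ x, ‖ψ.1 x‖ ≤ A) :
    (∃ s : ℝ, 0 < s ∧ ev = -(s : ℂ) ^ 2) ∨ (ev = 0 ∧ ∀ x, ψ.1 x = 1) := by
  obtain ⟨c, hc⟩ := IsAlgClosed.exists_pow_nat_eq ev (n := 2) two_pos
  have hode : ∀ r, _ := radial_ode hψ hL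
  rw [← hc] at hode
  by_cases hc0 : c = 0
  · right
    have hev : ev = 0 := by rw [← hc, hc0]; simp
    refine ⟨hev, fun x => ?_⟩
    have hd : ∀ r : ℝ, ψ.1 (r • unitVec 0) + r * (pd (unitVec 0) ψ).1 (r • unitVec 0) = 1 := by
      intro r
      have hz : ∀ r : ℝ, HasDerivAt (fun r : ℝ => ψ.1 (r • unitVec 0) +
          r * (pd (unitVec 0) ψ).1 (r • unitVec 0)) 0 r := by
        intro r
        have := hode r
        rwa [hc0, zero_pow two_ne_zero, zero_mul] at this
      have := is_const_of_deriv_eq_zero (fun r => (hz r).differentiableAt)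
        (fun r => (hz r).deriv) r 0
      simpa [h1] using this
    have hu : ∀ r : ℝ, HasDerivAt (fun r : ℝ => (r : ℂ) * ψ.1 (r • unitVec 0) - (r : ℂ)) 0 r := by
      intro r
      refine ((radial_hasDerivAt r).sub (hasDerivAt_id r).ofReal_comp).congr_deriv ?_
      rw [hd]
      simp
    have hur : ∀ r : ℝ, (r : ℂ) * ψ.1 (r • unitVec 0) = r := by
      intro r
      have := is_const_of_deriv_eq_zero (fun r => (hu r).differentiableAt)
        (fun r => (hu r).deriv) r 0
      simp only [Complex.ofReal_zero, zero_mul, sub_zero] at this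
      exact sub_eq_zero.1 this
    by_cases hx : x = 0
    · rw [hx, h1]
    · obtain ⟨k, hk⟩ := exists_rot_eq (‖x‖ • unitVec 0) x (by simp [norm_smul])
      rw [← hk, hψ]
      have hne : (‖x‖ : ℂ) ≠ 0 := by simpa using hx
      have := hur ‖x‖
      exact mul_left_cancel₀ hne (by rw [this, mul_one])
  · left
    have hexp := two_mul_eq_exp_sub (u := fun r : ℝ => (r : ℂ) * ψ.1 (r • unitVec 0))
      (c := c) radial_hasDerivAt hode (by simp) (by simp [h1])
    have hre := re_eq_zero_of_linear_growth (c := c) (B := ‖2 * c‖ * A) fun r hr => by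
      rw [← hexp r, norm_mul (2 * c), norm_mul (r : ℂ), Complex.norm_real, Real.norm_of_nonneg hr.le]
      have := mul_le_mul_of_nonneg_left (hA (r • unitVec 0)) (mul_nonneg (norm_nonneg (2 * c)) hr.le)
      calc _ = ‖2 * c‖ * r * ‖ψ.1 (r • unitVec 0)‖ := by ring
        _ ≤ _ := this
        _ = _ := by ring
    have hcim : c = (c.im : ℂ) * Complex.I := by
      apply Complex.ext <;> simp [hre]
    have him : c.im ≠ 0 := by
      intro h
      rw [h] at hcim
      exact hc0 (by simpa using hcim)
    refine ⟨|c.im|, abs_pos.2 him, ?_⟩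
    rw [← hc, hcim, mul_pow, Complex.I_sq, ← Complex.ofReal_pow, ← Complex.ofReal_pow, sq_abs]
    simp

end RadialEquation

/-! ### Classification of smooth spherical functions -/

section Classification

variable {V : Type*} [NormedAddCommGroup V] [InnerProductSpace ℂ V] [FiniteDimensional ℂ V]
variable {τ : SO3 →* (V →L[ℂ] V)} {J : E3 →ₗ[ℝ] (V →L[ℂ] V)} {m : ℕ}

/-- The normalized trace of a smooth operator-valued function. -/
def normTrace (Φ : Smooth (V →L[ℂ] V)) : Smooth ℂ :=
  (Module.finrank ℂ V : ℂ)⁻¹ • postComp (tr V) Φ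

theorem normTrace_apply (Φ : Smooth (V →L[ℂ] V)) (x : E3) :
    (normTrace Φ).1 x = (Module.finrank ℂ V : ℂ)⁻¹ * tr V (Φ.1 x) := rfl

theorem laplacian_normTrace {Φ : Smooth (V →L[ℂ] V)} {ev : ℂ}
    (hL : ∀ x, Laplacian.laplacian Φ.1 x = ev • Φ.1 x) (x : E3) :
    Laplacian.laplacian (normTrace Φ).1 x = ev * (normTrace Φ).1 x := by
  have h1 := hL x
  rw [laplacian_eq, Submodule.coe_sum, Finset.sum_apply] at h1 ⊢
  have h2 : ∀ i, (pd (unitVec i) (pd (unitVec i) (normTrace Φ))).1 x =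
      (Module.finrank ℂ V : ℂ)⁻¹ * tr V ((pd (unitVec i) (pd (unitVec i) Φ)).1 x) := by
    intro i
    rw [normTrace, map_smul, map_smul, pd_postComp, pd_postComp]
    rfl
  simp only [h2]
  rw [← Finset.mul_sum, ← map_sum, h1, map_smul, normTrace_apply, smul_eq_mul]
  ring

theorem pd_bump {R : ℝ} (hR : 0 < R) (v x : E3) :
    (pd v (bump R)).1 (R • x) = (R : ℂ)⁻¹ * (pd v (bump 1)).1 x := by
  have h1 := smooth_hasDerivAt_line (bump R) (R • x) v 0
  have h2 := smooth_hasDerivAt_line (bump 1) x (R⁻¹ • v) 0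
  have h3 : (fun t : ℝ => (bump R).1 (R • x + t • v)) =
      fun t : ℝ => (bump 1).1 (x + t • R⁻¹ • v) := by
    funext t
    rw [bump_apply, bump_apply, ← bumpReal_smul hR, smul_add, smul_comm R t, smul_inv_smul₀ hR.ne']
  rw [h3] at h1
  have h4 := h1.unique h2
  rw [zero_smul, zero_smul, add_zero, add_zero, pd_smul] at h4
  rw [h4, ← Complex.ofReal_inv]
  rfl

theorem integral_comp_smul_E3 {R : ℝ} (hR : 0 < R) (f : E3 → ℝ) :
    ∫ x, f x = R ^ 3 * ∫ x, f (R • x) := by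
  rw [Measure.integral_comp_smul, finrank_euclideanSpace_fin, abs_of_pos (by positivity),
    smul_eq_mul, mul_inv_cancel_left₀ (by positivity)]

/-- Liouville's argument. With normalized trace `1`, the transform of the bump of radius `R` is its
integral, of order `R³`, while the gradient of the bump has `L¹` norm of order `R²`. The Bernstein
bound for one derivative is thus of order `R⁻¹` and `Φ` is constant; by equivariance at the origin
and Schur it is scalar, and its trace fixes the scalar. -/
theorem IsWeightRep.eq_one_of_harmonic (h : IsWeightRep τ J m) {Φ : Smooth (V →L[ℂ] V)}
    (hΦ : IsSpherical τ Φ.1) (hψ : ∀ x, (normTrace Φ).1 x = 1) (x : E3) : Φ.1 x = 1 := by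
  obtain ⟨A, -, hA⟩ := exists_bound_of_continuous (continuous_smooth Φ) hΦ.memLinfty.1
  have hpd : ∀ v x, (pd v Φ).1 x = 0 := by
    intro v x
    set I1 := ∫ y, bumpReal 1 y with hI1
    set D1 := ∫ y, ‖(pd v (bump 1)).1 y‖ with hD1
    have hI1pos : 0 < I1 := integral_bumpReal_pos one_pos
    have key : ∀ R : ℝ, 0 < R → ‖(pd v Φ).1 x‖ ≤ A * (D1 / I1) * R⁻¹ := by
      intro R hR
      have hc : scalarTransform (bump R).1 Φ.1 = ((R ^ 3 * I1 : ℝ) : ℂ) := by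
        rw [scalarTransform_eq, ← integral_const_mul]
        have : ∀ y, (Module.finrank ℂ V : ℂ)⁻¹ * ((bump R).1 y * tr V (Φ.1 (-y))) =
            (bumpReal R y : ℂ) := by
          intro y
          have := hψ (-y)
          rw [normTrace_apply] at this
          rw [mul_left_comm, this, mul_one, bump_apply]
        simp only [this]
        rw [integral_complex_ofReal, integral_comp_smul_E3 hR]
        simp only [bumpReal_smul hR]
        rw [hI1]
      have hne : scalarTransform (bump R).1 Φ.1 ≠ 0 := by
        rw [hc, Complex.ofReal_ne_zero]
        positivity
      have h1 := bernstein (hasCompactSupport_bump hR) hne v 1 hA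
        (h.smoothConv_eq (hasCompactSupport_bump hR) (bump_rot R) hΦ) x
      rw [pow_one, pow_one, hc, integral_comp_smul_E3 hR] at h1
      simp only [pd_bump hR, norm_mul] at h1
      rw [integral_const_mul, Complex.norm_real, Real.norm_of_nonneg (by positivity), norm_inv,
        Complex.norm_real, Real.norm_of_nonneg hR.le, ← hD1] at h1
      refine h1.trans (le_of_eq ?_)
      field_simp
    have hlim : Tendsto (fun R : ℝ => A * (D1 / I1) * R⁻¹) atTop (𝓝 (A * (D1 / I1) * 0)) :=
      tendsto_inv_atTop_zero.const_mul _
    rw [mul_zero] at hlim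
    have := ge_of_tendsto hlim ((eventually_gt_atTop 0).mono key)
    exact norm_le_zero_iff.1 this
  have hconst : Φ.1 x = Φ.1 0 := is_const_of_fderiv_eq_zero (𝕜 := ℝ) (differentiable_smooth Φ)
    (fun y => ContinuousLinearMap.ext fun v => hpd v y) x 0
  obtain ⟨c, hc⟩ := h.schur (Φ.1 0) fun k => by
    have h1 := hΦ.equivariant k 0
    rw [rot_zero] at h1
    conv_rhs => rw [h1, mul_assoc, tau_inv_mul, mul_one]
  have h2 := h.tr_zero hΦ
  rw [hc, map_smul, tr_one, smul_eq_mul] at h2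
  have hd : (Module.finrank ℂ V : ℂ) ≠ 0 := by
    rw [h.finrank_eq]
    exact Nat.cast_ne_zero.2 (by omega)
  have hc1 : c = 1 := by
    apply mul_right_cancel₀ hd
    rw [h2, one_mul]
  rw [hconst, hc, hc1, one_smul]

/-- A smooth spherical function is the constant `1` or has eigenvalues `-s²` and `s j`. -/
theorem IsWeightRep.classification (h : IsWeightRep τ J m) {Φ : Smooth (V →L[ℂ] V)}
    (hΦ : IsSpherical τ Φ.1) : (∀ x, Φ.1 x = 1) ∨
      ∃ s : ℝ, 0 < s ∧ ∃ j ∈ Finset.Icc (-(m : ℤ)) m, IsSphericalEigen τ s j Φ := by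
  obtain ⟨ev, hev⟩ := h.exists_laplacian hΦ
  obtain ⟨μ, hμ⟩ := h.exists_Dop hΦ
  obtain ⟨A, -, hA⟩ := exists_bound_of_continuous (continuous_smooth Φ) hΦ.memLinfty.1
  have hd : (Module.finrank ℂ V : ℂ) ≠ 0 := by
    rw [h.finrank_eq]
    exact Nat.cast_ne_zero.2 (by omega)
  have htr := h.tr_zero hΦ
  rcases radial_eigenvalue (ψ := normTrace Φ) (ev := ev)
    (A := ‖(Module.finrank ℂ V : ℂ)⁻¹‖ * (‖tr V‖ * A))
    (fun k x => by rw [normTrace_apply, normTrace_apply, hΦ.equivariant, tr_conj])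
    (by rw [normTrace_apply, htr, inv_mul_cancel₀ hd]) (laplacian_normTrace hev)
    (fun x => by
      rw [normTrace_apply, norm_mul]
      gcongr
      exact (ContinuousLinearMap.le_opNorm _ _).trans (by gcongr; exact hA x)) with
    ⟨s, hs, hs'⟩ | ⟨-, hψ⟩
  · right
    rw [hs'] at hev
    obtain ⟨j, hj, hj'⟩ := exists_int_of_weightProd m
      (h.weightProd_eigenvalue hμ hev (by rw [htr]; exact hd))
    exact ⟨s, hs, j, hj, hΦ, hev, by rw [hμ, hj']⟩
  · exact Or.inl (h.eq_one_of_harmonic hΦ hψ)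

/-- A spherical function is determined by its eigenvalues. -/
theorem IsWeightRep.eq_of_isSphericalEigen (h : IsWeightRep τ J m) {s : ℝ} (hs : 0 < s) {j : ℤ}
    {Φ₁ Φ₂ : Smooth (V →L[ℂ] V)} (h₁ : IsSphericalEigen τ s j Φ₁)
    (h₂ : IsSphericalEigen τ s j Φ₂) : Φ₁ = Φ₂ :=
  h.eq_of_eigen h₁.spherical.equivariant h₂.spherical.equivariant h₁.Dop_eq h₂.Dop_eq
    h₁.laplacian_eq h₂.laplacian_eq
    (neg_ne_zero.2 (pow_ne_zero 2 (Complex.ofReal_ne_zero.2 hs.ne')))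
    ((h.tr_zero h₁.spherical).trans (h.tr_zero h₂.spherical).symm)
    (h.exists_bernstein h₁.spherical) (h.exists_bernstein h₂.spherical)

end Classification

/-! ### Superpositions of plane waves -/

section SphereMeasure

/-- The rotation-invariant probability measure on the unit sphere. -/
def sphereMeasure : Measure E3 :=
  Measure.map (fun x : E3 => ‖x‖⁻¹ • x)
    ((volume (Metric.ball (0 : E3) 1))⁻¹ • volume.restrict (Metric.ball (0 : E3) 1))

theorem measurable_normalize : Measurable (fun x : E3 => ‖x‖⁻¹ • x) := by fun_prop

instance : IsProbabilityMeasure sphereMeasure := by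
  have h0 : volume (Metric.ball (0 : E3) 1) ≠ 0 := (Metric.measure_ball_pos _ _ one_pos).ne'
  have : IsProbabilityMeasure ((volume (Metric.ball (0 : E3) 1))⁻¹ •
      (volume.restrict (Metric.ball (0 : E3) 1) : Measure E3)) := by
    constructor
    rw [Measure.smul_apply, Measure.restrict_apply_univ, smul_eq_mul,
      ENNReal.inv_mul_cancel h0 measure_ball_lt_top.ne]
  exact Measure.isProbabilityMeasure_map measurable_normalize.aemeasurable

theorem ae_norm_eq_one : ∀ᵐ w ∂sphereMeasure, ‖w‖ = 1 := by
  rw [sphereMeasure, ae_map_iff measurable_normalize.aemeasurable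
    (measurableSet_eq_fun measurable_norm measurable_const)]
  refine Measure.ae_smul_measure (ae_restrict_of_ae ?_) _
  have : ∀ᵐ x : E3, x ≠ 0 := by simp [ae_iff]
  filter_upwards [this] with x hx
  rw [norm_smul, norm_inv, norm_norm, inv_mul_cancel₀ (norm_ne_zero_iff.2 hx)]

theorem measurePreserving_rot_sphere (k : SO3) :
    MeasurePreserving (rot k) sphereMeasure sphereMeasure := by
  refine ⟨(continuous_rot k).measurable, ?_⟩
  have h1 : Measure.map (rot k) (volume.restrict (Metric.ball (0 : E3) 1)) =
      volume.restrict (Metric.ball (0 : E3) 1) := by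
    have h := (measurePreserving_rot k).restrict_preimage
      (Metric.isOpen_ball (x := (0 : E3)) (ε := 1)).measurableSet
    have h2 : rot k ⁻¹' Metric.ball (0 : E3) 1 = Metric.ball (0 : E3) 1 := by
      ext x
      simp [norm_rot]
    rw [h2] at h
    exact h.map_eq
  rw [sphereMeasure, Measure.map_map (continuous_rot k).measurable measurable_normalize]
  have h2 : rot k ∘ (fun x : E3 => ‖x‖⁻¹ • x) = (fun x : E3 => ‖x‖⁻¹ • x) ∘ rot k := by
    funext x
    simp [rot_smul, norm_rot]
  rw [h2, ← Measure.map_map measurable_normalize (continuous_rot k).measurable, Measure.map_smul, h1]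

theorem integral_rot_sphere {W : Type*} [NormedAddCommGroup W] [NormedSpace ℝ W] (k : SO3)
    (f : E3 → W) : ∫ w, f (rot k w) ∂sphereMeasure = ∫ w, f w ∂sphereMeasure :=
  (measurePreserving_rot_sphere k).integral_comp (measurableEmbedding_rot k) f

theorem exists_bound_sphere {W : Type*} [NormedAddCommGroup W] {f : E3 → W} (hf : Continuous f) :
    ∃ C, ∀ᵐ w ∂sphereMeasure, ‖f w‖ ≤ C := by
  obtain ⟨C, hC⟩ := (isCompact_closedBall (0 : E3) 1).exists_bound_of_continuousOn hf.continuousOn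
  refine ⟨C, ?_⟩
  filter_upwards [ae_norm_eq_one] with w hw
  exact hC w (by simp [hw])

theorem integrable_sphere {W : Type*} [NormedAddCommGroup W] {f : E3 → W} (hf : Continuous f) :
    Integrable f sphereMeasure := by
  obtain ⟨C, hC⟩ := exists_bound_sphere hf
  exact (integrable_const C).mono' hf.aestronglyMeasurable hC

end SphereMeasure

/-! ### Plane-wave superpositions and their symbols -/

section PlaneWave

open scoped FourierTransform
open Real (fourierChar)

variable {W : Type*} [NormedAddCommGroup W] [NormedSpace ℂ W]

/-- The bilinear form `-c ⟪w, x⟫`. -/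
def waveForm (c : ℝ) : E3 →L[ℝ] E3 →L[ℝ] ℝ := (-c) • innerSL ℝ

theorem waveForm_apply (c : ℝ) (w x : E3) : waveForm c w x = -(c * ⟪w, x⟫_ℝ) := by
  change (-c) * ⟪w, x⟫_ℝ = _
  ring

theorem continuous_waveForm_smul (c : ℝ) {A : E3 → W} (hA : Continuous A) (x : E3) :
    Continuous (fun w => fourierChar (-(waveForm c w x)) • A w) := by
  simp only [waveForm_apply]
  have : Continuous (fun w : E3 => fourierChar (-(-(c * ⟪w, x⟫_ℝ)))) :=
    Real.continuous_fourierChar.comp (by fun_prop)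
  exact this.smul hA

/-- The superposition `∫ e^{2πic⟨w, x⟩} A(w) dσ(w)` over the unit sphere. -/
def planeWave (c : ℝ) : C(E3, W) →ₗ[ℂ] Smooth W where
  toFun A := ⟨VectorFourier.fourierIntegral fourierChar sphereMeasure (waveForm c).toLinearMap₁₂ A,
    VectorFourier.contDiff_fourierIntegral (waveForm c) fun n _ =>
      integrable_sphere ((continuous_norm.pow n).mul A.continuous.norm)⟩
  map_add' A B := by
    ext1; funext x
    change ∫ w, fourierChar (-(waveForm c w x)) • (A w + B w) ∂sphereMeasure =
      ∫ w, fourierChar (-(waveForm c w x)) • A w ∂sphereMeasure +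
      ∫ w, fourierChar (-(waveForm c w x)) • B w ∂sphereMeasure
    simp only [smul_add]
    exact integral_add (integrable_sphere (continuous_waveForm_smul c A.continuous x))
      (integrable_sphere (continuous_waveForm_smul c B.continuous x))
  map_smul' a A := by
    ext1; funext x
    change ∫ w, fourierChar (-(waveForm c w x)) • (a • A w) ∂sphereMeasure =
      a • ∫ w, fourierChar (-(waveForm c w x)) • A w ∂sphereMeasure
    rw [← integral_smul]
    refine integral_congr_ae (Eventually.of_forall fun w => ?_)
    exact smul_comm _ _ _

theorem planeWave_apply (c : ℝ) (A : C(E3, W)) (x : E3) :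
    (planeWave c A).1 x = ∫ w, fourierChar (-(waveForm c w x)) • A w ∂sphereMeasure := rfl

theorem planeWave_congr (c : ℝ) {A B : C(E3, W)} (h : ∀ w, ‖w‖ = 1 → A w = B w) :
    planeWave c A = planeWave c B := by
  ext1; funext x
  rw [planeWave_apply, planeWave_apply]
  refine integral_congr_ae ?_
  filter_upwards [ae_norm_eq_one] with w hw
  rw [h w hw]

theorem planeWave_zero_apply [CompleteSpace W] (c : ℝ) (A : C(E3, W)) :
    (planeWave c A).1 0 = ∫ w, A w ∂sphereMeasure := by
  simp [planeWave_apply]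

theorem planeWave_bound (c : ℝ) (A : C(E3, W)) : ∃ C, ∀ x, ‖(planeWave c A).1 x‖ ≤ C := by
  refine ⟨∫ w, ‖A w‖ ∂sphereMeasure, fun x => ?_⟩
  rw [planeWave_apply]
  refine (norm_integral_le_integral_norm _).trans (le_of_eq ?_)
  simp only [Circle.norm_smul]

theorem planeWave_postComp {W' : Type*} [NormedAddCommGroup W'] [NormedSpace ℂ W']
    [CompleteSpace W] [CompleteSpace W'] (c : ℝ) (T : W →L[ℂ] W') (A : C(E3, W)) :
    postComp T (planeWave c A) = planeWave c ((T : C(W, W')).comp A) := by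
  ext1; funext x
  rw [postComp_apply, planeWave_apply, planeWave_apply, ← ContinuousLinearMap.integral_comp_comm _
    (integrable_sphere (continuous_waveForm_smul c A.continuous x))]
  refine integral_congr_ae (Eventually.of_forall fun w => ?_)
  simp [Circle.smul_def]

/-- The symbol `2πic⟨w, v⟩` of the derivative along `v`. -/
def waveSymbol (c : ℝ) (v : E3) : C(E3, ℂ) :=
  ⟨fun w => 2 * Real.pi * Complex.I * c * (⟪w, v⟫_ℝ : ℂ), by fun_prop⟩

theorem waveSymbol_apply (c : ℝ) (v w : E3) :
    waveSymbol c v w = 2 * Real.pi * Complex.I * c * (⟪w, v⟫_ℝ : ℂ) := rfl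

theorem pd_planeWave [CompleteSpace W] (c : ℝ) (v : E3) (A : C(E3, W)) :
    pd v (planeWave c A) = planeWave c (waveSymbol c v • A) := by
  ext1; funext x
  have h := VectorFourier.hasFDerivAt_fourierIntegral (waveForm c) (f := A) (μ := sphereMeasure)
    (integrable_sphere A.continuous) (integrable_sphere (continuous_norm.mul A.continuous.norm)) x
  have hc : Continuous (fun w => fourierChar (-(waveForm c w x)) •
      VectorFourier.fourierSMulRight (waveForm c) A w) := by
    refine continuous_waveForm_smul (W := E3 →L[ℝ] W) c ?_ x
    have : Continuous fun p : (E3 →L[ℝ] ℝ) × W => p.1.smulRight p.2 :=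
      (ContinuousLinearMap.smulRightL ℝ E3 W).continuous₂
    change Continuous fun w => (-(2 * Real.pi * Complex.I)) • (waveForm c w).smulRight (A w)
    have h2 := this.comp ((waveForm c).continuous.prodMk A.continuous)
    exact h2.const_smul (-(2 * Real.pi * Complex.I))
  rw [pd_apply, planeWave_apply]
  refine (congrArg (fun L => L v) h.fderiv).trans ?_
  refine (ContinuousLinearMap.integral_apply (integrable_sphere hc) v).trans ?_
  refine integral_congr_ae (Eventually.of_forall fun w => ?_)
  change fourierChar (-(waveForm c w x)) • (-(2 * Real.pi * Complex.I) • waveForm c w v • A w) =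
    fourierChar (-(waveForm c w x)) • (waveSymbol c v w • A w)
  rw [waveSymbol_apply, ← Complex.coe_smul, smul_smul, waveForm_apply c w v]
  congr 2
  push_cast
  ring

end PlaneWave

/-! ### Existence of spherical functions -/

section Existence

open scoped FourierTransform
open Real (fourierChar)

variable {V : Type*} [NormedAddCommGroup V] [InnerProductSpace ℂ V] [FiniteDimensional ℂ V]
variable {τ : SO3 →* (V →L[ℂ] V)} {J : E3 →ₗ[ℝ] (V →L[ℂ] V)} {m : ℕ}

/-- The pointwise product. -/
def mulMap (A B : C(E3, V →L[ℂ] V)) : C(E3, V →L[ℂ] V) :=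
  ⟨fun w => A w * B w, A.continuous.mul B.continuous⟩

theorem mulMap_apply (A B : C(E3, V →L[ℂ] V)) (w : E3) : mulMap A B w = A w * B w := rfl

theorem continuous_aeval {B : E3 → (V →L[ℂ] V)} (hB : Continuous B) (p : Polynomial ℂ) :
    Continuous fun w => Polynomial.aeval (B w) p := by
  induction p using Polynomial.induction_on' with
  | add p q hp hq => simp only [map_add]; exact hp.add hq
  | monomial n a =>
    simp only [Polynomial.aeval_monomial]
    exact continuous_const.mul (hB.pow n)

/-- The pointwise value of a polynomial. -/
def aevalMap (B : C(E3, V →L[ℂ] V)) (p : Polynomial ℂ) : C(E3, V →L[ℂ] V) :=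
  ⟨fun w => Polynomial.aeval (B w) p, continuous_aeval B.continuous p⟩

theorem aevalMap_apply (B : C(E3, V →L[ℂ] V)) (p : Polynomial ℂ) (w : E3) :
    aevalMap B p w = Polynomial.aeval (B w) p := rfl

/-- The symbol `2πic J(w)` of `D_τ`. -/
def waveOp (J : E3 →ₗ[ℝ] (V →L[ℂ] V)) (c : ℝ) : C(E3, V →L[ℂ] V) :=
  ⟨fun w => (2 * Real.pi * Complex.I * c : ℂ) • J w, J.continuous_of_finiteDimensional.fun_const_smul _⟩

theorem waveOp_apply (c : ℝ) (w : E3) : waveOp J c w = (2 * Real.pi * Complex.I * c : ℂ) • J w := rfl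

theorem inner_unitVec (w : E3) (i : Fin 3) : ⟪w, unitVec i⟫_ℝ = w i := by
  rw [unitVec, EuclideanSpace.inner_single_right]
  simp

theorem IsWeightRep.Dop_planeWave (h : IsWeightRep τ J m) (c : ℝ) (A : C(E3, V →L[ℂ] V)) :
    Dop τ (planeWave c A) = planeWave c (mulMap (waveOp J c) A) := by
  rw [h.Dop_eq]
  simp only [pd_planeWave, planeWave_postComp]
  rw [← map_sum]
  congr 1
  ext1 w
  rw [ContinuousMap.sum_apply, mulMap_apply, waveOp_apply]
  have hw : J w = ∑ i, w i • J (unitVec i) := by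
    conv_lhs => rw [← sum_smul_unitVec w]
    simp only [map_sum, map_smul]
  rw [hw, Finset.smul_sum, Finset.sum_mul]
  refine Finset.sum_congr rfl fun i _ => ?_
  change J (unitVec i) * (waveSymbol c (unitVec i) w • A w) = _
  rw [waveSymbol_apply, inner_unitVec, ← Complex.coe_smul, smul_smul, mul_smul_comm,
    smul_mul_assoc]

theorem IsWeightRep.aeval_Dop_planeWave (h : IsWeightRep τ J m) (c : ℝ) (p : Polynomial ℂ)
    (A : C(E3, V →L[ℂ] V)) : Polynomial.aeval (Dop τ) p (planeWave c A) =
      planeWave c (mulMap (aevalMap (waveOp J c) p) A) := by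
  induction p using Polynomial.induction_on' with
  | add p q hp hq =>
    rw [map_add, LinearMap.add_apply, hp, hq, ← map_add]
    congr 1
    ext1 w
    rw [ContinuousMap.add_apply]
    simp only [mulMap_apply, aevalMap_apply, map_add, add_mul]
  | monomial n a =>
    have key : ∀ n : ℕ, (Dop τ ^ n) (planeWave c A) =
        planeWave c ⟨fun w => waveOp J c w ^ n * A w,
          ((waveOp J c).continuous.pow n).mul A.continuous⟩ := by
      intro n
      induction n with
      | zero => simp; rfl
      | succ n ih =>
        rw [pow_succ', Module.End.mul_apply, ih, h.Dop_planeWave]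
        congr 1
        ext1 w
        rw [mulMap_apply]
        change waveOp J c w * (waveOp J c w ^ n * A w) = waveOp J c w ^ (n + 1) * A w
        rw [pow_succ', mul_assoc]
    rw [Polynomial.aeval_monomial, Algebra.algebraMap_eq_smul_one, smul_mul_assoc, one_mul,
      LinearMap.smul_apply, key, ← map_smul]
    congr 1
    ext1 w
    rw [mulMap_apply, aevalMap_apply, Polynomial.aeval_monomial, Algebra.algebraMap_eq_smul_one,
      smul_mul_assoc, smul_mul_assoc, one_mul]
    rfl

/-- The symbol of the Laplacian is `-(2πc)² ‖w‖²`, which is constant only on the unit sphere, where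
the measure lives; hence the comparison through `planeWave_congr`. -/
theorem laplacian_planeWave {W : Type*} [NormedAddCommGroup W] [NormedSpace ℂ W] [CompleteSpace W]
    (c : ℝ) (A : C(E3, W)) (x : E3) :
    Laplacian.laplacian (planeWave c A).1 x =
      (-((2 * Real.pi * c : ℝ) : ℂ) ^ 2) • (planeWave c A).1 x := by
  rw [laplacian_eq]
  simp only [pd_planeWave]
  rw [← map_sum]
  have : planeWave c (∑ i, waveSymbol c (unitVec i) • waveSymbol c (unitVec i) • A) =
      planeWave c ((-((2 * Real.pi * c : ℝ) : ℂ) ^ 2) • A) := by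
    refine planeWave_congr c fun w hw => ?_
    rw [ContinuousMap.sum_apply]
    change ∑ i, waveSymbol c (unitVec i) w • waveSymbol c (unitVec i) w • A w =
      (-((2 * Real.pi * c : ℝ) : ℂ) ^ 2) • A w
    simp only [smul_smul, ← Finset.sum_smul, waveSymbol_apply, inner_unitVec]
    congr 1
    have h1 : ∑ i, w i ^ 2 = 1 := by
      have := EuclideanSpace.norm_sq_eq w
      rw [hw] at this
      simpa using this.symm
    have h2 : ∑ i, ((w i : ℝ) : ℂ) ^ 2 = 1 := by exact_mod_cast h1
    rw [Fin.sum_univ_three] at h2 ⊢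
    push_cast
    linear_combination (-4 * (Real.pi : ℂ) ^ 2 * c ^ 2) * h2 + (4 * (Real.pi : ℂ) ^ 2 * c ^ 2 *
      ((w 0 : ℂ) ^ 2 + (w 1 : ℂ) ^ 2 + (w 2 : ℂ) ^ 2)) * Complex.I_sq
  rw [this, map_smul]
  rfl

/-- The classical spherical function of frequency `s`. -/
def classicalSpherical (s : ℝ) : Smooth ℂ := planeWave (s / (2 * Real.pi)) 1

theorem smulI_classicalSpherical (s : ℝ) :
    smulI V (classicalSpherical s) = planeWave (s / (2 * Real.pi)) (ContinuousMap.const E3 1) := by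
  have h := planeWave_postComp (s / (2 * Real.pi))
    (ContinuousLinearMap.toSpanSingleton ℂ (1 : V →L[ℂ] V)) 1
  refine (Subtype.ext (funext fun x => ?_)).trans (h.trans ?_)
  · exact (ContinuousLinearMap.toSpanSingleton_apply _ _ _).symm
  · congr 1
    ext1 w
    exact (ContinuousLinearMap.toSpanSingleton_apply _ _ _).trans (one_smul ℂ (1 : V →L[ℂ] V))

/-- The Lagrange polynomial of the nodes `s l`, `-m ≤ l ≤ m`, attached to `s j`. -/
def lagPoly (m : ℕ) (s : ℝ) (j : ℤ) : Polynomial ℂ :=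
  ∏ l ∈ (Finset.Icc (-(m : ℤ)) m).erase j,
      Polynomial.C (((s : ℂ) * j - (s : ℂ) * l)⁻¹) *
        (Polynomial.X - Polynomial.C ((s : ℂ) * l))

theorem eval_lagPoly_self {s : ℝ} (hs : s ≠ 0) (j : ℤ) : (lagPoly m s j).eval ((s : ℂ) * j) = 1 := by
  rw [lagPoly, Polynomial.eval_prod]
  refine Finset.prod_eq_one fun l hl => ?_
  have h1 : (s : ℂ) * j - s * l ≠ 0 := by
    rw [← mul_sub]
    refine mul_ne_zero (Complex.ofReal_ne_zero.2 hs) (sub_ne_zero.2 ?_)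
    exact_mod_cast (Finset.ne_of_mem_erase hl).symm
  simp [inv_mul_cancel₀ h1]

theorem eval_lagPoly_ne {s : ℝ} {j l : ℤ} (hl : l ∈ Finset.Icc (-(m : ℤ)) m) (hne : l ≠ j) :
    (lagPoly m s j).eval ((s : ℂ) * l) = 0 := by
  rw [lagPoly, Polynomial.eval_prod]
  exact Finset.prod_eq_zero (Finset.mem_erase.2 ⟨hne, hl⟩) (by simp)

/-- The spectral projection of the symbol of `D_τ` on its eigenvalue `s j`. -/
def waveProj (J : E3 →ₗ[ℝ] (V →L[ℂ] V)) (m : ℕ) (s : ℝ) (j : ℤ) : C(E3, V →L[ℂ] V) :=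
  aevalMap (waveOp J (s / (2 * Real.pi))) (lagPoly m s j)

theorem waveProj_apply (s : ℝ) (j : ℤ) (w : E3) : waveProj J m s j w =
    Polynomial.aeval (waveOp J (s / (2 * Real.pi)) w) (lagPoly m s j) :=
  rfl

/-- A polynomial in `D_τ` acts on a superposition through its value at the symbol `i s J(w)`; the
frequency `s / 2π` absorbs the `2π` of the Fourier character. The Lagrange polynomial yields the
spectral projection. -/
theorem IsWeightRep.Dlagrange_eq (h : IsWeightRep τ J m) (s : ℝ) (j : ℤ) :
    Dlagrange τ m s j (smulI V (classicalSpherical s)) =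
      planeWave (s / (2 * Real.pi)) (waveProj J m s j) := by
  rw [smulI_classicalSpherical]
  refine (h.aeval_Dop_planeWave _ _ _).trans ?_
  exact congrArg _ (ContinuousMap.ext fun w => mul_one _)

theorem IsWeightRep.waveOp_rot (h : IsWeightRep τ J m) (c : ℝ) (k : SO3) (w : E3) :
    waveOp J c (rot k w) = conjHom τ k (waveOp J c w) := by
  rw [waveOp_apply, h.J_rot, waveOp_apply, map_smul, conjHom_apply]

theorem IsWeightRep.waveProj_rot (h : IsWeightRep τ J m) (s : ℝ) (j : ℤ) (k : SO3) (w : E3) :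
    waveProj J m s j (rot k w) = conjHom τ k (waveProj J m s j w) := by
  rw [waveProj_apply, h.waveOp_rot, waveProj_apply, Polynomial.aeval_algHom_apply]

variable {b : Module.Basis (Finset.Icc (-(m : ℤ)) m) ℂ V}

theorem waveOp_weight
    (hb : ∀ l, J (unitVec 2) (b l) = (-(Complex.I * ((l : ℤ) : ℂ))) • b l) (s : ℝ)
    (l : Finset.Icc (-(m : ℤ)) m) :
    waveOp J (s / (2 * Real.pi)) (unitVec 2) (b l) = ((s : ℂ) * (l : ℤ)) • b l := by
  rw [waveOp_apply, smul_apply, hb, smul_smul]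
  congr 1
  have : (Real.pi : ℂ) ≠ 0 := Complex.ofReal_ne_zero.2 Real.pi_ne_zero
  push_cast
  field_simp
  linear_combination (-(s : ℂ) * (l : ℤ)) * Complex.I_sq

theorem waveProj_weight
    (hb : ∀ l, J (unitVec 2) (b l) = (-(Complex.I * ((l : ℤ) : ℂ))) • b l) {s : ℝ} (hs : s ≠ 0)
    (j l : Finset.Icc (-(m : ℤ)) m) :
    waveProj J m s j (unitVec 2) (b l) = if l = j then b l else 0 := by
  rw [waveProj_apply, IsWeightRep.aeval_weight (waveOp_weight hb s l)]
  split_ifs with hl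
  · rw [hl, eval_lagPoly_self hs, one_smul]
  · rw [eval_lagPoly_ne l.2 (fun h => hl (Subtype.ext h)), zero_smul]

/-- By equivariance it is enough to look at `e₃`, where both operators are diagonal in the weight
basis. -/
theorem IsWeightRep.waveOp_mul_waveProj (h : IsWeightRep τ J m) {s : ℝ} (hs : s ≠ 0) {j : ℤ}
    (hj : j ∈ Finset.Icc (-(m : ℤ)) m) {w : E3} (hw : ‖w‖ = 1) :
    waveOp J (s / (2 * Real.pi)) w * waveProj J m s j w = ((s : ℂ) * j) • waveProj J m s j w := by
  obtain ⟨k, hk⟩ := exists_rot_unitVec_two w hw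
  obtain ⟨b, hb⟩ := h.exists_basis
  rw [← hk, h.waveOp_rot, h.waveProj_rot, ← map_mul, ← map_smul]
  congr 1
  refine ContinuousLinearMap.coe_injective (b.ext fun l => ?_)
  change waveOp J _ _ (waveProj J m s j _ (b l)) = ((s : ℂ) * j) • (waveProj J m s j _ (b l))
  rw [waveProj_weight hb hs ⟨j, hj⟩]
  split_ifs with hl
  · rw [waveOp_weight hb, hl]
  · simp

theorem trace_mul_waveProj
    (hb : ∀ l, J (unitVec 2) (b l) = (-(Complex.I * ((l : ℤ) : ℂ))) • b l) {s : ℝ} (hs : s ≠ 0)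
    (j : Finset.Icc (-(m : ℤ)) m) {A : V →L[ℂ] V} {a : Finset.Icc (-(m : ℤ)) m → ℂ}
    (hA : ∀ l, A (b l) = a l • b l) : tr V (A * waveProj J m s j (unitVec 2)) = a j := by
  rw [tr_eq_sum_basis b, Finset.sum_eq_single j]
  · rw [mul_app, waveProj_weight hb hs, if_pos rfl, hA]
    simp
  · intro l _ hl
    rw [mul_app, waveProj_weight hb hs, if_neg hl]
    simp
  · simp

/-- The integrand is invariant under rotations, hence constant on the unit sphere, which is a single
orbit of total mass `1`. -/
theorem IsWeightRep.integral_trace (h : IsWeightRep τ J m) (s : ℝ) (j : ℤ)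
    {B : E3 → (V →L[ℂ] V)} (hB : ∀ k w, B (rot k w) = conjHom τ k (B w)) :
    ∫ w, tr V (B w * waveProj J m s j w) ∂sphereMeasure =
      tr V (B (unitVec 2) * waveProj J m s j (unitVec 2)) := by
  have : ∀ᵐ w ∂sphereMeasure, tr V (B w * waveProj J m s j w) =
      tr V (B (unitVec 2) * waveProj J m s j (unitVec 2)) := by
    filter_upwards [ae_norm_eq_one] with w hw
    obtain ⟨k, hk⟩ := exists_rot_unitVec_two w hw
    rw [← hk, hB, h.waveProj_rot, ← map_mul, conjHom_apply, tr_conj]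
  rw [integral_congr_ae this]
  simp

/-- Fubini: the reflection in `Φ(-x)` turns the wave into the Fourier kernel at frequency `c w`. -/
theorem sphericalTransform_planeWave {F : E3 → (V →L[ℂ] V)} (hF : Integrable F) (c : ℝ)
    (A : C(E3, V →L[ℂ] V)) : sphericalTransform F (planeWave c A).1 =
      (Module.finrank ℂ V : ℂ)⁻¹ * ∫ w, tr V (𝓕 F (c • w) * A w) ∂sphereMeasure := by
  have hchar : ∀ w x : E3, fourierChar (-(waveForm c w (-x))) = fourierChar (-⟪x, c • w⟫_ℝ) := by
    intro w x
    rw [waveForm_apply, inner_neg_right, inner_smul_right, real_inner_comm]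
    ring_nf
  have hcont : Continuous fun p : E3 × E3 => fourierChar (-⟪p.1, c • p.2⟫_ℝ) :=
    Real.continuous_fourierChar.comp (by fun_prop)
  obtain ⟨C, hC⟩ := exists_bound_sphere A.continuous
  have hint : Integrable (fun p : E3 × E3 =>
      tr V (F p.1 * (fourierChar (-⟪p.1, c • p.2⟫_ℝ) • A p.2))) (volume.prod sphereMeasure) := by
    apply (tr V).integrable_comp
    have h1 : Integrable (fun p : E3 × E3 => ‖F p.1‖ * C) (volume.prod sphereMeasure) :=
      (hF.norm.comp_fst _).mul_const C
    refine h1.mono' ((hF.comp_fst _).1.mul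
      (hcont.smul (A.continuous.comp continuous_snd)).aestronglyMeasurable) ?_
    filter_upwards [Measure.quasiMeasurePreserving_snd.ae hC] with p hp
    refine (norm_mul_le _ _).trans ?_
    have h2 : ‖fourierChar (-⟪p.1, c • p.2⟫_ℝ) • A p.2‖ = ‖A p.2‖ := by
      rw [Circle.smul_def, norm_smul, Circle.norm_coe, one_mul]
    rw [h2]
    gcongr
  rw [sphericalTransform]
  congr 1
  calc ∫ x : E3, tr V (F x * (planeWave c A).1 (-x))
      = ∫ x : E3, (∫ w, tr V (F x * (fourierChar (-⟪x, c • w⟫_ℝ) • A w)) ∂sphereMeasure) := by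
        refine integral_congr_ae (Eventually.of_forall fun x => ?_)
        have hi := integrable_sphere (continuous_waveForm_smul c A.continuous (-x))
        simp only [hchar] at hi
        change tr V (F x * (planeWave c A).1 (-x)) = _
        rw [planeWave_apply]
        simp only [hchar]
        rw [← ContinuousLinearMap.mul_apply' ℂ (V →L[ℂ] V),
          ← ContinuousLinearMap.integral_comp_comm _ hi,
          ← ContinuousLinearMap.integral_comp_comm _ (ContinuousLinearMap.integrable_comp _ hi)]
        rfl
    _ = ∫ w, (∫ x : E3, tr V (F x * (fourierChar (-⟪x, c • w⟫_ℝ) • A w))) ∂sphereMeasure :=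
        integral_integral_swap hint
    _ = _ := by
        refine integral_congr_ae (Eventually.of_forall fun w => ?_)
        have hi : Integrable (fun x => fourierChar (-⟪x, c • w⟫_ℝ) • F x) :=
          (Real.fourierIntegral_convergent_iff (c • w)).2 hF
        change _ = tr V ((∫ x, fourierChar (-⟪x, c • w⟫_ℝ) • F x) * A w)
        rw [← ContinuousLinearMap.mul_apply' ℂ (V →L[ℂ] V), ← ContinuousLinearMap.flip_apply,
          ← ContinuousLinearMap.integral_comp_comm _ hi,
          ← ContinuousLinearMap.integral_comp_comm _ (ContinuousLinearMap.integrable_comp _ hi)]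
        refine integral_congr_ae (Eventually.of_forall fun x => ?_)
        simp [Circle.smul_def]

theorem fourier_conv {F G : E3 → (V →L[ℂ] V)} (hF : Integrable F) (hG : Integrable G) (ξ : E3) :
    𝓕 (conv F G) ξ = 𝓕 F ξ * 𝓕 G ξ :=
  Real.fourier_bilin_convolution_eq (ContinuousLinearMap.mul ℂ (V →L[ℂ] V)).flip hG hF ξ

theorem integrable_conv {F G : E3 → (V →L[ℂ] V)} (hF : Integrable F) (hG : Integrable G) :
    Integrable (conv F G) :=
  hG.integrable_convolution (ContinuousLinearMap.mul ℂ (V →L[ℂ] V)).flip hF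

theorem fourier_rot {F : E3 → (V →L[ℂ] V)} (hF : MemL1 τ F) (k : SO3) (ξ : E3) :
    𝓕 F (rot k ξ) = conjHom τ k (𝓕 F ξ) := by
  have hi : Integrable (fun x => fourierChar (-⟪x, ξ⟫_ℝ) • F x) :=
    (Real.fourierIntegral_convergent_iff ξ).2 hF.1
  calc 𝓕 F (rot k ξ) = ∫ x, fourierChar (-⟪x, rot k ξ⟫_ℝ) • F x := rfl
    _ = ∫ x, fourierChar (-⟪rot k x, rot k ξ⟫_ℝ) • F (rot k x) :=
      (integral_rot k (fun x => fourierChar (-⟪x, rot k ξ⟫_ℝ) • F x)).symm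
    _ = ∫ x, conjHom τ k (fourierChar (-⟪x, ξ⟫_ℝ) • F x) := by
      refine integral_congr_ae ?_
      filter_upwards [hF.2 k] with x hx
      rw [inner_rot, hx, Circle.smul_def, Circle.smul_def, map_smul, conjHom_apply]
    _ = _ := ContinuousLinearMap.integral_comp_comm
          (LinearMap.toContinuousLinearMap (conjHom τ k).toLinearMap) hi

theorem planeWave_rot {c : ℝ} {A : C(E3, V →L[ℂ] V)}
    (hA : ∀ k w, A (rot k w) = conjHom τ k (A w)) (k : SO3) (x : E3) :
    (planeWave c A).1 (rot k x) = conjHom τ k ((planeWave c A).1 x) := by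
  have hi := integrable_sphere (continuous_waveForm_smul c A.continuous x)
  calc (planeWave c A).1 (rot k x)
      = ∫ w, fourierChar (-(waveForm c w (rot k x))) • A w ∂sphereMeasure := rfl
    _ = ∫ w, fourierChar (-(waveForm c (rot k w) (rot k x))) • A (rot k w) ∂sphereMeasure :=
      (integral_rot_sphere k (fun w => fourierChar (-(waveForm c w (rot k x))) • A w)).symm
    _ = ∫ w, conjHom τ k (fourierChar (-(waveForm c w x)) • A w) ∂sphereMeasure := by
      refine integral_congr_ae (Eventually.of_forall fun w => ?_)
      simp only [waveForm_apply, inner_rot, hA, Circle.smul_def, map_smul]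
    _ = _ := ContinuousLinearMap.integral_comp_comm
          (LinearMap.toContinuousLinearMap (conjHom τ k).toLinearMap) hi

/-- Existence of a spherical function with eigenvalues `-s²` and `s j`. -/
theorem IsWeightRep.isSphericalEigen (h : IsWeightRep τ J m) {s : ℝ} (hs : s ≠ 0) {j : ℤ}
    (hj : j ∈ Finset.Icc (-(m : ℤ)) m) : IsSphericalEigen τ s j
      ((2 * (m : ℂ) + 1) • Dlagrange τ m s j (smulI V (classicalSpherical s))) := by
  have hd : (Module.finrank ℂ V : ℂ) = 2 * (m : ℂ) + 1 := by
    rw [h.finrank_eq]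
    push_cast
    ring
  have hd0 : (Module.finrank ℂ V : ℂ) ≠ 0 := by
    rw [h.finrank_eq]
    exact Nat.cast_ne_zero.2 (by omega)
  obtain ⟨b, hb⟩ := h.exists_basis
  rw [h.Dlagrange_eq, ← hd]
  set c := s / (2 * Real.pi) with hc
  set Q := waveProj J m s j with hQ
  have hsc : ((2 * Real.pi * c : ℝ) : ℂ) = s := by
    rw [hc]
    congr 1
    have := Real.pi_ne_zero
    field_simp
  rw [← map_smul]
  have hrot := planeWave_rot (c := c) (A := (Module.finrank ℂ V : ℂ) • Q) (τ := τ) fun k w => by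
    rw [ContinuousMap.smul_apply, h.waveProj_rot, ContinuousMap.smul_apply, map_smul]
  have htrans : ∀ F : E3 → (V →L[ℂ] V), Integrable F →
      sphericalTransform F (planeWave c ((Module.finrank ℂ V : ℂ) • Q)).1 =
        ∫ w, tr V (𝓕 F (c • w) * Q w) ∂sphereMeasure := by
    intro F hF
    rw [sphericalTransform_planeWave hF]
    simp only [ContinuousMap.smul_apply, mul_smul_comm, map_smul]
    rw [integral_smul, smul_eq_mul, inv_mul_cancel_left₀ hd0]
  -- The Fourier transform of `F` is equivariant, so its value on the axis of `e₃` commutes with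
  -- `J(e₃)`, whose spectrum is simple. This commutativity is what makes the transform
  -- multiplicative.
  have hdiag : ∀ F, MemL1 τ F → ∃ a : Finset.Icc (-(m : ℤ)) m → ℂ,
      ∀ l, 𝓕 F (c • unitVec 2) (b l) = a l • b l := by
    intro F hF
    refine exists_diag hb (h.commute_J fun k hk => ?_)
    rw [← conjHom_apply, ← fourier_rot hF, rot_smul, hk]
  have hB : ∀ F, MemL1 τ F → ∀ k w, 𝓕 F (c • rot k w) = conjHom τ k (𝓕 F (c • w)) := by
    intro F hF k w
    rw [← rot_smul, fourier_rot hF]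
  refine ⟨⟨⟨?_, fun k => Eventually.of_forall fun x => hrot k x⟩, ?_, ?_⟩, ?_, ?_⟩
  · obtain ⟨C, hC⟩ := planeWave_bound c ((Module.finrank ℂ V : ℂ) • Q)
    exact memLp_top_of_smooth_bound hC
  -- A function vanishing almost everywhere would vanish at the origin by continuity, but the trace
  -- there is `dim V`.
  · intro h0
    have h1 := (continuous_smooth _).ae_eq_iff_eq volume continuous_zero |>.1 h0
    have h2 := congrArg (tr V) (congrFun h1 0)
    rw [planeWave_zero_apply, ← ContinuousLinearMap.integral_comp_comm _
      (integrable_sphere (ContinuousMap.continuous _))] at h2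
    simp only [ContinuousMap.smul_apply, map_smul] at h2
    have h3 := h.integral_trace s j (B := fun _ => 1) (fun k w => (map_one _).symm)
    rw [trace_mul_waveProj hb hs ⟨j, hj⟩ (a := fun _ => 1) (fun l => by simp)] at h3
    simp only [one_mul] at h3
    rw [integral_smul, h3] at h2
    simp [hd0] at h2
  -- The transform of `F` is the diagonal entry `a₁ j`; convolution multiplies the diagonal
  -- matrices.
  · intro F G hF hG
    obtain ⟨a₁, h₁⟩ := hdiag F hF
    obtain ⟨a₂, h₂⟩ := hdiag G hG
    rw [htrans _ (integrable_conv hF.1 hG.1), htrans F hF.1, htrans G hG.1,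
      h.integral_trace s j (B := fun w => 𝓕 F (c • w)) (hB F hF),
      h.integral_trace s j (B := fun w => 𝓕 G (c • w)) (hB G hG),
      trace_mul_waveProj hb hs ⟨j, hj⟩ h₁, trace_mul_waveProj hb hs ⟨j, hj⟩ h₂]
    simp only [fourier_conv hF.1 hG.1]
    rw [h.integral_trace s j (B := fun w => 𝓕 F (c • w) * 𝓕 G (c • w))
      (fun k w => by rw [hB F hF, hB G hG, map_mul])]
    refine trace_mul_waveProj hb hs ⟨j, hj⟩ (a := fun l => a₁ l * a₂ l) fun l => ?_
    rw [mul_app, h₂, map_smul, h₁, smul_smul, mul_comm]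
  · intro x
    rw [laplacian_planeWave, hsc]
  · rw [h.Dop_planeWave, ← map_smul]
    refine planeWave_congr c fun w hw => ?_
    rw [mulMap_apply, ContinuousMap.smul_apply, ContinuousMap.smul_apply,
      ContinuousMap.smul_apply, mul_smul_comm, h.waveOp_mul_waveProj hs hj hw, smul_comm]

end Existence

/-! ### The Fischer inner product is rotation invariant -/

section Fischer

local notation "R3" => MvPolynomial (Fin 3) ℂ

theorem fischer_add_left (p q r : R3) : fischer (p + q) r = fischer p r + fischer q r := by
  classical
  rw [fischer_eq _ r _ support_add, fischer_eq q r _ (Finset.subset_union_right (s₁ := p.support)),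
    fischer_eq p r _ (Finset.subset_union_left (s₂ := q.support)), ← Finset.sum_add_distrib]
  refine Finset.sum_congr rfl fun d _ => ?_
  simp only [coeff_add, map_add]; ring

theorem fischer_add_right (p q r : R3) : fischer p (q + r) = fischer p q + fischer p r := by
  simp only [fischer, ← Finset.sum_add_distrib, coeff_add, mul_add]

theorem fischer_C_mul_left (c : ℂ) (p q : R3) :
    fischer (C c * p) q = starRingEnd ℂ c * fischer p q := by
  have h : (C c * p).support ⊆ p.support := by
    rw [← smul_eq_C_mul]
    exact support_smul
  rw [fischer_eq _ q _ h, fischer, Finset.mul_sum]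
  refine Finset.sum_congr rfl fun d _ => ?_
  simp only [coeff_C_mul, map_mul]; ring

theorem fischer_C_mul_right (c : ℂ) (p q : R3) : fischer p (C c * q) = c * fischer p q := by
  simp only [fischer, Finset.mul_sum, coeff_C_mul]
  refine Finset.sum_congr rfl fun d _ => ?_
  ring

theorem fischer_sum_left {ι : Type*} (s : Finset ι) (f : ι → R3) (q : R3) :
    fischer (∑ i ∈ s, f i) q = ∑ i ∈ s, fischer (f i) q :=
  map_sum (AddMonoidHom.mk' (fun p => fischer p q) fun a b => fischer_add_left a b q) f s

theorem fischer_sum_right {ι : Type*} (s : Finset ι) (p : R3) (f : ι → R3) :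
    fischer p (∑ i ∈ s, f i) = ∑ i ∈ s, fischer p (f i) :=
  map_sum (AddMonoidHom.mk' (fun q => fischer p q) fun a b => fischer_add_right p a b) f s

theorem fischer_C (c : ℂ) (q : R3) : fischer (C c) q = starRingEnd ℂ c * coeff 0 q := by
  classical
  have h : (C c : R3).support ⊆ {0} := by
    rw [C_apply]
    exact support_monomial_subset
  rw [fischer_eq _ q _ h]
  simp

/-- The factorial weights are made for this: raising the exponent of `Xᵢ` by one multiplies the
weight by `dᵢ + 1`, the factor produced by differentiation. -/
theorem fischer_X_mul (i : Fin 3) (p q : R3) : fischer (X i * p) q = fischer p (pderiv i q) := by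
  rw [fischer, support_X_mul, Finset.sum_map, fischer]
  refine Finset.sum_congr rfl fun d _ => ?_
  rw [addLeftEmbedding_apply, coeff_X_mul, coeff_pderiv, add_comm d]
  have h : (∏ a, (((Finsupp.single i 1 + d : Fin 3 →₀ ℕ) a).factorial : ℂ)) =
      (∏ a, ((d a).factorial : ℂ)) * (d i + 1) := by
    rw [← Finset.mul_prod_erase _ _ (Finset.mem_univ i),
      ← Finset.mul_prod_erase Finset.univ (fun a => ((d a).factorial : ℂ)) (Finset.mem_univ i)]
    have h1 : ∀ a ∈ Finset.univ.erase i,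
        (((Finsupp.single i 1 + d : Fin 3 →₀ ℕ) a).factorial : ℂ) = ((d a).factorial : ℂ) := by
      intro a ha
      rw [Finsupp.add_apply, Finsupp.single_eq_of_ne (Finset.ne_of_mem_erase ha), zero_add]
    rw [Finset.prod_congr rfl h1, Finsupp.add_apply, Finsupp.single_eq_same, add_comm 1,
      Nat.factorial_succ]
    push_cast
    ring
  rw [h]
  ring

theorem coeff_zero_substInv (k : SO3) (q : R3) : coeff 0 (substInv k q) = coeff 0 q := by
  have h := eval_substInv k q 0
  rw [rot_zero] at h
  rw [← constantCoeff_eq]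
  simpa [← MvPolynomial.constantCoeff_eq, MvPolynomial.eval_zero'] using h

/-- Induction on `p`, removing one variable at a time. A rotated variable is a linear form whose
adjoint is a combination of partial derivatives, and orthogonality of `k` matches it with the
rotated derivative. -/
theorem fischer_substInv (k : SO3) (p q : R3) :
    fischer (substInv k p) (substInv k q) = fischer p q := by
  induction p using MvPolynomial.induction_on generalizing q with
  | C a =>
    have : substInv k (C a) = C a := by simp [substInv]
    rw [this, fischer_C, fischer_C, coeff_zero_substInv]
  | add p p' hp hp' => rw [map_add, fischer_add_left, hp, hp', fischer_add_left]
  | mul_X p i hp =>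
    have hX : substInv k (X i) = invCoord k i := by simp [substInv]
    set A : Matrix (Fin 3) (Fin 3) ℝ := ((k⁻¹ : SO3) : Matrix (Fin 3) (Fin 3) ℝ) with hA
    have hent : ∀ l, ∑ j, (A i j : ℂ) * (A l j : ℂ) = if l = i then 1 else 0 := by
      intro l
      have := congrFun (congrFun (SO3_mul_transpose k⁻¹) i) l
      rw [Matrix.mul_apply, Matrix.one_apply] at this
      simp only [Matrix.transpose_apply] at this
      have h2 := congrArg (fun t : ℝ => (t : ℂ)) this
      push_cast at h2
      rw [h2]
      by_cases h : l = i
      · simp [h]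
      · simp [h, Ne.symm h]
    rw [mul_comm, map_mul, hX, invCoord, Finset.sum_mul, fischer_sum_left, fischer_X_mul, ← hp]
    calc _ = ∑ j, ∑ l, (A i j : ℂ) * ((A l j : ℂ) *
          fischer (substInv k p) (substInv k (pderiv l q))) := by
          refine Finset.sum_congr rfl fun j _ => ?_
          rw [mul_assoc, fischer_C_mul_left, fischer_X_mul, pderiv_substInv, fischer_sum_right,
            Finset.mul_sum]
          refine Finset.sum_congr rfl fun l _ => ?_
          rw [fischer_C_mul_right, Complex.conj_ofReal]
      _ = ∑ l, (∑ j, (A i j : ℂ) * (A l j : ℂ)) *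
          fischer (substInv k p) (substInv k (pderiv l q)) := by
          rw [Finset.sum_comm]
          refine Finset.sum_congr rfl fun l _ => ?_
          rw [Finset.sum_mul]
          refine Finset.sum_congr rfl fun j _ => ?_
          rw [mul_assoc]
      _ = _ := by simp [hent]

theorem adjoint_tau (m : ℕ) (k : SO3) : ContinuousLinearMap.adjoint (tau m k) = tau m k⁻¹ := by
  symm
  rw [ContinuousLinearMap.eq_adjoint_iff]
  intro p q
  change fischer (toPoly m (tau m k⁻¹ p)) (toPoly m q) = fischer (toPoly m p) (toPoly m (tau m k q))
  rw [toPoly_tau, toPoly_tau, ← fischer_substInv k, ← AlgHom.comp_apply, ← substInv_mul,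
    mul_inv_cancel, substInv_one]
  rfl

end Fischer

/-! ### The differential of `τ_m` -/

section Differential

local notation "R3" => MvPolynomial (Fin 3) ℂ

/-- The vector field generated by the rotations `exp(t ∑ wᵢ Yᵢ)`. -/
def rotDer (w : E3) : Derivation ℂ R3 R3 :=
  mkDerivation ℂ fun i => ∑ j, C (-((Yv w : Matrix (Fin 3) (Fin 3) ℝ) i j : ℂ)) * X j

theorem rotDer_X (w : E3) (i : Fin 3) :
    rotDer w (X i) = ∑ j, C (-((Yv w : Matrix (Fin 3) (Fin 3) ℝ) i j : ℂ)) * X j :=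
  mkDerivation_X _ _ _

theorem rotDer_add (v w : E3) : rotDer (v + w) = rotDer v + rotDer w := by
  refine derivation_ext fun i => ?_
  rw [Derivation.add_apply, rotDer_X, rotDer_X, rotDer_X, ← Finset.sum_add_distrib]
  refine Finset.sum_congr rfl fun j _ => ?_
  rw [← add_mul, ← C_add]
  congr 2
  simp only [Yv_coe]
  fin_cases i <;> fin_cases j <;> simp <;> ring

theorem rotDer_smul (c : ℝ) (w : E3) : rotDer (c • w) = (c : ℂ) • rotDer w := by
  refine derivation_ext fun i => ?_
  rw [Derivation.smul_apply, rotDer_X, rotDer_X, Finset.smul_sum]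
  refine Finset.sum_congr rfl fun j _ => ?_
  rw [smul_eq_C_mul, ← mul_assoc, ← C_mul]
  congr 2
  simp only [Yv_coe]
  fin_cases i <;> fin_cases j <;> simp

theorem substInv_expSO3_zero (Y : so3) (p : R3) : substInv (expSO3 ((0 : ℝ) • Y)) p = p := by
  rw [expSO3_zero_smul, substInv_one, AlgHom.id_apply]

/-- Substitution is multiplicative and the identity at `t = 0`, so its derivative obeys the Leibniz
rule, as `rotDer` does; both agree on the variables. -/
theorem hasDerivAt_coeff_substInv (w : E3) (p : R3) (d : Fin 3 →₀ ℕ) :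
    HasDerivAt (fun t : ℝ => coeff d (substInv (expSO3 (t • Yv w)) p)) (coeff d (rotDer w p)) 0 := by
  classical
  induction p using MvPolynomial.induction_on generalizing d with
  | C a =>
    have : ∀ k, substInv k (C a) = C a := fun k => by simp [substInv]
    simp only [this, derivation_C, coeff_zero]
    exact hasDerivAt_const _ _
  | add p q hp hq =>
    simp only [map_add, coeff_add]
    exact (hp d).add (hq d)
  | mul_X p i hp =>
    have hX : ∀ d : Fin 3 →₀ ℕ, HasDerivAt
        (fun t : ℝ => coeff d (substInv (expSO3 (t • Yv w)) (X i))) (coeff d (rotDer w (X i))) 0 := by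
      intro d
      have h1 : ∀ k, substInv k (X i) = invCoord k i := fun k => by simp [substInv]
      simp only [h1, invCoord, rotDer_X, coeff_sum, coeff_C_mul, SO3_coe_inv,
        Matrix.transpose_apply]
      refine HasDerivAt.fun_sum fun j _ => ?_
      have h2 := (hasDerivAt_expSO3_apply (Yv w) j i).ofReal_comp.mul_const (coeff d (X j : R3))
      refine h2.congr_deriv ?_
      congr 1
      rw [← Complex.ofReal_neg, Yv_coe]
      fin_cases i <;> fin_cases j <;> simp
    have h3 : HasDerivAt (fun t : ℝ => ∑ x ∈ Finset.HasAntidiagonal.antidiagonal d,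
        coeff x.1 (substInv (expSO3 (t • Yv w)) p) * coeff x.2 (substInv (expSO3 (t • Yv w)) (X i)))
        (∑ x ∈ Finset.HasAntidiagonal.antidiagonal d, (coeff x.1 (rotDer w p) * coeff x.2 (X i : R3) +
          coeff x.1 p * coeff x.2 (rotDer w (X i)))) 0 := by
      refine HasDerivAt.fun_sum fun x _ => ?_
      have h4 := (hp x.1).mul (hX x.2)
      simp only [substInv_expSO3_zero] at h4
      exact h4
    simp only [map_mul, coeff_mul]
    refine h3.congr_deriv ?_
    rw [Derivation.leibniz, smul_eq_mul, smul_eq_mul, coeff_add, mul_comm (X i), coeff_mul,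
      coeff_mul, ← Finset.sum_add_distrib]
    refine Finset.sum_congr rfl fun x _ => add_comm _ _

theorem hasDerivAt_coeff_pderiv {f : ℝ → R3} {g : R3}
    (h : ∀ d, HasDerivAt (fun t => coeff d (f t)) (coeff d g) 0) (i : Fin 3) (d : Fin 3 →₀ ℕ) :
    HasDerivAt (fun t => coeff d (pderiv i (f t))) (coeff d (pderiv i g)) 0 := by
  simp only [coeff_pderiv]
  exact (h _).mul_const _

/-- The rotated polynomials remain in `H_m`, which is cut out by linear conditions on coefficients;
differentiating these conditions at `t = 0` gives the claim. -/
theorem rotDer_mem (m : ℕ) (w : E3) (p : R3) (hp : p ∈ harmonic m) : rotDer w p ∈ harmonic m := by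
  have hmem := fun t : ℝ => substInv_mem m (expSO3 (t • Yv w)) p hp
  have hd := hasDerivAt_coeff_substInv w p
  refine ⟨fun d hne => ?_, ?_⟩
  · by_contra hdeg
    apply hne
    have h0 : ∀ t : ℝ, coeff d (substInv (expSO3 (t • Yv w)) p) = 0 := fun t =>
      ((mem_homogeneousSubmodule m _).1 (hmem t).1).coeff_eq_zero (by
        rwa [Finsupp.degree_eq_weight_one])
    have h1 := hd d
    simp only [h0] at h1
    exact h1.unique (hasDerivAt_const _ _)
  · rw [SetLike.mem_coe, LinearMap.mem_ker]
    ext d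
    have h1 : HasDerivAt (fun t : ℝ => coeff d (polyLaplacian (substInv (expSO3 (t • Yv w)) p)))
        (coeff d (polyLaplacian (rotDer w p))) 0 := by
      simp only [polyLaplacian_apply, coeff_sum]
      exact HasDerivAt.fun_sum fun i _ =>
        hasDerivAt_coeff_pderiv (hasDerivAt_coeff_pderiv hd i) i d
    have h0 : ∀ t : ℝ, polyLaplacian (substInv (expSO3 (t • Yv w)) p) = 0 := fun t => (hmem t).2
    simp only [h0, coeff_zero] at h1
    rw [coeff_zero]
    exact h1.unique (hasDerivAt_const _ _)

/-- The differential of `τ_m`. -/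
def dtau (m : ℕ) : E3 →ₗ[ℝ] (H m →L[ℂ] H m) where
  toFun w := LinearMap.toContinuousLinearMap ((toPoly m).symm.toLinearMap ∘ₗ
    (rotDer w).toLinearMap.restrict (rotDer_mem m w) ∘ₗ (toPoly m).toLinearMap)
  map_add' v w := by
    ext p
    apply (toPoly m).injective
    ext1
    simp [rotDer_add]
  map_smul' c w := by
    ext p
    apply (toPoly m).injective
    ext1
    simp [rotDer_smul]
    rfl

theorem toPoly_dtau (m : ℕ) (w : E3) (p : H m) :
    (toPoly m (dtau m w p) : R3) = rotDer w (toPoly m p) := rfl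

/-- In finite dimension, differentiability may be tested on a separating family of functionals. -/
theorem hasDerivAt_of_separating {E : Type*} [NormedAddCommGroup E] [NormedSpace ℂ E]
    [FiniteDimensional ℂ E] {ι : Type*} (ℓ : ι → Module.Dual ℂ E)
    (hsep : ∀ x, (∀ i, ℓ i x = 0) → x = 0) {c : ℝ → E} {e : E} {t₀ : ℝ}
    (h : ∀ i, HasDerivAt (fun t => ℓ i (c t)) (ℓ i e) t₀) : HasDerivAt c e t₀ := by
  have hspan : Submodule.span ℂ (Set.range ℓ) = ⊤ := by
    rw [← Subspace.dualCoannihilator_dualAnnihilator_eq (W := Submodule.span ℂ (Set.range ℓ))]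
    have : (Submodule.span ℂ (Set.range ℓ)).dualCoannihilator = ⊥ := by
      rw [eq_bot_iff]
      intro x hx
      rw [Submodule.mem_dualCoannihilator] at hx
      exact hsep x fun i => hx _ (Submodule.subset_span ⟨i, rfl⟩)
    rw [this, Submodule.dualAnnihilator_bot]
  have hall : ∀ φ : Module.Dual ℂ E, HasDerivAt (fun t => φ (c t)) (φ e) t₀ := by
    intro φ
    have hφ : φ ∈ Submodule.span ℂ (Set.range ℓ) := hspan ▸ Submodule.mem_top
    induction hφ using Submodule.span_induction with
    | mem x hx =>
      obtain ⟨i, rfl⟩ := hx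
      exact h i
    | zero => exact hasDerivAt_const _ _
    | add x y _ _ hx hy => exact hx.add hy
    | smul a x _ hx => exact hx.const_mul a
  set b := Module.finBasis ℂ E
  have h1 : HasDerivAt (fun t => ∑ i, b.coord i (c t) • b i) (∑ i, b.coord i e • b i) t₀ :=
    HasDerivAt.fun_sum fun i _ => (hall (b.coord i)).smul_const (b i)
  simpa only [Module.Basis.coord_apply, b.sum_repr] using h1

theorem hasDerivAt_tau (m : ℕ) (w : E3) :
    HasDerivAt (fun t : ℝ => tau m (expSO3 (t • Yv w))) (dtau m w) 0 := by
  let ℓ : H m × (Fin 3 →₀ ℕ) → Module.Dual ℂ (H m →L[ℂ] H m) := fun pd =>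
    { toFun := fun A => coeff pd.2 (toPoly m (A pd.1) : R3)
      map_add' := fun A B => by simp
      map_smul' := fun a A => by simp }
  refine hasDerivAt_of_separating ℓ (fun A hA => ?_) fun pd => ?_
  · ext p
    apply (toPoly m).injective
    ext1
    ext d
    exact (hA (p, d)).trans (by simp)
  · change HasDerivAt (fun t : ℝ => coeff pd.2 (toPoly m (tau m (expSO3 (t • Yv w)) pd.1) : R3))
      (coeff pd.2 (toPoly m (dtau m w pd.1) : R3)) 0
    simp only [toPoly_tau, toPoly_dtau]
    exact hasDerivAt_coeff_substInv w _ _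

end Differential

/-! ### The weights of `τ_m` -/

section Ladder

variable {V : Type*} [AddCommGroup V] [Module ℂ V] {a e f : V →ₗ[ℂ] V} {v : V} {m : ℕ}

theorem ladder_weight (haf : ∀ x, a (f x) = f (a x) - Complex.I • f x)
    (hav : a v = (Complex.I * m) • v) (k : ℕ) :
    a ((f ^ k) v) = (Complex.I * (m - k)) • (f ^ k) v := by
  induction k with
  | zero => simpa using hav
  | succ k ih =>
    rw [pow_succ', Module.End.mul_apply, haf, ih, map_smul, ← sub_smul]
    congr 1
    push_cast
    ring

/-- The `sl₂` computation: moving `e` past one `f` at a time adds up the weights of the intermediate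
vectors. The factor is nonzero for `k < 2m`, so the ladder has at least `2m + 1` rungs. -/
theorem ladder_raise (haf : ∀ x, a (f x) = f (a x) - Complex.I • f x)
    (hef : ∀ x, e (f x) = f (e x) - (2 * Complex.I) • a x)
    (hav : a v = (Complex.I * m) • v) (hev : e v = 0) (k : ℕ) :
    e ((f ^ (k + 1)) v) = (((k : ℂ) + 1) * (2 * m - k)) • (f ^ k) v := by
  induction k with
  | zero =>
    rw [zero_add, pow_one, hef, hev, map_zero, hav, smul_smul, zero_sub, ← neg_smul, pow_zero,
      Module.End.one_apply]
    congr 1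
    push_cast
    linear_combination (-2 * (m : ℂ)) * Complex.I_sq
  | succ k ih =>
    rw [pow_succ', Module.End.mul_apply, hef, ih, map_smul, ladder_weight haf hav, smul_smul,
      ← Module.End.mul_apply, ← pow_succ', ← sub_smul]
    congr 1
    push_cast
    linear_combination (-2 * ((m : ℂ) - (k + 1))) * Complex.I_sq

theorem ladder_ne_zero (haf : ∀ x, a (f x) = f (a x) - Complex.I • f x)
    (hef : ∀ x, e (f x) = f (e x) - (2 * Complex.I) • a x)
    (hav : a v = (Complex.I * m) • v) (hev : e v = 0) (hv : v ≠ 0) {k : ℕ} (hk : k ≤ 2 * m) :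
    (f ^ k) v ≠ 0 := by
  induction k with
  | zero => simpa using hv
  | succ k ih =>
    intro h0
    have h := ladder_raise haf hef hav hev k
    rw [h0, map_zero, eq_comm, smul_eq_zero] at h
    refine h.elim (fun h => ?_) (ih (by omega))
    rcases mul_eq_zero.1 h with h | h
    · exact Nat.cast_add_one_ne_zero k h
    · rw [sub_eq_zero] at h
      have : 2 * m = k := by exact_mod_cast h
      omega

/-- The weight basis generated by a highest weight vector. -/
theorem exists_ladder_basis [FiniteDimensional ℂ V] (hdim : Module.finrank ℂ V ≤ 2 * m + 1)
    (haf : ∀ x, a (f x) = f (a x) - Complex.I • f x)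
    (hef : ∀ x, e (f x) = f (e x) - (2 * Complex.I) • a x)
    (hav : a v = (Complex.I * m) • v) (hev : e v = 0) (hv : v ≠ 0) :
    ∃ b : Module.Basis (Finset.Icc (-(m : ℤ)) m) ℂ V,
      (∀ l, a (b l) = (-(Complex.I * ((l : ℤ) : ℂ))) • b l) ∧
      ∀ l, b l = (f ^ ((l : ℤ) + m).toNat) v := by
  have hbound : ∀ l : Finset.Icc (-(m : ℤ)) m, ((l : ℤ) + m).toNat ≤ 2 * m ∧
      ((((l : ℤ) + m).toNat : ℤ)) = l + m := by
    intro l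
    have := Finset.mem_Icc.1 l.2
    omega
  let u : Finset.Icc (-(m : ℤ)) m → V := fun l => (f ^ ((l : ℤ) + m).toNat) v
  have hu : ∀ l, a (u l) = (-(Complex.I * ((l : ℤ) : ℂ))) • u l := by
    intro l
    change a ((f ^ ((l : ℤ) + m).toNat) v) = _
    rw [ladder_weight haf hav]
    congr 1
    have : ((((l : ℤ) + m).toNat : ℕ) : ℂ) = (((l : ℤ) + m : ℤ) : ℂ) := by
      rw [← Int.cast_natCast, (hbound l).2]
    rw [this]
    push_cast
    ring
  have hli : LinearIndependent ℂ u := by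
    -- Eigenvectors for distinct eigenvalues are independent. With the bound on the dimension, these
    -- `2m + 1` vectors form a basis.
    refine Module.End.eigenvectors_linearIndependent' a
      (fun l : Finset.Icc (-(m : ℤ)) m => -(Complex.I * ((l : ℤ) : ℂ))) (fun x y hxy => ?_) u
      fun l => Module.End.hasEigenvector_iff.2
        ⟨Module.End.mem_eigenspace_iff.2 (hu l), ladder_ne_zero haf hef hav hev hv (hbound l).1⟩
    have : ((x : ℤ) : ℂ) = ((y : ℤ) : ℂ) := by simpa [Complex.I_ne_zero] using hxy
    exact Subtype.ext (by exact_mod_cast this)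
  have hcard : Fintype.card (Finset.Icc (-(m : ℤ)) m) = 2 * m + 1 := by
    simp
    omega
  have hnonempty : Nonempty (Finset.Icc (-(m : ℤ)) m) := ⟨⟨0, by simp⟩⟩
  refine ⟨basisOfLinearIndependentOfCardEqFinrank hli
    (le_antisymm hli.fintype_card_le_finrank (hcard ▸ hdim)), fun l => ?_, fun l => ?_⟩
  · rw [coe_basisOfLinearIndependentOfCardEqFinrank]
    exact hu l
  · rw [coe_basisOfLinearIndependentOfCardEqFinrank]

end Ladder

/-! ### Harmonic polynomials and the highest weight vector -/

section Harmonic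

local notation "R3" => MvPolynomial (Fin 3) ℂ

theorem harmonic_eq_zero {m : ℕ} {p : R3} (hp : p ∈ harmonic m)
    (h : ∀ d : Fin 3 →₀ ℕ, d 2 ≤ 1 → d 0 + d 1 + d 2 = m → coeff d p = 0) : p = 0 := by
  have hlap : ∑ i, pderiv i (pderiv i p) = 0 := by
    rw [← polyLaplacian_apply]
    exact hp.2
  have key : ∀ n, ∀ d : Fin 3 →₀ ℕ, d 2 = n → coeff d p = 0 := by
    intro n
    induction n using Nat.strong_induction_on with
    | _ n ih =>
      intro d hd
      by_cases hdeg : d 0 + d 1 + d 2 = m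
      · by_cases hn : n ≤ 1
        · exact h d (by omega) hdeg
        -- The coefficient of the Laplacian at this index expresses the coefficient at `d` through
        -- two coefficients with third exponent `n - 2`.
        · set d' : Fin 3 →₀ ℕ := d - Finsupp.single 2 2 with hd'
          have hd2 : d' + Finsupp.single 2 1 + Finsupp.single 2 1 = d := by
            ext i
            simp only [hd', Finsupp.add_apply, Finsupp.tsub_apply]
            fin_cases i <;> simp
            omega
          have hd'2 : d' 2 = n - 2 := by simp [hd', hd]
          have h1 := congrArg (coeff d') hlap
          rw [coeff_sum, Fin.sum_univ_three] at h1
          simp only [coeff_pderiv, coeff_zero, hd2] at h1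
          rw [ih (n - 2) (by omega) _ (by simp [hd'2]), ih (n - 2) (by omega) _ (by simp [hd'2])]
            at h1
          simp only [zero_mul, zero_add, mul_eq_zero] at h1
          rcases h1 with (h1 | h1) | h1
          · exact h1
          · exact absurd h1 (Nat.cast_add_one_ne_zero _)
          · exact absurd h1 (Nat.cast_add_one_ne_zero _)
      · refine ((mem_homogeneousSubmodule m p).1 hp.1).coeff_eq_zero ?_
        rw [Finsupp.degree_eq_sum, Fin.sum_univ_three]
        exact hdeg
  ext d
  exact (key _ d rfl).trans (by simp)

/-- The multi-indices of degree `m` whose last entry is at most `1`. -/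
def lowIndex (m : ℕ) : Fin (m + 1) ⊕ Fin m → (Fin 3 →₀ ℕ)
  | .inl i => Finsupp.equivFunOnFinite.symm ![i, m - i, 0]
  | .inr i => Finsupp.equivFunOnFinite.symm ![i, m - 1 - i, 1]

/-- A harmonic polynomial is determined by its coefficients with third exponent `0` or `1`; in
degree `m` there are `m + 1` and `m` of these. -/
theorem finrank_H_le (m : ℕ) : Module.finrank ℂ (H m) ≤ 2 * m + 1 := by
  let T : H m →ₗ[ℂ] (Fin (m + 1) ⊕ Fin m → ℂ) :=
    { toFun := fun p i => coeff (lowIndex m i) (toPoly m p : R3)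
      map_add' := fun p q => by ext i; simp
      map_smul' := fun c p => by ext i; simp }
  have hT : Function.Injective T := by
    rw [← LinearMap.ker_eq_bot, LinearMap.ker_eq_bot']
    intro p hp
    apply (toPoly m).injective
    ext1
    rw [map_zero]
    refine harmonic_eq_zero (toPoly m p).2 fun d hd hdeg => ?_
    have h2 : d 2 = 0 ∨ d 2 = 1 := by omega
    rcases h2 with h2 | h2
    · have h1 := congrFun hp (.inl ⟨d 0, by omega⟩)
      have h3 : lowIndex m (.inl ⟨d 0, by omega⟩) = d := by
        ext i
        fin_cases i <;> simp [lowIndex, h2]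
        omega
      rw [← h3]
      exact h1
    · have h1 := congrFun hp (.inr ⟨d 0, by omega⟩)
      have h3 : lowIndex m (.inr ⟨d 0, by omega⟩) = d := by
        ext i
        fin_cases i <;> simp [lowIndex, h2]
        omega
      rw [← h3]
      exact h1
  refine (LinearMap.finrank_le_finrank_of_injective hT).trans ?_
  rw [Module.finrank_pi, Fintype.card_sum, Fintype.card_fin, Fintype.card_fin]
  omega

/-- The linear form `x₁ + i x₂`. -/
def highForm : R3 := X 0 + C Complex.I * X 1

theorem pderiv_highForm (i : Fin 3) : pderiv i highForm = C (![1, Complex.I, 0] i) := by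
  fin_cases i <;> simp [highForm, pderiv_X]

/-- The coefficient vector `(1, i, 0)` is isotropic, so the Laplacian of any power of the form
vanishes. -/
theorem highForm_pow_mem (m : ℕ) : highForm ^ m ∈ harmonic m := by
  refine ⟨?_, ?_⟩
  · rw [SetLike.mem_coe, mem_homogeneousSubmodule]
    have h : highForm.IsHomogeneous 1 := (isHomogeneous_X ℂ 0).add (by
      simpa using (isHomogeneous_C (Fin 3) Complex.I).mul (isHomogeneous_X ℂ 1))
    simpa using h.pow m
  · rw [SetLike.mem_coe, LinearMap.mem_ker, polyLaplacian_apply]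
    have h : ∀ i, pderiv i (pderiv i (highForm ^ m)) =
        (m • (m - 1) • highForm ^ (m - 1 - 1)) * C ((![1, Complex.I, 0] i) ^ 2) := by
      intro i
      rw [Derivation.leibniz_pow, pderiv_highForm, map_nsmul, smul_eq_mul, Derivation.leibniz,
        pderiv_C, smul_zero, zero_add, Derivation.leibniz_pow, pderiv_highForm, smul_eq_mul,
        smul_eq_mul, C_pow]
      simp only [nsmul_eq_mul]
      ring
    simp only [h, ← Finset.mul_sum, ← map_sum C]
    have : ∑ i : Fin 3, (![1, Complex.I, 0] i) ^ 2 = 0 := by simp [Fin.sum_univ_three]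
    rw [this, C_0, mul_zero]

theorem highForm_ne_zero : highForm ≠ 0 := by
  intro h
  have h1 := pderiv_highForm 0
  rw [h, map_zero] at h1
  simp at h1

/-- The vector `(x₁ + i x₂)^m` of `H_m`. -/
def highVec (m : ℕ) : H m := (toPoly m).symm ⟨highForm ^ m, highForm_pow_mem m⟩

theorem toPoly_highVec (m : ℕ) : (toPoly m (highVec m) : R3) = highForm ^ m := by
  rw [highVec, LinearEquiv.apply_symm_apply]

theorem highVec_ne_zero (m : ℕ) : highVec m ≠ 0 := by
  intro h
  have h1 := toPoly_highVec m
  rw [h, map_zero] at h1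
  exact pow_ne_zero m highForm_ne_zero h1.symm

theorem rotDer_unitVec_X (i j : Fin 3) : rotDer (unitVec i) (X j) =
    (![![0, -X 2, X 1], ![X 2, 0, -X 0], ![-X 1, X 0, 0]] : Fin 3 → Fin 3 → R3) i j := by
  rw [rotDer_X, Yv_coe]
  fin_cases i <;> fin_cases j <;> simp [Fin.sum_univ_three, unitVec]

theorem rotDer_highForm (i : Fin 3) : rotDer (unitVec i) highForm =
    ![-(C Complex.I * X 2), X 2, C Complex.I * highForm] i := by
  rw [highForm, map_add, Derivation.leibniz, ← algebraMap_eq, Derivation.map_algebraMap, smul_zero,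
    add_zero, rotDer_unitVec_X, rotDer_unitVec_X, smul_eq_mul, algebraMap_eq]
  have hI : (C Complex.I : R3) * C Complex.I = -1 := by
    rw [← C_mul, Complex.I_mul_I, C_neg, C_1]
  fin_cases i
  · simp
  · simp
  · simp
    linear_combination (-(X 1 : R3)) * hI

theorem rotDer_highForm_pow (i : Fin 3) (m : ℕ) : rotDer (unitVec i) (highForm ^ m) =
    m • (highForm ^ (m - 1) * ![-(C Complex.I * X 2), X 2, C Complex.I * highForm] i) := by
  rw [Derivation.leibniz_pow, rotDer_highForm, smul_eq_mul]

theorem rotDer_comm (p : R3) :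
    rotDer (unitVec 0) (rotDer (unitVec 1) p) - rotDer (unitVec 1) (rotDer (unitVec 0) p) =
      -rotDer (unitVec 2) p ∧
    rotDer (unitVec 1) (rotDer (unitVec 2) p) - rotDer (unitVec 2) (rotDer (unitVec 1) p) =
      -rotDer (unitVec 0) p ∧
    rotDer (unitVec 2) (rotDer (unitVec 0) p) - rotDer (unitVec 0) (rotDer (unitVec 2) p) =
      -rotDer (unitVec 1) p := by
  have h : ∀ a b c : Fin 3, (∀ j, ⁅rotDer (unitVec a), rotDer (unitVec b)⁆ (X j) =
      (-rotDer (unitVec c)) (X j)) → rotDer (unitVec a) (rotDer (unitVec b) p) -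
        rotDer (unitVec b) (rotDer (unitVec a) p) = -rotDer (unitVec c) p := by
    intro a b c habc
    have := congrArg (fun D : Derivation ℂ R3 R3 => D p) (derivation_ext habc)
    rwa [Derivation.commutator_apply] at this
  refine ⟨h _ _ _ fun j => ?_, h _ _ _ fun j => ?_, h _ _ _ fun j => ?_⟩ <;>
  · rw [Derivation.commutator_apply, Derivation.neg_apply]
    fin_cases j <;> simp [rotDer_unitVec_X]

theorem dtau_comm (m : ℕ) (p : H m) :
    dtau m (unitVec 0) (dtau m (unitVec 1) p) - dtau m (unitVec 1) (dtau m (unitVec 0) p) =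
      -dtau m (unitVec 2) p ∧
    dtau m (unitVec 1) (dtau m (unitVec 2) p) - dtau m (unitVec 2) (dtau m (unitVec 1) p) =
      -dtau m (unitVec 0) p ∧
    dtau m (unitVec 2) (dtau m (unitVec 0) p) - dtau m (unitVec 0) (dtau m (unitVec 2) p) =
      -dtau m (unitVec 1) p := by
  obtain ⟨h1, h2, h3⟩ := rotDer_comm (toPoly m p)
  refine ⟨?_, ?_, ?_⟩ <;> apply (toPoly m).injective <;> ext1
  · simpa [toPoly_dtau] using h1
  · simpa [toPoly_dtau] using h2
  · simpa [toPoly_dtau] using h3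

theorem isWeightRep_tau (m : ℕ) : IsWeightRep (tau m) (dtau m) m := by
  set A := fun i => dtau m (unitVec i) with hA
  -- Raising and lowering operators for the relations `[A₀, A₁] = -A₂` and cyclic; `e` annihilates
  -- `(x₁ + i x₂)^m`.
  set e : H m →ₗ[ℂ] H m := ((A 0 + Complex.I • A 1 : H m →L[ℂ] H m) : H m →ₗ[ℂ] H m) with he
  set f : H m →ₗ[ℂ] H m := ((Complex.I • A 1 - A 0 : H m →L[ℂ] H m) : H m →ₗ[ℂ] H m) with hf
  set a : H m →ₗ[ℂ] H m := (A 2 : H m →ₗ[ℂ] H m) with ha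
  have hea : ∀ x, e x = A 0 x + Complex.I • A 1 x := fun x => rfl
  have hfa : ∀ x, f x = Complex.I • A 1 x - A 0 x := fun x => rfl
  have haa : ∀ x, a x = A 2 x := fun x => rfl
  have h01 : ∀ x, A 0 (A 1 x) = A 1 (A 0 x) - A 2 x := fun x => by
    rw [sub_eq_add_neg, ← (dtau_comm m x).1]; abel
  have h21 : ∀ x, A 2 (A 1 x) = A 1 (A 2 x) + A 0 x := fun x => by
    rw [← sub_neg_eq_add, ← (dtau_comm m x).2.1]; abel
  have h20 : ∀ x, A 2 (A 0 x) = A 0 (A 2 x) - A 1 x := fun x => by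
    rw [sub_eq_add_neg, ← (dtau_comm m x).2.2]; abel
  have haf : ∀ x, a (f x) = f (a x) - Complex.I • f x := by
    intro x
    simp only [hfa, haa, map_sub, map_smul, h21, h20, smul_sub, smul_add, smul_smul,
      Complex.I_mul_I]
    module
  have hef : ∀ x, e (f x) = f (e x) - (2 * Complex.I) • a x := by
    intro x
    simp only [hfa, haa, hea, map_sub, map_add, map_smul, h01, smul_sub, smul_add, smul_smul,
      Complex.I_mul_I]
    module
  have hpoly : ∀ i, (toPoly m (A i (highVec m)) : R3) = m • (highForm ^ (m - 1) *
      ![-(C Complex.I * X 2), X 2, C Complex.I * highForm] i) := by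
    intro i
    rw [hA, toPoly_dtau, toPoly_highVec, rotDer_highForm_pow]
  have hav : a (highVec m) = (Complex.I * m) • highVec m := by
    apply (toPoly m).injective
    ext1
    rw [haa, hpoly, map_smul, Submodule.coe_smul, toPoly_highVec, smul_eq_C_mul, C_mul]
    rcases m with _ | m
    · simp
    · simp [pow_succ]
      ring
  have hev : e (highVec m) = 0 := by
    apply (toPoly m).injective
    ext1
    rw [hea, map_add, map_smul, Submodule.coe_add, Submodule.coe_smul, hpoly, hpoly, smul_eq_C_mul]
    simp
    ring
  obtain ⟨b, hb, hbf⟩ := exists_ladder_basis (finrank_H_le m) haf hef hav hev (highVec_ne_zero m)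
  refine ⟨adjoint_tau m, hasDerivAt_tau m, ⟨b, hb⟩, fun B hB => ?_⟩
  have hJ : ∀ w, dtau m w * B = B * dtau m w := fun w =>
    ((hasDerivAt_tau m w).mul_const B).unique (((hasDerivAt_tau m w).const_mul B).congr_of_eventuallyEq
      (Eventually.of_forall fun t => hB _))
  have hBA : ∀ i x, B (A i x) = A i (B x) := fun i x =>
    congrArg (fun T : H m →L[ℂ] H m => T x) (hJ (unitVec i)).symm
  have hBf : ∀ x, B (f x) = f (B x) := fun x => by
    simp only [hfa, map_sub, map_smul, hBA]
  obtain ⟨c, hc⟩ := IsWeightRep.exists_diag hb (hJ (unitVec 2))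
  -- The index `-m` labels the highest weight vector, of `a`-eigenvalue `i m`. An operator commuting
  -- with `τ_m` scales it, and then scales the whole ladder by the same constant since it commutes
  -- with `f`.
  set l₀ : Finset.Icc (-(m : ℤ)) m := ⟨-m, by simp⟩
  have hv : B (highVec m) = c l₀ • highVec m := by
    have h1 := hc l₀
    rw [hbf] at h1
    simpa [l₀] using h1
  refine ⟨c l₀, ContinuousLinearMap.coe_injective (b.ext fun l => ?_)⟩
  change B (b l) = c l₀ • b l
  rw [hbf]
  generalize ((l : ℤ) + m).toNat = k
  induction k with
  | zero => simpa using hv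
  | succ k ih => rw [pow_succ', Module.End.mul_apply, hBf, ih, map_smul]

theorem isWeightRep_one : IsWeightRep (1 : SO3 →* (ℂ →L[ℂ] ℂ)) 0 0 := by
  refine ⟨fun k => ?_, fun w => hasDerivAt_const _ _, ?_, fun A _ => ⟨A 1, ?_⟩⟩
  · rw [MonoidHom.one_apply, MonoidHom.one_apply]
    exact ContinuousLinearMap.adjoint_id
  · have : Unique (Finset.Icc (-((0 : ℕ) : ℤ)) (0 : ℕ)) :=
      ⟨⟨⟨0, by simp⟩⟩, fun x => Subtype.ext (by simpa using x.2)⟩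
    refine ⟨Module.Basis.singleton _ ℂ, fun l => ?_⟩
    have hl : (l : ℤ) = 0 := by simpa using l.2
    simp [hl]
  · ext
    simp

end Harmonic

/-! ### Classification of the spherical functions of `τ_m` -/

section Main

variable {V : Type*} [NormedAddCommGroup V] [InnerProductSpace ℂ V] [FiniteDimensional ℂ V]
variable {τ : SO3 →* (V →L[ℂ] V)} {J : E3 →ₗ[ℝ] (V →L[ℂ] V)} {m : ℕ}

theorem laplacian_postComp {W W' : Type*} [NormedAddCommGroup W] [NormedSpace ℂ W]
    [NormedAddCommGroup W'] [NormedSpace ℂ W'] (T : W →L[ℂ] W') (f : Smooth W) (x : E3) :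
    Laplacian.laplacian (postComp T f).1 x = T (Laplacian.laplacian f.1 x) := by
  rw [laplacian_eq, laplacian_eq]
  simp only [pd_postComp]
  rw [← map_sum, postComp_apply]

/-- For the trivial representation `D_τ = 0`, so the eigenvalue condition with `j = 0` holds
automatically. -/
theorem isClassicalSpherical_iff {s : ℝ} {φ : Smooth ℂ} : IsClassicalSpherical s φ ↔
    IsSphericalEigen (1 : SO3 →* (ℂ →L[ℂ] ℂ)) s 0 (smulI ℂ φ) := by
  have hsm : smulI ℂ φ =
      postComp (ContinuousLinearMap.toSpanSingleton ℂ (1 : ℂ →L[ℂ] ℂ)) φ :=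
    Subtype.ext (funext fun x => (ContinuousLinearMap.toSpanSingleton_apply _ _ _).symm)
  have hlap : ∀ x, Laplacian.laplacian (smulI ℂ φ).1 x =
      Laplacian.laplacian φ.1 x • (1 : ℂ →L[ℂ] ℂ) := fun x => by
    rw [hsm, laplacian_postComp, ContinuousLinearMap.toSpanSingleton_apply]
  have hval : ∀ x, (smulI ℂ φ).1 x = φ.1 x • (1 : ℂ →L[ℂ] ℂ) := fun _ => rfl
  refine ⟨fun h => ⟨h.1, fun x => ?_, ?_⟩, fun h => ⟨h.spherical, fun x => ?_⟩⟩
  · rw [hlap, hval, h.2 x, smul_smul]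
  · rw [isWeightRep_one.Dop_eq, Int.cast_zero, mul_zero, zero_smul]
    refine Finset.sum_eq_zero fun i _ => ?_
    rw [LinearMap.zero_apply, map_zero]
    rfl
  · have h1 := congrArg (fun T : ℂ →L[ℂ] ℂ => T 1) (h.laplacian_eq x)
    rw [hlap, hval, smul_smul] at h1
    simpa using h1

theorem smulI_injective : Function.Injective (smulI ℂ) := by
  intro φ ψ h
  ext1
  funext x
  have h1 := congrArg (fun f : Smooth (ℂ →L[ℂ] ℂ) => f.1 x 1) h
  simpa [smulI] using h1

theorem Dlagrange_zero (s : ℝ) (τ : SO3 →* (V →L[ℂ] V)) (f : Smooth (V →L[ℂ] V)) :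
    Dlagrange τ 0 s 0 f = f := by
  have : (Finset.Icc (-((0 : ℕ) : ℤ)) (0 : ℕ)).erase 0 = ∅ := by simp
  rw [Dlagrange, this, Finset.prod_empty, map_one, Module.End.one_apply]

theorem isClassicalSpherical_classicalSpherical {s : ℝ} (hs : 0 < s) :
    IsClassicalSpherical s (classicalSpherical s) := by
  rw [isClassicalSpherical_iff]
  have h := isWeightRep_one.isSphericalEigen hs.ne' (j := 0) (by simp)
  rw [Dlagrange_zero] at h
  simpa using h

theorem IsClassicalSpherical.eq {s : ℝ} (hs : 0 < s) {φ ψ : Smooth ℂ}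
    (hφ : IsClassicalSpherical s φ) (hψ : IsClassicalSpherical s ψ) : φ = ψ :=
  smulI_injective (isWeightRep_one.eq_of_isSphericalEigen hs (isClassicalSpherical_iff.1 hφ)
    (isClassicalSpherical_iff.1 hψ))

theorem eq_of_ae_eq_smooth {W : Type*} [NormedAddCommGroup W] [NormedSpace ℂ W] {f g : Smooth W}
    (h : f.1 =ᵐ[volume] g.1) : f = g :=
  Subtype.ext ((continuous_smooth f).ae_eq_iff_eq volume (continuous_smooth g) |>.1 h)

/-- The Laplacian of a constant vanishes, whereas `-s² Φ(0)` has trace `-s² (2m + 1) ≠ 0`. -/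
theorem IsWeightRep.not_ae_one (h : IsWeightRep τ J m) {s : ℝ} (hs : 0 < s) {j : ℤ}
    {Φ : Smooth (V →L[ℂ] V)} (hΦ : IsSphericalEigen τ s j Φ) :
    ¬ Φ.1 =ᵐ[volume] fun _ => ContinuousLinearMap.id ℂ V := by
  intro hone
  have heq := (continuous_smooth Φ).ae_eq_iff_eq volume continuous_const |>.1 hone
  have h1 := hΦ.laplacian_eq 0
  have hpd : ∀ v, pd v Φ = 0 := fun v => Subtype.ext (funext fun x => by
    rw [pd_apply, heq]
    simp)
  rw [EuclideanMotion.laplacian_eq] at h1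
  simp only [hpd, map_zero, Finset.sum_const_zero] at h1
  have h2 := congrArg (tr V) h1
  rw [map_smul, h.tr_zero hΦ.spherical, h.finrank_eq] at h2
  have hne : ((2 * m + 1 : ℕ) : ℂ) ≠ 0 := Nat.cast_ne_zero.2 (by omega)
  have hs0 : (s : ℂ) ≠ 0 := Complex.ofReal_ne_zero.2 hs.ne'
  exact smul_ne_zero (neg_ne_zero.2 (pow_ne_zero 2 hs0)) hne (h2.symm.trans (map_zero _))

/-- Both eigenvalues can be read off at the origin, where `Φ` has nonzero trace; positivity selects
the root of `s²`. -/
theorem IsWeightRep.eigenvalues_unique (h : IsWeightRep τ J m) {s t : ℝ} (hs : 0 < s) (ht : 0 < t)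
    {j l : ℤ} {Φ : Smooth (V →L[ℂ] V)} (h₁ : IsSphericalEigen τ s j Φ)
    (h₂ : IsSphericalEigen τ t l Φ) : s = t ∧ j = l := by
  have hne : Φ.1 0 ≠ 0 := fun h0 => by
    have := h.tr_zero h₁.spherical
    rw [h0, map_zero, h.finrank_eq] at this
    exact (Nat.cast_ne_zero (R := ℂ)).2 (by omega : 2 * m + 1 ≠ 0) this.symm
  have h1 := smul_left_injective ℂ hne ((h₁.laplacian_eq 0).symm.trans (h₂.laplacian_eq 0))
  have hst : s = t := by
    have h2 : s ^ 2 = t ^ 2 := by exact_mod_cast neg_injective h1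
    exact (pow_left_inj₀ hs.le ht.le two_ne_zero).1 h2
  refine ⟨hst, ?_⟩
  subst hst
  have h3 := congrArg (fun f : Smooth (V →L[ℂ] V) => f.1 0) (h₁.Dop_eq.symm.trans h₂.Dop_eq)
  have h4 := smul_left_injective ℂ hne h3
  have h5 := mul_left_cancel₀ (Complex.ofReal_ne_zero.2 hs.ne') h4
  exact_mod_cast h5

end Main

end EuclideanMotion

end

open EuclideanMotion in
theorem theorem4 (m : ℕ) :
    ∃ φ : ℝ → Smooth ℂ,
      -- `φ s` is the classical spherical function with eigenvalue `-s²`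
      (∀ s : ℝ, 0 < s →
        IsClassicalSpherical s (φ s) ∧ ∀ ψ : Smooth ℂ, IsClassicalSpherical s ψ → ψ = φ s) ∧
      -- `(2m+1) D_{s,j}(φ_s I)` is the spherical function with eigenvalues `-s²` and `s j`,
      -- and it is not the constant `I`
      (∀ s : ℝ, 0 < s → ∀ j ∈ Finset.Icc (-(m : ℤ)) m,
        (∀ Φ : Smooth (H m →L[ℂ] H m), IsSphericalEigen (tau m) s j Φ ↔
          Φ = (2 * (m : ℂ) + 1) • Dlagrange (tau m) m s j (smulI (H m) (φ s))) ∧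
        ¬ ((2 * (m : ℂ) + 1) • Dlagrange (tau m) m s j (smulI (H m) (φ s))).1 =ᵐ[volume]
          fun _ => ContinuousLinearMap.id ℂ (H m)) ∧
      -- every spherical function other than the constant `I` arises so, from exactly one `(s, j)`
      (∀ Φ : E3 → (H m →L[ℂ] H m), IsSpherical (tau m) Φ →
        ¬ Φ =ᵐ[volume] (fun _ => ContinuousLinearMap.id ℂ (H m)) →
        ∃! p : ℝ × ℤ, 0 < p.1 ∧ p.2 ∈ Finset.Icc (-(m : ℤ)) m ∧
          Φ =ᵐ[volume]
            ((2 * (m : ℂ) + 1) • Dlagrange (tau m) m p.1 p.2 (smulI (H m) (φ p.1))).1) := by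
  have h := isWeightRep_tau m
  refine ⟨classicalSpherical, fun s hs => ⟨isClassicalSpherical_classicalSpherical hs,
    fun ψ hψ => hψ.eq hs (isClassicalSpherical_classicalSpherical hs)⟩,
    fun s hs j hj => ?_, fun Φ hΦ hne => ?_⟩
  · have hex := h.isSphericalEigen hs.ne' hj
    refine ⟨fun Φ => ⟨fun hΦ => h.eq_of_isSphericalEigen hs hΦ hex, fun hΦ => hΦ ▸ hex⟩,
      h.not_ae_one hs hex⟩
  · obtain ⟨Ψ, hΨ, hsph⟩ := h.exists_smooth hΦ
    rcases h.classification hsph with h1 | ⟨s, hs, j, hj, heig⟩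
    · exact absurd (hΨ.trans (Eventually.of_forall h1)) hne
    · have hEq := h.eq_of_isSphericalEigen hs heig (h.isSphericalEigen hs.ne' hj)
      refine ⟨(s, j), ⟨hs, hj, hEq ▸ hΨ⟩, ?_⟩
      rintro ⟨t, l⟩ ⟨ht, hl, hl'⟩
      have hEq' := eq_of_ae_eq_smooth (hΨ.symm.trans hl')
      have hu := h.eigenvalues_unique hs ht heig (hEq' ▸ h.isSphericalEigen ht.ne' hl)
      exact Prod.ext hu.1.symm hu.2.symm
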